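/- **Setting.** Let $T=(V,E)$ be a locally finite tree with root $o\in V$ and graph distance $d$. Put $\Lambda_n=\{x: d(o,x)=n\}$, $\Lambda_{[0,n]}=\{x:d(o,x)\le n\}$, $S(x)=\{y\sim x: d(o,y)>d(o,x)\}$ (direct successors), and let $P(x)$ be the set of vertices other than $x$ on the path from $o$ to $x$. For every $x\in V$ let $\mathcal A_x\neq 0$ be a finite-dimensional $C^*$-algebra (for instance $M_{d_x}(\mathbb C)$). For $\Lambda\subset V$ finite let $\mathcal A_\Lambda=\bigotimes_{x\in\Lambda}\mathcal A_x$, with $\mathcal A_\emptyset=\mathbb C1$, and let $\mathcal A_V=\bigotimes_{x\in V}\mathcal A_x$ be the quasi-local $C^*$-algebra, in which all the $\mathcal A_\Lambda$ are contained. A *quasi-conditional expectation* with respect to unital $C^*$-algebras $\mathcal C\subset\mathcal B\subset\mathcal A$ is a completely positive, identity preserving linear map $E:\mathcal A\to\mathcal B$ with $E(ca)=cE(a)$ for $c\in\mathcal C$, $a\in\mathcal A$. A state $\varphi$ on $\mathcal A_V$ is a *localized quantum Markov state* if there are quasi-conditional expectations $E_n$ with respect to $\mathcal A_{\Lambda_{[0,n-1]}}\subset\mathcal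 A_{\Lambda_{[0,n]}}\subset\mathcal A_{\Lambda_{[0,n+1]}}$, $n\ge 0$ (where $\Lambda_{[0,-1]}=\emptyset$), such that 1. $\varphi(a)=\lim_{n\to\infty}\varphi_0\circ E_0\circ E_1\circ\cdots\circ E_n(a)$ for every local $a$, where $\varphi_0$ is the restriction of $\varphi$ to $\mathcal A_o$; 2. for all $n$ and $x\in\Lambda_n$, $E_n$ maps $\mathcal A_{\{x\}\cup S(x)}$ into $\mathcal A_{x}$ and $\mathcal A_{P(x)\cup\{x\}\cup S(x)}$ into $\mathcal A_{P(x)\cup\{x\}}$, and $E_n=\mathrm{id}_{\mathcal A_{\Lambda_{[0,n-1]}}}\otimes\bigotimes_{x\in\Lambda_n}E_n\lceil_{\mathcal A_{\{x\}\cup S(x)}}$; 3. for all $n$ and $x\in\Lambda_n$, $\varphi\circ E_n=\varphi$ on $\mathcal A_{P(x)\cup\{x\}\cup S(x)}$. **Theorem.** Let $\varphi$ be a localized quantum Markov state on $\mathcal A_V$. Then there exist * a diagonal algebra $\mathcal D_V\subset\mathcal A_V$, that is, a maximal abelian $*$-subalgebra which is the norm closure of the $*$-algebra generated by $*$-subalgebras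 $\mathcal D_x\subset\mathcal A_{\{x\}\cup S(x)}$, $x\in V$; * a Borel probability measure $\mu$ on $\mathrm{spec}(\mathcal D_V)$ which is a Markov random field on $T$: with $X_x(\chi)=\chi\lceil_{\mathcal D_x}$ for $\chi\in\mathrm{spec}(\mathcal D_V)$, for every finite $\Lambda\subset V$ the families $(X_x)_{x\in\Lambda}$ and $(X_x)_{x\notin\Lambda}$ are conditionally independent given $(X_y)_{y\in\partial\Lambda}$, where $\partial\Lambda$ is the set of vertices outside of $\Lambda$ that have a neighbour in $\Lambda$; * a Umegaki conditional expectation $\mathfrak E:\mathcal A_V\to\mathcal D_V$, that is, a positive projection of norm one onto $\mathcal D_V$ which is a $\mathcal D_V$-bimodule map; such that $\varphi=\varphi_\mu\circ\mathfrak E$, where $\varphi_\mu(b)=\int\chi(b)\,d\mu(\chi)$ for $b\in\mathcal D_V$. -/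

import Mathlib

open scoped ComplexOrder ENNReal

noncomputable section

namespace TreeQMS

open MeasureTheory ProbabilityTheory Filter Topology

/-! ### The quasi-local algebra

The site algebra at `x` is a finite-dimensional C*-algebra, given as a unital *-subalgebra `𝒜 x` of
a full matrix algebra of size `d x ≥ 1` (every finite-dimensional C*-algebra is of this form; the
full matrix algebra is `𝒜 x = ⊤`). The infinite tensor product of the site algebras is realized
faithfully on the Hilbert space whose orthonormal basis consists of the configurations that are
equal to the reference state `0` off a finite set of sites. -/

section Algebra

variable {V : Type*} (d : V → ℕ) [∀ x, NeZero (d x)]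

/-- Configurations that differ from the reference configuration `0` at finitely many sites. -/
def Config : Type _ := {s : ∀ x, Fin (d x) // {x | s x ≠ 0}.Finite}

variable {d}

open Classical in
/-- Replace the value of the configuration `s` at the site `x` by `i`. -/
def Config.update (s : Config d) (x : V) (i : Fin (d x)) : Config d :=
  ⟨Function.update s.1 x i, (s.2.union (Set.finite_singleton x)).subset (by
    intro y hy
    by_cases h : y = x
    · exact Or.inr h
    · left
      have hy' : Function.update s.1 x i y ≠ 0 := hy
      rwa [Function.update_of_ne h] at hy')⟩

theorem Config.update_injOn (x : V) (i j : Fin (d x)) (s t : Config d) (hs : s.1 x = i)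
    (ht : t.1 x = i) (h : s.update x j = t.update x j) : s = t := by
  classical
  apply Subtype.ext
  funext y
  by_cases hy : y = x
  · subst hy
    rw [hs, ht]
  · have := congrFun (congrArg Subtype.val h) y
    simpa [Config.update, Function.update_of_ne hy] using this

variable (d)

/-- The Hilbert space `ℓ²` over the configurations. -/
abbrev Hilb : Type _ := lp (fun _ : Config d => ℂ) 2

/-- The bounded operators on `Hilb d`. -/
abbrev Op : Type _ := Hilb d →L[ℂ] Hilb d

variable {d}

open Classical in
/-- The coordinates of the image of `f` under the matrix unit `e_{ij}` acting at the site `x`. -/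
def unitFun (x : V) (i j : Fin (d x)) (f : Hilb d) (s : Config d) : ℂ :=
  if s.1 x = i then f (s.update x j) else 0

theorem unitFun_sum_le (x : V) (i j : Fin (d x)) (f : Hilb d) (F : Finset (Config d)) :
    ∑ s ∈ F, ‖unitFun x i j f s‖ ^ (2 : ℝ≥0∞).toReal ≤ ‖f‖ ^ (2 : ℝ≥0∞).toReal := by
  classical
  have h1 : ∑ s ∈ F, ‖unitFun x i j f s‖ ^ (2 : ℝ≥0∞).toReal
      = ∑ s ∈ F.filter (fun s => s.1 x = i), ‖f (s.update x j)‖ ^ (2 : ℝ≥0∞).toReal := by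
    rw [Finset.sum_filter]
    refine Finset.sum_congr rfl fun s _ => ?_
    unfold unitFun
    split_ifs <;> simp
  have h2 : ∑ s ∈ F.filter (fun s => s.1 x = i), ‖f (s.update x j)‖ ^ (2 : ℝ≥0∞).toReal
      = ∑ t ∈ (F.filter (fun s => s.1 x = i)).image (fun s => s.update x j),
          ‖f t‖ ^ (2 : ℝ≥0∞).toReal := by
    rw [Finset.sum_image]
    intro s hs t ht h
    exact Config.update_injOn x i j s t (by simpa using (Finset.mem_filter.1 hs).2)
      (by simpa using (Finset.mem_filter.1 ht).2) h
  rw [h1, h2]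
  exact lp.sum_rpow_le_norm_rpow (by norm_num) f _

/-- The matrix unit `e_{ij}` acting at the site `x`. -/
def unitOp (x : V) (i j : Fin (d x)) : Op d :=
  LinearMap.mkContinuous
    { toFun := fun f => ⟨unitFun x i j f, memℓp_gen' (unitFun_sum_le x i j f)⟩
      map_add' := by
        intro f g
        ext s
        simp only [unitFun, lp.coeFn_add, Pi.add_apply]
        split_ifs <;> simp
      map_smul' := by
        intro c f
        ext s
        simp only [unitFun, lp.coeFn_smul, Pi.smul_apply, RingHom.id_apply]
        split_ifs <;> simp }
    1 (by
      intro f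
      rw [one_mul]
      exact lp.norm_le_of_forall_sum_le (by norm_num) (norm_nonneg f) (unitFun_sum_le x i j f))

/-- The matrix `a` acting at the site `x` (and as the identity at all other sites). -/
def siteOp (x : V) (a : Matrix (Fin (d x)) (Fin (d x)) ℂ) : Op d :=
  ∑ i, ∑ j, a i j • unitOp x i j

/-- The action of a site operator in coordinates. -/
theorem siteOp_apply (x : V) (a : Matrix (Fin (d x)) (Fin (d x)) ℂ) (f : Hilb d) (s : Config d) :
    siteOp x a f s = ∑ j, a (s.1 x) j * f (s.update x j) := by
  classical
  have h : ∀ i j, unitOp x i j f s = if s.1 x = i then f (s.update x j) else 0 := fun i j => rfl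
  have h2 : siteOp x a f s = ∑ i, ∑ j, a i j * unitOp x i j f s := by
    simp only [siteOp, sum_apply, smul_apply,
      lp.coeFn_sum, Finset.sum_apply, lp.coeFn_smul, Pi.smul_apply, smul_eq_mul]
  rw [h2, Finset.sum_comm]
  refine Finset.sum_congr rfl fun j _ => ?_
  simp [h]

variable (𝒜 : ∀ x, StarSubalgebra ℂ (Matrix (Fin (d x)) (Fin (d x)) ℂ))

/-- The local algebra `𝒜_Λ`, generated by the site algebras over `Λ`. For finite `Λ` it is the
tensor product of the site algebras over `Λ`; for `Λ = ∅` it is `ℂ 1`. -/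
def locAlg (Λ : Set V) : StarSubalgebra ℂ (Op d) :=
  StarAlgebra.adjoin ℂ {T | ∃ x ∈ Λ, ∃ a ∈ 𝒜 x, T = siteOp x a}

theorem locAlg_mono {Λ Λ' : Set V} (h : Λ ⊆ Λ') : locAlg 𝒜 Λ ≤ locAlg 𝒜 Λ' :=
  StarAlgebra.adjoin_mono (by
    rintro T ⟨x, hx, a, ha, rfl⟩
    exact ⟨x, h hx, a, ha, rfl⟩)

/-- The quasi-local algebra `𝒜_V`, the norm closure of the algebra of all local operators. -/
def quasiLocal : StarSubalgebra ℂ (Op d) :=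
  (locAlg 𝒜 Set.univ).topologicalClosure

/-- The embedding of a local algebra into the quasi-local algebra. -/
def incl (Λ : Set V) : locAlg 𝒜 Λ →⋆ₐ[ℂ] quasiLocal 𝒜 :=
  StarSubalgebra.inclusion
    ((locAlg_mono 𝒜 (Set.subset_univ Λ)).trans (StarSubalgebra.le_topologicalClosure _))

/-- States: normalized positive linear functionals. -/
structure IsState (φ : quasiLocal 𝒜 →ₗ[ℂ] ℂ) : Prop where
  map_one : φ 1 = 1
  nonneg : ∀ a, 0 ≤ φ (star a * a)

end Algebra

/-! ### Quasi-conditional expectations -/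

section QuasiCond

variable {V : Type*} {d : V → ℕ} [∀ x, NeZero (d x)]

/-- Complete positivity: for all `a₁, …, a_m` the operator matrix `(E (aᵢ* aⱼ))ᵢⱼ` is positive. -/
def IsCompletelyPositive {A B : StarSubalgebra ℂ (Op d)} (E : A →ₗ[ℂ] B) : Prop :=
  ∀ (m : ℕ) (a : Fin m → A) (ξ : Fin m → Hilb d),
    0 ≤ ∑ i, ∑ j, inner ℂ (ξ i) ((E (star (a i) * a j) : Op d) (ξ j))

/-- `E : A → B` is a quasi-conditional expectation with respect to `C ⊆ B ⊆ A`: it is completely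
positive, identity preserving, and left `C`-linear. -/
structure IsQuasiCondExp {A B : StarSubalgebra ℂ (Op d)} (C : StarSubalgebra ℂ (Op d))
    (E : A →ₗ[ℂ] B) : Prop where
  completelyPositive : IsCompletelyPositive E
  map_one : E 1 = 1
  map_mul : ∀ c a : A, (c : Op d) ∈ C → (E (c * a) : Op d) = (c : Op d) * (E a : Op d)

end QuasiCond

/-! ### Rooted trees -/

section Tree

variable {V : Type*} (G : SimpleGraph V) (o : V)

/-- The direct successors of `x` with respect to the root `o`. -/
def succs (x : V) : Set V := {y | G.Adj x y ∧ G.dist o x < G.dist o y}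

/-- The predecessors of `x`: the vertices other than `x` on the path from the root `o` to `x`. -/
def preds (x : V) : Set V := {y | y ≠ x ∧ ∃ w : G.Walk o x, w.IsPath ∧ y ∈ w.support}

/-- The ball `Λ_{[0,n]}`. -/
def ball (n : ℕ) : Set V := {x | G.dist o x ≤ n}

theorem ball_mono {m n : ℕ} (h : m ≤ n) : ball G o m ⊆ ball G o n :=
  fun _ hx => le_trans (show G.dist o _ ≤ m from hx) h

end Tree

/-! ### Localized quantum Markov states -/

section Markov

variable {V : Type*} (G : SimpleGraph V) (o : V) {d : V → ℕ} [∀ x, NeZero (d x)]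
  (𝒜 : ∀ x, StarSubalgebra ℂ (Matrix (Fin (d x)) (Fin (d x)) ℂ))

/-- The algebra `𝒜_{Λ_{[0,n]}}`. -/
abbrev ballAlg (n : ℕ) : StarSubalgebra ℂ (Op d) := locAlg 𝒜 (ball G o n)

variable {G o 𝒜} in
/-- The composition `E₀ ∘ E₁ ∘ ⋯ ∘ E_{n-1} : 𝒜_{Λ_{[0,n]}} → 𝒜_{Λ_{[0,0]}}`. -/
def chain (E : ∀ n, ballAlg G o 𝒜 (n + 1) →ₗ[ℂ] ballAlg G o 𝒜 n) :
    ∀ n, ballAlg G o 𝒜 n →ₗ[ℂ] ballAlg G o 𝒜 0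
  | 0 => LinearMap.id
  | n + 1 => (chain E n).comp (E n)

/-- `φ` is a quantum Markov chain with respect to the sequence `E` of maps
`Eₙ : 𝒜_{Λ_{[0,n+1]}} → 𝒜_{Λ_{[0,n]}}`: each `Eₙ` is a quasi-conditional expectation with respect
to `𝒜_{Λ_{[0,n-1]}} ⊆ 𝒜_{Λ_{[0,n]}} ⊆ 𝒜_{Λ_{[0,n+1]}}`, and
`φ = lim φ₀ ∘ E₀ ∘ E₁ ∘ ⋯ ∘ Eₙ` pointwise on local operators, where the initial state `φ₀` is the
restriction of `φ` to the site algebra of the root. -/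
structure IsQuantumMarkovChain (φ : quasiLocal 𝒜 →ₗ[ℂ] ℂ)
    (E : ∀ n, ballAlg G o 𝒜 (n + 1) →ₗ[ℂ] ballAlg G o 𝒜 n) : Prop where
  quasiCondExp : ∀ n, IsQuasiCondExp (locAlg 𝒜 {x | G.dist o x < n}) (E n)
  tendsto : ∀ (m : ℕ) (a : ballAlg G o 𝒜 m),
    Tendsto (fun k : ℕ => φ (incl 𝒜 _ (chain E (m + k)
      (StarSubalgebra.inclusion (locAlg_mono 𝒜 (ball_mono G o (Nat.le_add_right m k))) a))))
      atTop (𝓝 (φ (incl 𝒜 _ a)))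

/-- `φ` is a localized quantum Markov state: a quantum Markov chain for some maps `Eₙ` such that,
for every vertex `x` of level `n`,
* `Eₙ` restricts to a map `𝒜_{P(x) ∪ {x} ∪ S(x)} → 𝒜_{P(x) ∪ {x}}` (a quasi-conditional expectation
  with respect to `𝒜_{P(x)} ⊆ 𝒜_{P(x) ∪ {x}} ⊆ 𝒜_{P(x) ∪ {x} ∪ S(x)}`, as `Eₙ` is one);
* `Eₙ` restricts to a transition expectation `𝒜_{{x} ∪ S(x)} → 𝒜_{{x}}`, and it is the tensor
  product of this restriction and of its restriction to the algebra of the other vertices of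
  `Λ_{[0,n+1]}` (for all `x` together: `Eₙ` is the tensor product of the identity of
  `𝒜_{Λ_{[0,n-1]}}` and of the transition expectations at the vertices of level `n`);
* the Markov property `φ ∘ Eₙ = φ` holds on `𝒜_{P(x) ∪ {x} ∪ S(x)}`. -/
def IsLocalizedQMS (φ : quasiLocal 𝒜 →ₗ[ℂ] ℂ) : Prop :=
  ∃ E : ∀ n, ballAlg G o 𝒜 (n + 1) →ₗ[ℂ] ballAlg G o 𝒜 n,
    IsQuantumMarkovChain G o 𝒜 φ E ∧
    ∀ (n : ℕ) (x : V), G.dist o x = n →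
      (∀ a : ballAlg G o 𝒜 (n + 1),
        (a : Op d) ∈ locAlg 𝒜 (preds G o x ∪ {x} ∪ succs G o x) →
        (E n a : Op d) ∈ locAlg 𝒜 (preds G o x ∪ {x})) ∧
      (∀ a : ballAlg G o 𝒜 (n + 1), (a : Op d) ∈ locAlg 𝒜 ({x} ∪ succs G o x) →
        (E n a : Op d) ∈ locAlg 𝒜 {x}) ∧
      (∀ a b : ballAlg G o 𝒜 (n + 1), (a : Op d) ∈ locAlg 𝒜 ({x} ∪ succs G o x) →
        (b : Op d) ∈ locAlg 𝒜 (ball G o (n + 1) \ ({x} ∪ succs G o x)) →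
        E n (a * b) = E n a * E n b) ∧
      (∀ a : ballAlg G o 𝒜 (n + 1),
        (a : Op d) ∈ locAlg 𝒜 (preds G o x ∪ {x} ∪ succs G o x) →
        φ (incl 𝒜 _ (E n a)) = φ (incl 𝒜 _ a))

end Markov

/-! ### Diagonal algebras, Umegaki conditional expectations, Markov random fields -/

section Diagonal

variable {V : Type*} (G : SimpleGraph V) (o : V) {d : V → ℕ} [∀ x, NeZero (d x)]
  {𝒜 : ∀ x, StarSubalgebra ℂ (Matrix (Fin (d x)) (Fin (d x)) ℂ)}

/-- `𝒟` is a diagonal algebra of `𝒜_V` with local algebras `D x`: a maximal abelian *-subalgebra of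
`𝒜_V` which is the norm closure of the *-algebra generated by subalgebras
`D x ⊆ 𝒜_{{x} ∪ S(x)}`. -/
structure IsDiagonalAlgebra (D : V → StarSubalgebra ℂ (quasiLocal 𝒜))
    (𝒟 : StarSubalgebra ℂ (quasiLocal 𝒜)) : Prop where
  comm : ∀ a ∈ 𝒟, ∀ b ∈ 𝒟, a * b = b * a
  maximal : ∀ a : quasiLocal 𝒜, (∀ b ∈ 𝒟, a * b = b * a) → a ∈ 𝒟
  localized : ∀ x, ∀ a ∈ D x, (a : Op d) ∈ locAlg 𝒜 ({x} ∪ succs G o x)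
  generated : 𝒟 = (⨆ x, D x).topologicalClosure

/-- An Umegaki conditional expectation of `𝒜_V` onto `𝒟`: a positive projection of norm one onto
`𝒟` which is a `𝒟`-bimodule map. -/
structure IsUmegakiCondExp (𝒟 : StarSubalgebra ℂ (quasiLocal 𝒜))
    (P : quasiLocal 𝒜 →ₗ[ℂ] 𝒟) : Prop where
  proj : ∀ a : 𝒟, P a = a
  norm_le : ∀ a, ‖P a‖ ≤ ‖a‖
  pos : ∀ a, ∃ b : 𝒟, P (star a * a) = star b * b
  map_mul_left : ∀ (b : 𝒟) (a : quasiLocal 𝒜), P (b * a) = b * P a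
  map_mul_right : ∀ (a : quasiLocal 𝒜) (b : 𝒟), P (a * b) = P a * b

/-- The spectrum (the space of characters) of `𝒟`. -/
abbrev Spec (𝒟 : StarSubalgebra ℂ (quasiLocal 𝒜)) : Type _ := WeakDual.characterSpace ℂ 𝒟

instance (𝒟 : StarSubalgebra ℂ (quasiLocal 𝒜)) : MeasurableSpace (Spec 𝒟) := borel _

instance (𝒟 : StarSubalgebra ℂ (quasiLocal 𝒜)) : BorelSpace (Spec 𝒟) := ⟨rfl⟩

/-- The σ-algebra on `Spec 𝒟` generated by the random variables `X_x`, `x ∈ Λ`, where `X_x` is the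
restriction of characters to `D x`. -/
@[reducible] def fieldSigma (D : V → StarSubalgebra ℂ (quasiLocal 𝒜)) (𝒟 : StarSubalgebra ℂ (quasiLocal 𝒜))
    (Λ : Set V) : MeasurableSpace (Spec 𝒟) :=
  ⨆ (a : 𝒟) (_ : ∃ x ∈ Λ, (a : quasiLocal 𝒜) ∈ D x),
    MeasurableSpace.comap (fun χ : Spec 𝒟 => χ a) (borel ℂ)

/-- The event that the field `(X_x)` agrees with that of `ω` on `Λ`. -/
def fieldCylinder (D : V → StarSubalgebra ℂ (quasiLocal 𝒜)) (𝒟 : StarSubalgebra ℂ (quasiLocal 𝒜))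
    (Λ : Set V) (ω : Spec 𝒟) : Set (Spec 𝒟) :=
  {χ | ∀ x ∈ Λ, ∀ a : 𝒟, (a : quasiLocal 𝒜) ∈ D x → χ a = ω a}

/-- The outer boundary of `Λ`. -/
def outerBoundary (Λ : Set V) : Set V := {y | y ∉ Λ ∧ ∃ x ∈ Λ, G.Adj x y}

/-- The (finitely valued) random variables `X_x` form a Markov random field under `μ`: for every
finite `Λ`, conditionally on the values of the field on the outer boundary of `Λ`, the field in
`Λ` and the field outside of `Λ` are independent. (The conditional measure given a null event is
zero, so that such an event imposes no condition.) -/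
def IsMarkovRandomField (D : V → StarSubalgebra ℂ (quasiLocal 𝒜))
    (𝒟 : StarSubalgebra ℂ (quasiLocal 𝒜)) (μ : Measure (Spec 𝒟)) : Prop :=
  ∀ (Λ : Set V), Λ.Finite → ∀ ω : Spec 𝒟,
    Indep (fieldSigma D 𝒟 Λ) (fieldSigma D 𝒟 Λᶜ)
      (ProbabilityTheory.cond μ (fieldCylinder D 𝒟 (outerBoundary G Λ) ω))

/-- The functional `b ↦ ∫ χ(b) dμ(χ)` on `𝒟` that corresponds to the measure `μ`. -/
def stateOfMeasure {𝒟 : StarSubalgebra ℂ (quasiLocal 𝒜)} (μ : Measure (Spec 𝒟)) (b : 𝒟) : ℂ :=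
  ∫ χ : Spec 𝒟, χ b ∂μ

end Diagonal

end TreeQMS

end

open scoped ComplexOrder ENNReal

noncomputable section

namespace TreeQMS

open MeasureTheory ProbabilityTheory Filter Topology

/-! ### Finite-dimensional star subalgebras of a C*-algebra -/

section FiniteDim

variable {M : Type*} [CStarAlgebra M]

/-! The state becomes classical once one knows, at every vertex `x`, a subalgebra `R x` of the site
algebra through which the descendants of `x` are correlated with the other vertices; then only what
lies between consecutive such subalgebras has to be diagonalized.

Invariance. The Markov hypothesis gives φ ∘ Eₙ = φ only on the family of a single vertex;
`IsMarkovSystem.invariant` extends it to whole balls. Since Eₖ fixes the observables of level below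
k, the defining limit is eventually constant and φ = φ ∘ E₀ ∘ ⋯ ∘ Eₙ on the ball of radius n. By
induction it remains to see that Eₙ(v − Eₙ₊₁ v), for v in one family, is uncorrelated with the other
sites of the ball. An idempotent limit F of the powers of Eₙ preserves φ and respects the tensor
structure, so only k = F Eₙ(v − Eₙ₊₁ v) matters, and equality in the Kadison–Schwarz inequality
forces φ(k* k) = 0 (`IsMarkovSystem.map_mul_defect_eq_zero`).

Separation. Composing the Eₙ down to the level of `x` and applying F gives maps Θ that preserve φ,
factor over the descendants of `x` and the rest, and take values in the fixed points of F.
Compressed to the support p of φ on the site, F preserves a faithful state, so its fixed points give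
an algebra `R x`, over which b ↦ p Θ(b) p is a bimodule map (`IsSupport.map_mul`). Hence the centre
Z of `R x` lies in the centralizer of φ, and a descendant observable commuting with `R x` can be
replaced under φ by an element of Z (`IsMarkovSystem.exists_isSeparating`).

Diagonalization. Moving each `R x` to the parent of `x` regroups the observables into commuting
algebras `cAlg x`. Pinching by Z leads from `L x` into the algebra generated by `R x` and its
relative commutant (`mem_sup_relComm`), so up to pinchings that preserve φ nothing is lost. Take `D
x` maximal abelian in `cAlg x` and in the centralizer of φ there. Reduction to the centres carries
the centralizer property to the whole algebra (`IsSepSystem.map_mul_commutator`), so pinching by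
finitely many `D x` preserves φ. These pinchings converge to the conditional expectation; they fix
whatever commutes with the diagonal algebra, which is therefore maximal abelian.

Markov property. Conditionally on an atom of Z, the descendants of `x` and the other vertices are
independent (`IsSepSystem.map_mul_atom`). Moreover Z lies both in `D x` and in the diagonal algebra
of the parent, so the field on the outer boundary of Λ determines the atom at every edge that leaves
Λ. Cutting the tree at these edges gives the Markov random field; the measure comes from Gelfand
duality and the Riesz–Markov theorem. -/

theorem isClosed_of_finiteDimensional (D : StarSubalgebra ℂ M) [FiniteDimensional ℂ D] :
    IsClosed (D : Set M) := by
  have : FiniteDimensional ℂ (Subalgebra.toSubmodule D.toSubalgebra) :=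
    (inferInstance : FiniteDimensional ℂ D)
  exact Submodule.closed_of_finiteDimensional (Subalgebra.toSubmodule D.toSubalgebra)

theorem finiteDimensional_of_le {A B : StarSubalgebra ℂ M} [hB : FiniteDimensional ℂ B]
    (h : A ≤ B) : FiniteDimensional ℂ A := by
  have : FiniteDimensional ℂ (Subalgebra.toSubmodule B.toSubalgebra) := hB
  exact Submodule.finiteDimensional_of_le (S₁ := Subalgebra.toSubmodule A.toSubalgebra)
    (S₂ := Subalgebra.toSubmodule B.toSubalgebra) h

/-- Every positive element of a closed star subalgebra is a square in this subalgebra. -/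
theorem exists_eq_star_mul_self_of_nonneg [PartialOrder M] [StarOrderedRing M]
    {S : StarSubalgebra ℂ M} (hS : IsClosed (S : Set M)) {x : M} (hx : x ∈ S) (h0 : 0 ≤ x) :
    ∃ c ∈ S, x = star c * c := by
  have hsa : IsSelfAdjoint x := IsSelfAdjoint.of_nonneg h0
  refine ⟨cfc Real.sqrt x, cfc_mem _ hx, ?_⟩
  have h1 : IsSelfAdjoint (cfc Real.sqrt x) := cfc_predicate _ _
  rw [h1.star_eq, ← cfc_mul .., ]
  conv_lhs => rw [← cfc_id' ℝ x]
  refine cfc_congr fun t ht => ?_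
  have : 0 ≤ t := spectrum_nonneg_of_nonneg h0 ht
  simp [Real.mul_self_sqrt this]

/-- A partition of unity into the minimal projections of the commutative algebra `D`. -/
structure IsAtoms (D : StarSubalgebra ℂ M) {ι : Type*} [Fintype ι] (p : ι → M) : Prop where
  mem : ∀ i, p i ∈ D
  star_eq : ∀ i, star (p i) = p i
  idem : ∀ i, p i * p i = p i
  orth : ∀ i j, i ≠ j → p i * p j = 0
  sum_eq : ∑ i, p i = 1
  ne_zero : ∀ i, p i ≠ 0
  scalar : ∀ a ∈ D, ∀ i, ∃ c : ℂ, a * p i = c • p i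

/-- Gelfand duality: distinct characters are linearly independent, so the spectrum is finite, and
the atoms are the indicator functions of its points. -/
theorem exists_isAtoms (D : StarSubalgebra ℂ M) [FiniteDimensional ℂ D]
    (hD : ∀ a ∈ D, ∀ b ∈ D, Commute a b) :
    ∃ (n : ℕ) (p : Fin n → M), IsAtoms D p := by
  classical
  have hcl : IsClosed (D : Set M) := isClosed_of_finiteDimensional D
  let : CommCStarAlgebra D :=
    { (inferInstance : CStarAlgebra D) with
      mul_comm := fun a b => Subtype.ext (hD a a.2 b b.2) }
  let X := WeakDual.characterSpace ℂ D
  have hinj : Function.Injective (fun χ : X => WeakDual.CharacterSpace.toAlgHom χ) := by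
    intro χ ψ h
    apply WeakDual.CharacterSpace.ext
    intro a
    exact DFunLike.congr_fun h a
  have hfin : Finite (D →ₐ[ℂ] ℂ) := by
    have := (linearIndependent_toLinearMap ℂ D ℂ).finite
    exact this
  have : Finite X := Finite.of_injective _ hinj
  let e := gelfandStarTransform D
  let : Fintype X := Fintype.ofFinite X
  let u : X → C(X, ℂ) := fun x => ⟨fun y => if y = x then 1 else 0, continuous_of_discreteTopology⟩
  let n := Fintype.card X
  let eq := (Fintype.equivFin X).symm
  have hu_mul : ∀ x y, x ≠ y → u x * u y = 0 := by
    intro x y hxy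
    ext z
    simp only [u, ContinuousMap.mul_apply, ContinuousMap.coe_mk, ContinuousMap.zero_apply]
    split_ifs with h1 h2 <;> simp_all
  refine ⟨n, fun i => (e.symm (u (eq i)) : D), ⟨fun i => Subtype.property _, ?_, ?_, ?_, ?_, ?_, ?_⟩⟩
  · intro i
    rw [← StarMemClass.coe_star, ← map_star]
    congr 2
    ext z
    simp only [u, ContinuousMap.star_apply, ContinuousMap.coe_mk]
    split_ifs <;> simp
  · intro i
    rw [← MulMemClass.coe_mul, ← map_mul]
    congr 2
    ext z
    simp only [u, ContinuousMap.mul_apply, ContinuousMap.coe_mk]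
    split_ifs <;> simp
  · intro i j hij
    rw [← MulMemClass.coe_mul, ← map_mul, hu_mul _ _ (fun h => hij (eq.injective h))]
    simp
  · rw [← AddSubmonoidClass.coe_finsetSum, ← map_sum]
    have : ∑ i, u (eq i) = 1 := by
      rw [Equiv.sum_comp eq u]
      ext z
      simp [u]
    rw [this]; simp
  · intro i h
    have h1 : e.symm (u (eq i)) = 0 := by
      apply Subtype.ext; simpa using h
    have h2 : u (eq i) = 0 := by
      have := congrArg e h1
      simpa using this
    have := DFunLike.congr_fun h2 (eq i)
    simp [u] at this
  · intro a ha i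
    refine ⟨e ⟨a, ha⟩ (eq i), ?_⟩
    have : (⟨a, ha⟩ : D) * e.symm (u (eq i)) = (e ⟨a, ha⟩ (eq i)) • e.symm (u (eq i)) := by
      apply EquivLike.injective e
      have h1 : e ((e ⟨a, ha⟩ (eq i)) • e.symm (u (eq i)))
          = (e ⟨a, ha⟩ (eq i)) • e (e.symm (u (eq i))) := map_smul e _ _
      rw [map_mul, h1, StarAlgEquiv.apply_symm_apply]
      ext z
      simp only [u, ContinuousMap.mul_apply, ContinuousMap.coe_mk, ContinuousMap.smul_apply]
      split_ifs with h
      · subst h; simp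
      · simp
    simpa using congrArg Subtype.val this

theorem IsAtoms.eq_sum {D : StarSubalgebra ℂ M} {ι : Type*} [Fintype ι] {p : ι → M}
    (hp : IsAtoms D p) {a : M} (ha : a ∈ D) : ∃ c : ι → ℂ, a = ∑ i, c i • p i := by
  choose c hc using hp.scalar a ha
  refine ⟨c, ?_⟩
  calc a = a * ∑ i, p i := by rw [hp.sum_eq, mul_one]
    _ = _ := by rw [Finset.mul_sum]; exact Finset.sum_congr rfl fun i _ => hc i

/-- `D` is a maximal abelian star subalgebra of `C`. -/
structure IsMasa (D C : StarSubalgebra ℂ M) : Prop where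
  le : D ≤ C
  comm : ∀ a ∈ D, ∀ b ∈ D, Commute a b
  maximal : ∀ c ∈ C, (∀ d ∈ D, Commute c d) → c ∈ D

theorem commute_adjoin {s : Set M} (hs : ∀ a ∈ s, ∀ b ∈ s, Commute a b)
    (hs' : ∀ a ∈ s, star a ∈ s) :
    ∀ a ∈ StarAlgebra.adjoin ℂ s, ∀ b ∈ StarAlgebra.adjoin ℂ s, Commute a b := by
  have h1 : ∀ a ∈ s, ∀ b ∈ StarAlgebra.adjoin ℂ s, Commute a b := by
    intro a ha
    have : StarAlgebra.adjoin ℂ s ≤ StarSubalgebra.centralizer ℂ {a} := by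
      apply StarAlgebra.adjoin_le
      intro b hb
      rw [SetLike.mem_coe, StarSubalgebra.mem_centralizer_iff]
      intro g hg
      rw [Set.mem_singleton_iff] at hg; subst hg
      exact ⟨hs _ ha _ hb, hs _ (hs' _ ha) _ hb⟩
    intro b hb
    exact ((StarSubalgebra.mem_centralizer_iff ℂ).1 (this hb) a rfl).1
  intro a ha b hb
  have : StarAlgebra.adjoin ℂ s ≤ StarSubalgebra.centralizer ℂ {b} := by
    apply StarAlgebra.adjoin_le
    intro c hc
    rw [SetLike.mem_coe, StarSubalgebra.mem_centralizer_iff]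
    intro g hg
    rw [Set.mem_singleton_iff] at hg; subst hg
    exact ⟨(h1 _ hc _ hb).symm, (h1 _ hc _ (star_mem hb)).symm⟩
  exact ((StarSubalgebra.mem_centralizer_iff ℂ).1 (this ha) b rfl).1.symm

/-- A commutative subalgebra of greatest dimension is maximal: adjoining a self-adjoint element that
commutes with it cannot enlarge it. A general element is treated through its real and imaginary
parts. -/
theorem exists_isMasa (C : StarSubalgebra ℂ M) [hC : FiniteDimensional ℂ C] {h : M} (hh : h ∈ C)
    (hsa : star h = h) : ∃ D, IsMasa D C ∧ h ∈ D := by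
  let P : StarSubalgebra ℂ M → Prop := fun D =>
    D ≤ C ∧ (∀ a ∈ D, ∀ b ∈ D, Commute a b) ∧ h ∈ D
  have hP0 : P (StarAlgebra.adjoin ℂ {h}) := by
    refine ⟨StarAlgebra.adjoin_le (by simpa using hh), ?_, StarAlgebra.self_mem_adjoin_singleton ℂ h⟩
    apply commute_adjoin
    · intro a ha b hb
      rw [Set.mem_singleton_iff] at ha hb; subst ha; subst hb; exact Commute.refl _
    · intro a ha
      rw [Set.mem_singleton_iff] at ha ⊢; subst ha; exact hsa
  let dim : StarSubalgebra ℂ M → ℕ := fun D => Module.finrank ℂ (Subalgebra.toSubmodule D.toSubalgebra)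
  have hC' : FiniteDimensional ℂ (Subalgebra.toSubmodule C.toSubalgebra) := hC
  have hbd : ∀ D, P D → dim D ≤ dim C := fun D hD =>
    Submodule.finrank_mono (s := Subalgebra.toSubmodule D.toSubalgebra)
      (t := Subalgebra.toSubmodule C.toSubalgebra) hD.1
  -- The greatest dimension is found as the least codimension.
  have hne : ∃ k, ∃ D, P D ∧ dim C - dim D = k := ⟨_, _, hP0, rfl⟩
  classical
  obtain ⟨D, hD, hDk⟩ := Nat.find_spec hne
  have hmin : ∀ D', P D' → dim D' ≤ dim D := by
    intro D' hD'
    by_contra hlt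
    have h2 := hbd D' hD'
    exact Nat.find_min hne (m := dim C - dim D') (by omega) ⟨D', hD', rfl⟩
  have key : ∀ c ∈ C, star c = c → (∀ d ∈ D, Commute c d) → c ∈ D := by
    intro c hc hcs hcd
    let D' := StarAlgebra.adjoin ℂ (insert c (D : Set M))
    have hDD' : D ≤ D' := fun x hx => StarAlgebra.subset_adjoin ℂ _ (Or.inr hx)
    have hPD' : P D' := by
      refine ⟨StarAlgebra.adjoin_le (by
        intro x hx
        rcases hx with rfl | hx
        · exact hc
        · exact hD.1 hx), ?_, hDD' hD.2.2⟩
      apply commute_adjoin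
      · rintro a (rfl | ha) b (rfl | hb)
        · exact Commute.refl _
        · exact hcd _ hb
        · exact (hcd _ ha).symm
        · exact hD.2.1 a ha b hb
      · rintro a (rfl | ha)
        · left; exact hcs
        · right; exact star_mem (s := D) ha
    have hfd : FiniteDimensional ℂ (Subalgebra.toSubmodule D'.toSubalgebra) :=
      Submodule.finiteDimensional_of_le (S₁ := Subalgebra.toSubmodule D'.toSubalgebra)
        (S₂ := Subalgebra.toSubmodule C.toSubalgebra) hPD'.1
    have heq : Subalgebra.toSubmodule D.toSubalgebra = Subalgebra.toSubmodule D'.toSubalgebra :=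
      Submodule.eq_of_le_of_finrank_le hDD' (hmin D' hPD')
    have : c ∈ Subalgebra.toSubmodule D'.toSubalgebra :=
      StarAlgebra.subset_adjoin ℂ _ (Or.inl rfl)
    rw [← heq] at this
    exact this
  refine ⟨D, ⟨hD.1, hD.2.1, ?_⟩, hD.2.2⟩
  intro c hc hcd
  have hcd' : ∀ d ∈ D, Commute (star c) d := by
    intro d hd
    have := (hcd (star d) (star_mem hd)).star_star
    simpa using this
  have hre := key ((1 / 2 : ℂ) • (c + star c))
    (C.smul_mem (add_mem hc (star_mem hc)) _)
    (by simp [star_smul, add_comm]) (fun d hd => ((hcd d hd).add_left (hcd' d hd)).smul_left _)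
  have him := key ((Complex.I / 2 : ℂ) • (c - star c))
    (C.smul_mem (sub_mem hc (star_mem hc)) _)
    (by
      rw [star_smul, star_sub, star_star, ← neg_sub c (star c), smul_neg, ← neg_smul]
      congr 1
      simp [neg_div])
    (fun d hd => ((hcd d hd).sub_left (hcd' d hd)).smul_left _)
  have : c = (1 / 2 : ℂ) • (c + star c) + (-Complex.I) • ((Complex.I / 2 : ℂ) • (c - star c)) := by
    rw [smul_smul]
    have h3 : (-Complex.I) * (Complex.I / 2) = 1 / 2 := by
      rw [neg_mul, mul_div_assoc', Complex.I_mul_I]; norm_num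
    rw [h3, ← smul_add]
    rw [add_add_sub_cancel, ← two_smul ℂ c, smul_smul]; norm_num
  rw [this]
  exact add_mem (hre) (D.smul_mem him _)

/-- Every `d ∈ D` acts on the corner `p i * c * p i` as one and the same scalar from both sides, so
the corner commutes with `D` and maximality puts it into `D`. -/
theorem IsMasa.atom_mul_mul_atom {D C : StarSubalgebra ℂ M} (hDC : IsMasa D C)
    {ι : Type*} [Fintype ι] {p : ι → M} (hp : IsAtoms D p) {c : M} (hc : c ∈ C) (i : ι) :
    ∃ z : ℂ, p i * c * p i = z • p i := by
  have hmem : p i * c * p i ∈ D := by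
    refine hDC.maximal _ (mul_mem (mul_mem (hDC.le (hp.mem i)) hc) (hDC.le (hp.mem i))) ?_
    intro d hd
    obtain ⟨z, hz⟩ := hp.scalar d hd i
    have hz' : p i * d = z • p i := by rw [← hz]; exact hDC.comm _ (hp.mem i) _ hd
    change p i * c * p i * d = d * (p i * c * p i)
    rw [mul_assoc (p i * c), hz', ← mul_assoc, ← mul_assoc, hz]
    simp
  obtain ⟨z, hz⟩ := hp.scalar _ hmem i
  refine ⟨z, ?_⟩
  rw [← hz, mul_assoc (p i * c), hp.idem]

theorem IsAtoms.eq_of_smul_eq {D : StarSubalgebra ℂ M} {ι : Type*} [Fintype ι] {p : ι → M}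
    (hp : IsAtoms D p) {i : ι} {z w : ℂ} (h : z • p i = w • p i) : z = w := by
  have : (z - w) • p i = 0 := by rw [sub_smul, h, sub_self]
  rcases smul_eq_zero.1 this with h | h
  · exact sub_eq_zero.1 h
  · exact absurd h (hp.ne_zero i)

end FiniteDim

/-! ### Positive functionals and degenerate Cauchy–Schwarz arguments. -/

section Forms

/-- A nonnegative affine function on the real line is constant. Real and imaginary `z` give `w + w'
= 0` and `w - w' = 0`. This replaces Cauchy–Schwarz whenever the quadratic term is known to vanish.
-/
theorem eq_zero_of_forall_nonneg {A w w' : ℂ}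
    (h : ∀ z : ℂ, 0 ≤ A + z * w + (starRingEnd ℂ) z * w') : w = 0 ∧ w' = 0 := by
  have key : ∀ B v : ℂ, (∀ t : ℝ, 0 ≤ B + t * v) → v = 0 := by
    intro B v hv
    have h1 : ∀ t : ℝ, 0 ≤ B.re + t * v.re ∧ 0 = B.im + t * v.im := by
      intro t
      have := Complex.le_def.1 (hv t)
      simpa using this
    apply Complex.ext
    · by_contra hne
      have hne' : v.re ≠ 0 := hne
      have := (h1 (-(B.re + 1) / v.re)).1
      rw [div_mul_cancel₀ _ hne'] at this
      linarith
    · have h2 := (h1 0).2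
      have h3 := (h1 1).2
      simp at h2 h3 ⊢
      linarith
  have h1 : w + w' = 0 := key A _ fun t => by
    have := h t
    rw [Complex.conj_ofReal, add_assoc, ← mul_add] at this
    exact this
  have h2 : Complex.I * (w - w') = 0 := key A _ fun t => by
    have := h (t * Complex.I)
    rw [map_mul, Complex.conj_ofReal, Complex.conj_I] at this
    convert this using 1
    ring
  have h3 : w - w' = 0 := by simpa using h2
  constructor
  · linear_combination (h1 + h3) / 2
  · linear_combination (h1 - h3) / 2

theorem eq_conj_of_forall_nonneg {A B w w' : ℂ}
    (h : ∀ z : ℂ, 0 ≤ A + z * w + (starRingEnd ℂ) z * w' + ((starRingEnd ℂ) z * z) * B) :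
    w' = (starRingEnd ℂ) w := by
  have h0 := (Complex.le_def.1 (h 0)).2
  have h1 := (Complex.le_def.1 (h 1)).2
  have h2 := (Complex.le_def.1 (h (-1))).2
  have h3 := (Complex.le_def.1 (h Complex.I)).2
  simp at h0 h1 h2 h3
  apply Complex.ext
  · simp; linarith
  · simp; linarith

variable {M : Type*} [Ring M] [StarRing M] [Algebra ℂ M] [StarModule ℂ M]

/-- The linear functional `φ` is positive on the star subalgebra `C`. -/
def PosOn (C : StarSubalgebra ℂ M) (φ : M →ₗ[ℂ] ℂ) : Prop := ∀ a ∈ C, 0 ≤ φ (star a * a)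

theorem PosOn.mono {C C' : StarSubalgebra ℂ M} {φ : M →ₗ[ℂ] ℂ} (h : PosOn C' φ) (hC : C ≤ C') :
    PosOn C φ := fun a ha => h a (hC ha)

theorem star_add_smul_mul_self (a b : M) (z : ℂ) :
    star (a + z • b) * (a + z • b) = star a * a + z • (star a * b)
      + (starRingEnd ℂ) z • (star b * a) + ((starRingEnd ℂ) z * z) • (star b * b) := by
  simp only [star_add, star_smul, add_mul, mul_add, smul_mul_assoc, mul_smul_comm,
    RCLike.star_def]
  rw [smul_add, smul_smul, mul_comm z]
  abel

theorem PosOn.map_star_mul {C : StarSubalgebra ℂ M} {φ : M →ₗ[ℂ] ℂ} (h : PosOn C φ) {a b : M}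
    (ha : a ∈ C) (hb : b ∈ C) : φ (star b * a) = (starRingEnd ℂ) (φ (star a * b)) := by
  apply eq_conj_of_forall_nonneg (A := φ (star a * a)) (B := φ (star b * b))
  intro z
  have := h (a + z • b) (add_mem ha (C.smul_mem hb z))
  rw [star_add_smul_mul_self] at this
  simpa using this

theorem PosOn.map_star {C : StarSubalgebra ℂ M} {φ : M →ₗ[ℂ] ℂ} (h : PosOn C φ) {a : M}
    (ha : a ∈ C) : φ (star a) = (starRingEnd ℂ) (φ a) := by
  have := h.map_star_mul (one_mem C) ha
  simpa using this

/-- A null vector `b` is orthogonal to everything, since the quadratic term of φ(|a + z b|²) in `z`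
vanishes. -/
theorem PosOn.map_star_mul_eq_zero {C : StarSubalgebra ℂ M} {φ : M →ₗ[ℂ] ℂ} (h : PosOn C φ)
    {a b : M} (ha : a ∈ C) (hb : b ∈ C) (h0 : φ (star b * b) = 0) : φ (star a * b) = 0 := by
  refine (eq_zero_of_forall_nonneg (A := φ (star a * a)) (w' := φ (star b * a)) ?_).1
  intro z
  have := h (a + z • b) (add_mem ha (C.smul_mem hb z))
  rw [star_add_smul_mul_self] at this
  simpa [h0] using this

theorem PosOn.map_mul_eq_zero {C : StarSubalgebra ℂ M} {φ : M →ₗ[ℂ] ℂ} (h : PosOn C φ)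
    {a b : M} (ha : a ∈ C) (hb : b ∈ C) (h0 : φ (star b * b) = 0) : φ (a * b) = 0 := by
  simpa using h.map_star_mul_eq_zero (star_mem ha) hb h0

theorem PosOn.map_star_mul_eq_zero' {C : StarSubalgebra ℂ M} {φ : M →ₗ[ℂ] ℂ} (h : PosOn C φ)
    {a b : M} (ha : a ∈ C) (hb : b ∈ C) (h0 : φ (star b * b) = 0) : φ (star b * a) = 0 := by
  rw [h.map_star_mul ha hb, h.map_star_mul_eq_zero ha hb h0, map_zero]

/-- The elements of `A` that commute with `R`. -/
def relComm (R A : StarSubalgebra ℂ M) : StarSubalgebra ℂ M :=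
  A ⊓ StarSubalgebra.centralizer ℂ (R : Set M)

theorem mem_relComm {R A : StarSubalgebra ℂ M} {a : M} :
    a ∈ relComm R A ↔ a ∈ A ∧ ∀ r ∈ R, Commute a r := by
  rw [relComm, StarSubalgebra.mem_inf, StarSubalgebra.mem_centralizer_iff]
  refine and_congr_right fun _ => ⟨fun h r hr => (h r hr).1.symm, fun h r hr => ?_⟩
  exact ⟨(h r hr).symm, (h _ (star_mem (s := R) hr)).symm⟩

theorem relComm_le {R A : StarSubalgebra ℂ M} : relComm R A ≤ A := inf_le_left

end Forms

/-! ### Traces, densities and supports on finite-dimensional algebras. -/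

section FiniteDim

variable {M : Type*} [CStarAlgebra M]

/-- The scalar `z` belongs to the spectrum of the positive element `z • p`. -/
theorem nonneg_of_smul_eq_star_mul_self {p y : M} {z : ℂ} (hp : p * p = p) (h0 : p ≠ 0)
    (h : z • p = star y * y) : 0 ≤ z := by
  let : PartialOrder M := CStarAlgebra.spectralOrder M
  have : StarOrderedRing M := CStarAlgebra.spectralOrderedRing M
  have h1 : (0 : M) ≤ z • p := h ▸ star_mul_self_nonneg y
  have hz : z ∈ spectrum ℂ (z • p) := by
    rw [spectrum.mem_iff]
    intro hu
    apply h0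
    have h2 : (algebraMap ℂ M z - z • p) * p = 0 := by
      rw [sub_mul, smul_mul_assoc, hp, Algebra.algebraMap_eq_smul_one, smul_mul_assoc, one_mul,
        sub_self]
    exact hu.mul_right_eq_zero.1 h2
  exact spectrum_nonneg_of_nonneg h1 hz

/-- The trace adds up the scalars of the corners at the atoms of a maximal abelian subalgebra. For x
= pᵢ c pⱼ and y = pⱼ e pᵢ one has x y = λ pᵢ and y x = μ pⱼ, and computing x y x in two ways gives λ
= μ unless x = 0; summing over i and j gives the trace property. Faithfulness holds because the
scalars of `star a * a` are nonnegative. -/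
theorem exists_trace (C : StarSubalgebra ℂ M) [FiniteDimensional ℂ C] :
    ∃ τ : C →ₗ[ℂ] ℂ, (∀ a b, τ (a * b) = τ (b * a)) ∧ (∀ a, τ (star a) = (starRingEnd ℂ) (τ a)) ∧
      ∀ a, τ (star a * a) = 0 → a = 0 := by
  obtain ⟨D, hD, -⟩ := exists_isMasa C (one_mem C) (star_one M)
  have := finiteDimensional_of_le hD.le
  obtain ⟨n, p, hp⟩ := exists_isAtoms D hD.comm
  choose lam hlam using fun (i : Fin n) (c : C) => hD.atom_mul_mul_atom hp c.2 i
  have hpC : ∀ i, p i ∈ C := fun i => hD.le (hp.mem i)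
  have hadd : ∀ i a b, lam i (a + b) = lam i a + lam i b := by
    intro i a b
    apply hp.eq_of_smul_eq (i := i)
    rw [← hlam, add_smul, ← hlam, ← hlam]
    simp [mul_add, add_mul]
  have hsmul : ∀ i (z : ℂ) a, lam i (z • a) = z * lam i a := by
    intro i z a
    apply hp.eq_of_smul_eq (i := i)
    rw [← hlam, mul_smul, ← hlam]
    simp
  have hstar : ∀ i a, lam i (star a) = (starRingEnd ℂ) (lam i a) := by
    intro i a
    apply hp.eq_of_smul_eq (i := i)
    rw [← hlam]
    have := congrArg star (hlam i a)
    simp only [star_mul, star_smul, hp.star_eq] at this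
    rw [mul_assoc]
    exact this
  let τ : C →ₗ[ℂ] ℂ :=
    { toFun := fun c => ∑ i, lam i c
      map_add' := fun a b => by simp [hadd, Finset.sum_add_distrib]
      map_smul' := fun z a => by simp [hsmul, Finset.mul_sum] }
  have htau : ∀ c, τ c = ∑ i, lam i c := fun _ => rfl
  let lamL : Fin n → C →ₗ[ℂ] ℂ := fun i =>
    { toFun := fun c => lam i c
      map_add' := fun a b => hadd i a b
      map_smul' := fun z a => hsmul i z a }
  let P : Fin n → C := fun i => ⟨p i, hpC i⟩
  have hP : ∑ i, P i = 1 := by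
    apply Subtype.ext
    rw [AddSubmonoidClass.coe_finsetSum]
    exact hp.sum_eq
  have hins : ∀ i (c e : C), lam i (c * e) = ∑ j, lam i (c * P j * e) := by
    intro i c e
    have h1 : c * e = ∑ j, c * P j * e := by
      rw [← Finset.sum_mul, ← Finset.mul_sum, hP, mul_one]
    calc lam i (c * e) = lamL i (∑ j, c * P j * e) := by rw [← h1]; rfl
      _ = _ := map_sum (lamL i) _ _
  have hsw : ∀ i j (c e : C), lam i (c * P j * e) = lam j (e * P i * c) := by
    intro i j c e
    have h1 := hlam i (c * P j * e)
    have h2 := hlam j (e * P i * c)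
    simp only [MulMemClass.coe_mul, P] at h1 h2
    set x : M := p i * c * p j with hx
    set y : M := p j * e * p i with hy
    have hxy : x * y = lam i (c * P j * e) • p i := by
      rw [← h1, hx, hy]; simp only [mul_assoc]; rw [← mul_assoc (p j) (p j), hp.idem]
    have hyx : y * x = lam j (e * P i * c) • p j := by
      rw [← h2, hx, hy]; simp only [mul_assoc]; rw [← mul_assoc (p i) (p i), hp.idem]
    have h3 : lam i (c * P j * e) • x = lam j (e * P i * c) • x := by
      have e1 : p i * x = x := by rw [hx, ← mul_assoc, ← mul_assoc, hp.idem]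
      have e2 : x * p j = x := by rw [hx, mul_assoc, hp.idem]
      calc _ = (lam i (c * P j * e) • p i) * x := by rw [smul_mul_assoc, e1]
        _ = x * (y * x) := by rw [← hxy, mul_assoc]
        _ = _ := by rw [hyx, mul_smul_comm, e2]
    by_cases hx0 : x = 0
    · rw [hx0, zero_mul] at hxy
      rw [hx0, mul_zero] at hyx
      have e1 := (smul_eq_zero.1 hxy.symm).resolve_right (hp.ne_zero i)
      have e2 := (smul_eq_zero.1 hyx.symm).resolve_right (hp.ne_zero j)
      rw [e1, e2]
    · have : (lam i (c * P j * e) - lam j (e * P i * c)) • x = 0 := by rw [sub_smul, h3, sub_self]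
      exact sub_eq_zero.1 ((smul_eq_zero.1 this).resolve_right hx0)
  have htr : ∀ a b, τ (a * b) = τ (b * a) := by
    intro a b
    rw [htau, htau, Finset.sum_congr rfl fun i _ => hins i a b,
      Finset.sum_congr rfl fun i _ => hins i b a, Finset.sum_comm]
    exact Finset.sum_congr rfl fun i _ => Finset.sum_congr rfl fun j _ => hsw _ _ _ _
  refine ⟨τ, htr, fun a => by
    rw [htau, htau, map_sum]; exact Finset.sum_congr rfl fun i _ => hstar i a, ?_⟩
  intro a ha
  have hfac : ∀ i, lam i (star a * a) • p i = star ((a : M) * p i) * (a * p i) := by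
    intro i
    rw [← hlam]
    simp [star_mul, hp.star_eq, mul_assoc]
  have hnn : ∀ i, 0 ≤ lam i (star a * a) := fun i =>
    nonneg_of_smul_eq_star_mul_self (hp.idem i) (hp.ne_zero i) (hfac i)
  have hz := (Finset.sum_eq_zero_iff_of_nonneg fun i _ => hnn i).1 ((htau _).symm.trans ha)
  have hap : ∀ i, (a : M) * p i = 0 := by
    intro i
    have h1 := hfac i
    rw [hz i (Finset.mem_univ i), zero_smul] at h1
    exact (CStarRing.star_mul_self_eq_zero_iff _).1 h1.symm
  apply Subtype.ext
  calc (a : M) = a * ∑ i, p i := by rw [hp.sum_eq, mul_one]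
    _ = 0 := by rw [Finset.mul_sum]; exact Finset.sum_eq_zero fun i _ => hap i

/-- A hermitian functional on a finite-dimensional C*-algebra can be diagonalized. -/
theorem exists_isMasa_centralizer (C : StarSubalgebra ℂ M) [FiniteDimensional ℂ C]
    {φ : M →ₗ[ℂ] ℂ} (hφ : PosOn C φ) :
    ∃ D, IsMasa D C ∧ ∀ d ∈ D, ∀ a ∈ C, φ (d * a) = φ (a * d) := by
  obtain ⟨τ, htr, hst, hf⟩ := exists_trace C
  -- The trace form is nondegenerate, so φ has a self-adjoint density ρ. A maximal abelian
  -- subalgebra through ρ commutes with ρ and so lies in the centralizer of φ.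
  let B : C →ₗ[ℂ] Module.Dual ℂ C := (LinearMap.mul ℂ C).compr₂ τ
  have hB : ∀ a b, B a b = τ (a * b) := fun _ _ => rfl
  have hinj : Function.Injective B := by
    rw [← LinearMap.ker_eq_bot, LinearMap.ker_eq_bot']
    intro a ha
    apply hf
    rw [htr, ← hB, ha]; rfl
  have hsurj : Function.Surjective B :=
    (LinearMap.injective_iff_surjective_of_finrank_eq_finrank
      (Subspace.dual_finrank_eq).symm).1 hinj
  obtain ⟨ρ, hρ⟩ := hsurj (φ.comp (Subalgebra.toSubmodule C.toSubalgebra).subtype)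
  have hρ' : ∀ b : C, φ b = τ (ρ * b) := fun b => by rw [← hB, hρ]; rfl
  have hsa : star ρ = ρ := by
    apply hinj
    ext b
    rw [hB, hB, ← hρ', htr]
    have h1 : b * star ρ = star (ρ * star b) := by simp
    rw [h1, hst, ← hρ']
    have := hφ.map_star (star_mem b.2)
    simp only [star_star] at this
    rw [this]; simp
  obtain ⟨D, hD, hρD⟩ := exists_isMasa C ρ.2 (by rw [← StarMemClass.coe_star, hsa])
  refine ⟨D, hD, fun d hd a ha => ?_⟩
  have h1 := hρ' (⟨d, hD.le hd⟩ * ⟨a, ha⟩)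
  have h2 := hρ' (⟨a, ha⟩ * ⟨d, hD.le hd⟩)
  simp only [MulMemClass.coe_mul] at h1 h2
  have hc : ρ * ⟨d, hD.le hd⟩ = ⟨d, hD.le hd⟩ * ρ := Subtype.ext (hD.comm _ hρD _ hd)
  rw [h1, h2, ← mul_assoc, hc, mul_assoc, htr, mul_assoc]

/-- The support projection of a positive functional. -/
theorem exists_support (C : StarSubalgebra ℂ M) [FiniteDimensional ℂ C]
    {φ : M →ₗ[ℂ] ℂ} (hφ : PosOn C φ) :
    ∃ p ∈ C, star p = p ∧ p * p = p ∧ φ (1 - p) = 0 ∧ ∀ a ∈ C, φ (star a * a) = 0 → a * p = 0 := by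
  classical
  obtain ⟨D, hD, hcen⟩ := exists_isMasa_centralizer C hφ
  have := finiteDimensional_of_le hD.le
  obtain ⟨n, p, hp⟩ := exists_isAtoms D hD.comm
  have hpC : ∀ i, p i ∈ C := fun i => hD.le (hp.mem i)
  have hpp : ∀ i j, p i * p j = if i = j then p i else 0 := by
    intro i j
    split_ifs with h
    · subst h; exact hp.idem i
    · exact hp.orth i j h
  -- The support is the sum of the atoms charged by φ in a diagonalizing algebra. There φ(a* a) is a
  -- sum of nonnegative terms over the atoms, so its vanishing kills `a` on every charged atom.
  refine ⟨∑ i with φ (p i) ≠ 0, p i, sum_mem fun i _ => hpC i, ?_, ?_, ?_, ?_⟩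
  · rw [star_sum]; exact Finset.sum_congr rfl fun i _ => hp.star_eq i
  · rw [Finset.sum_mul_sum]
    refine Finset.sum_congr rfl fun i hi => ?_
    simp_rw [hpp]
    rw [Finset.sum_ite_eq, if_pos hi]
  · rw [← hp.sum_eq, ← Finset.sum_filter_add_sum_filter_not Finset.univ (fun i => φ (p i) ≠ 0),
      add_sub_cancel_left, map_sum]
    refine Finset.sum_eq_zero fun i hi => ?_
    simpa using (Finset.mem_filter.1 hi).2
  · intro a ha h0
    choose lam hlam using fun i => hD.atom_mul_mul_atom hp (mul_mem (star_mem ha) ha) i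
    have hfac : ∀ i, lam i • p i = star (a * p i) * (a * p i) := by
      intro i
      rw [← hlam]
      simp [star_mul, hp.star_eq, mul_assoc]
    have hnn : ∀ i, 0 ≤ lam i := fun i =>
      nonneg_of_smul_eq_star_mul_self (hp.idem i) (hp.ne_zero i) (hfac i)
    have hpn : ∀ i, 0 ≤ φ (p i) := fun i => by
      have := hφ _ (hpC i); rwa [hp.star_eq, hp.idem] at this
    have hsum : φ (star a * a) = ∑ i, lam i * φ (p i) := by
      calc φ (star a * a) = φ ((∑ i, p i) * (star a * a)) := by rw [hp.sum_eq, one_mul]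
        _ = ∑ i, φ (p i * (star a * a)) := by rw [Finset.sum_mul, map_sum]
        _ = _ := by
          refine Finset.sum_congr rfl fun i _ => ?_
          rw [← smul_eq_mul (lam i), ← map_smul, ← hlam,
            ← hcen _ (hp.mem i) _ (mul_mem (hpC i) (mul_mem (star_mem ha) ha)), ← mul_assoc (p i) (p i),
            hp.idem]
    rw [h0] at hsum
    have hz := (Finset.sum_eq_zero_iff_of_nonneg fun i _ => mul_nonneg (hnn i) (hpn i)).1 hsum.symm
    rw [Finset.mul_sum]
    refine Finset.sum_eq_zero fun i hi => ?_
    have h1 := (mul_eq_zero.1 (hz i (Finset.mem_univ i))).resolve_right (Finset.mem_filter.1 hi).2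
    have h2 := hfac i
    rw [h1, zero_smul] at h2
    exact (CStarRing.star_mul_self_eq_zero_iff _).1 h2.symm

end FiniteDim

/-! ### Commuting families of star subalgebras -/

section Families

variable {M : Type*} [Ring M] [StarRing M] [Algebra ℂ M] [StarModule ℂ M]

/-- The algebras `A` and `B` commute elementwise. -/
def CommAlg (A B : StarSubalgebra ℂ M) : Prop := ∀ a ∈ A, ∀ b ∈ B, Commute a b

theorem CommAlg.symm {A B : StarSubalgebra ℂ M} (h : CommAlg A B) : CommAlg B A :=
  fun b hb a ha => (h a ha b hb).symm

theorem CommAlg.mono {A B A' B' : StarSubalgebra ℂ M} (h : CommAlg A B) (hA : A' ≤ A)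
    (hB : B' ≤ B) : CommAlg A' B' := fun a ha b hb => h a (hA ha) b (hB hb)

theorem commute_of_le_centralizer {A : StarSubalgebra ℂ M} {t : M}
    (h : A ≤ StarSubalgebra.centralizer ℂ {t}) {a : M} (ha : a ∈ A) : Commute t a :=
  ((StarSubalgebra.mem_centralizer_iff ℂ).1 (h ha) t rfl).1

theorem le_centralizer_of_commute {A : StarSubalgebra ℂ M} {t : M}
    (h : ∀ a ∈ A, Commute t a) : A ≤ StarSubalgebra.centralizer ℂ {t} := by
  intro a ha
  rw [StarSubalgebra.mem_centralizer_iff]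
  rintro g rfl
  refine ⟨h a ha, ?_⟩
  have := (h (star a) (star_mem ha)).star_star
  rw [star_star] at this
  exact this

theorem commute_sup {A B : StarSubalgebra ℂ M} {t : M} (hA : ∀ a ∈ A, Commute t a)
    (hB : ∀ b ∈ B, Commute t b) : ∀ c ∈ A ⊔ B, Commute t c := fun _ hc =>
  commute_of_le_centralizer (sup_le (le_centralizer_of_commute hA) (le_centralizer_of_commute hB)) hc

theorem CommAlg.sup_left {A B C : StarSubalgebra ℂ M} (hA : CommAlg A C) (hB : CommAlg B C) :
    CommAlg (A ⊔ B) C := fun a ha c hc =>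
  (commute_sup (fun a ha => (hA a ha c hc).symm) (fun a ha => (hB a ha c hc).symm) a ha).symm

theorem CommAlg.sup_right {A B C : StarSubalgebra ℂ M} (hA : CommAlg C A) (hB : CommAlg C B) :
    CommAlg C (A ⊔ B) := (hA.symm.sup_left hB.symm).symm

/-- For commuting algebras `A` and `B`, the products `a * b` span `A ⊔ B`. -/
theorem toSubmodule_sup_le {A B : StarSubalgebra ℂ M} (h : CommAlg A B) :
    Subalgebra.toSubmodule (A ⊔ B).toSubalgebra
      ≤ Subalgebra.toSubmodule A.toSubalgebra * Subalgebra.toSubmodule B.toSubalgebra := by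
  set SA := Subalgebra.toSubmodule A.toSubalgebra
  set SB := Subalgebra.toSubmodule B.toSubalgebra
  have hA1 : (1 : M) ∈ SA := one_mem A
  have hB1 : (1 : M) ∈ SB := one_mem B
  have hmul : ∀ x ∈ SA * SB, ∀ y ∈ SA * SB, x * y ∈ SA * SB := by
    intro x hx y hy
    refine Submodule.mul_induction_on hx ?_ ?_
    · intro a ha b hb
      refine Submodule.mul_induction_on hy ?_ ?_
      · intro a' ha' b' hb'
        have : a * b * (a' * b') = (a * a') * (b * b') := by
          rw [mul_assoc, ← mul_assoc b, ← (h a' ha' b hb).eq]; simp only [mul_assoc]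
        rw [this]
        exact Submodule.mul_mem_mul (mul_mem (S := StarSubalgebra ℂ M) (s := A) ha ha')
          (mul_mem (S := StarSubalgebra ℂ M) (s := B) hb hb')
      · intro y y' h1 h2
        rw [mul_add]; exact add_mem h1 h2
    · intro x x' h1 h2
      rw [add_mul]; exact add_mem h1 h2
  have hstar : ∀ x ∈ SA * SB, star x ∈ SA * SB := by
    intro x hx
    refine Submodule.mul_induction_on hx ?_ ?_
    · intro a ha b hb
      rw [star_mul, ← (h _ (star_mem (s := A) ha) _ (star_mem (s := B) hb)).eq]
      exact Submodule.mul_mem_mul (star_mem (s := A) ha) (star_mem (s := B) hb)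
    · intro y y' h1 h2
      rw [star_add]; exact add_mem h1 h2
  let S : StarSubalgebra ℂ M :=
    { carrier := SA * SB
      mul_mem' := fun hx hy => hmul _ hx _ hy
      add_mem' := fun hx hy => add_mem hx hy
      algebraMap_mem' := fun r => by
        have := Submodule.mul_mem_mul (A.algebraMap_mem r) hB1 (M := SA) (N := SB)
        rwa [mul_one] at this
      star_mem' := fun hx => hstar _ hx }
  have hle : A ⊔ B ≤ S := by
    refine sup_le ?_ ?_
    · intro a ha
      have := Submodule.mul_mem_mul (show a ∈ SA from ha) hB1 (M := SA) (N := SB)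
      rw [mul_one] at this
      exact this
    · intro b hb
      have := Submodule.mul_mem_mul hA1 (show b ∈ SB from hb) (M := SA) (N := SB)
      rw [one_mul] at this
      exact this
  exact fun x hx => hle hx

theorem mem_of_mem_sup {A B : StarSubalgebra ℂ M} (h : CommAlg A B) (K : Submodule ℂ M)
    (hK : ∀ a ∈ A, ∀ b ∈ B, a * b ∈ K) {x : M} (hx : x ∈ A ⊔ B) : x ∈ K :=
  (Submodule.mul_le.2 fun a ha b hb => hK a ha b hb :
    Subalgebra.toSubmodule A.toSubalgebra * Subalgebra.toSubmodule B.toSubalgebra ≤ K)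
    (toSubmodule_sup_le h hx)

theorem finiteDimensional_sup {A B : StarSubalgebra ℂ M} (h : CommAlg A B)
    [hA : FiniteDimensional ℂ A] [hB : FiniteDimensional ℂ B] :
    FiniteDimensional ℂ (A ⊔ B : StarSubalgebra ℂ M) := by
  have h1 : (Subalgebra.toSubmodule A.toSubalgebra).FG := Module.Finite.iff_fg.1 hA
  have h2 : (Subalgebra.toSubmodule B.toSubalgebra).FG := Module.Finite.iff_fg.1 hB
  have h3 : FiniteDimensional ℂ
      (Subalgebra.toSubmodule A.toSubalgebra * Subalgebra.toSubmodule B.toSubalgebra : Submodule ℂ M) :=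
    Module.Finite.iff_fg.2 (h1.mul h2)
  exact Submodule.finiteDimensional_of_le
    (S₁ := Subalgebra.toSubmodule (A ⊔ B).toSubalgebra) (toSubmodule_sup_le h)

variable {V : Type*}

/-- The algebra generated by the algebras `A x`, `x ∈ Y`. -/
def region (A : V → StarSubalgebra ℂ M) (Y : Set V) : StarSubalgebra ℂ M := ⨆ x ∈ Y, A x

variable {A B : V → StarSubalgebra ℂ M} {Y Z : Set V}

theorem le_region {x : V} (hx : x ∈ Y) : A x ≤ region A Y := le_iSup₂_of_le x hx le_rfl

theorem region_le {C : StarSubalgebra ℂ M} (h : ∀ x ∈ Y, A x ≤ C) : region A Y ≤ C := iSup₂_le h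

theorem region_mono (h : Y ⊆ Z) : region A Y ≤ region A Z := region_le fun _ hx => le_region (h hx)

theorem region_union : region A (Y ∪ Z) = region A Y ⊔ region A Z := by
  refine le_antisymm (region_le ?_) (sup_le (region_mono Set.subset_union_left)
    (region_mono Set.subset_union_right))
  rintro x (hx | hx)
  · exact (le_region hx).trans le_sup_left
  · exact (le_region hx).trans le_sup_right

theorem region_empty : region A (∅ : Set V) = ⊥ := by simp [region]

theorem region_singleton (x : V) : region A {x} = A x := by simp [region]

theorem region_insert (x : V) : region A (insert x Y) = A x ⊔ region A Y := by
  rw [Set.insert_eq, region_union, region_singleton]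

theorem commute_region {t : M} (h : ∀ x ∈ Y, ∀ a ∈ A x, Commute t a) :
    ∀ a ∈ region A Y, Commute t a := fun _ ha =>
  commute_of_le_centralizer (region_le fun x hx => le_centralizer_of_commute (h x hx)) ha

theorem CommAlg.region_left {C : StarSubalgebra ℂ M} (h : ∀ x ∈ Y, CommAlg (A x) C) :
    CommAlg (region A Y) C := fun a ha c hc =>
  (commute_region (fun x hx a ha => (h x hx a ha c hc).symm) a ha).symm

theorem CommAlg.region_right {C : StarSubalgebra ℂ M} (h : ∀ x ∈ Y, CommAlg C (A x)) :
    CommAlg C (region A Y) := (CommAlg.region_left fun x hx => (h x hx).symm).symm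

theorem CommAlg.region_region (h : ∀ x ∈ Y, ∀ y ∈ Z, CommAlg (A x) (B y)) :
    CommAlg (region A Y) (region B Z) :=
  CommAlg.region_left fun x hx => CommAlg.region_right fun y hy => h x hx y hy

theorem exists_finset_of_mem_region {a : M} (ha : a ∈ region A Y) :
    ∃ F : Finset V, (F : Set V) ⊆ Y ∧ a ∈ region A (F : Set V) := by
  classical
  let S : StarSubalgebra ℂ M :=
    { carrier := {a | ∃ F : Finset V, (F : Set V) ⊆ Y ∧ a ∈ region A (F : Set V)}
      mul_mem' := by
        rintro a b ⟨F, hF, ha⟩ ⟨F', hF', hb⟩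
        refine ⟨F ∪ F', by simp [hF, hF'], ?_⟩
        exact mul_mem (region_mono (by simp) ha) (region_mono (by simp) hb)
      add_mem' := by
        rintro a b ⟨F, hF, ha⟩ ⟨F', hF', hb⟩
        refine ⟨F ∪ F', by simp [hF, hF'], ?_⟩
        exact add_mem (region_mono (by simp) ha) (region_mono (by simp) hb)
      algebraMap_mem' := fun r => ⟨∅, by simp, StarSubalgebra.algebraMap_mem _ r⟩
      star_mem' := by
        rintro a ⟨F, hF, ha⟩
        exact ⟨F, hF, star_mem ha⟩ }
  have : region A Y ≤ S := region_le fun x hx a ha =>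
    ⟨{x}, by simpa using hx, le_region (by simp) ha⟩
  exact this ha

theorem finiteDimensional_region_finset (hfd : ∀ x, FiniteDimensional ℂ (A x))
    (hc : Pairwise fun x y => CommAlg (A x) (A y)) (F : Finset V) :
    FiniteDimensional ℂ (region A (F : Set V)) := by
  classical
  induction F using Finset.induction_on with
  | empty =>
    rw [Finset.coe_empty, region_empty]
    exact (inferInstance : FiniteDimensional ℂ (⊥ : Subalgebra ℂ M))
  | insert x F hx ih =>
    rw [Finset.coe_insert, region_insert]
    have := hfd x
    apply finiteDimensional_sup
    apply CommAlg.region_right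
    intro y hy
    exact hc (by rintro rfl; exact hx hy)

theorem finiteDimensional_region (hfd : ∀ x, FiniteDimensional ℂ (A x))
    (hc : Pairwise fun x y => CommAlg (A x) (A y)) (hY : Y.Finite) :
    FiniteDimensional ℂ (region A Y) := by
  have := finiteDimensional_region_finset hfd hc hY.toFinset
  rwa [hY.coe_toFinset] at this

/-- Reduction of the elements of the algebra generated by the commuting algebras `A x` to elements
of the algebra generated by subalgebras `B x`, one site after the other. -/
theorem region_univ_induction (K : Submodule ℂ M) (Φ : V → M →ₗ[ℂ] M)
    (hA : Pairwise fun x y => CommAlg (A x) (A y)) (hBA : ∀ x, B x ≤ A x)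
    (hΦ : ∀ x, ∀ a ∈ A x, Φ x a ∈ B x)
    (hK : ∀ x, ∀ a ∈ A x, ∀ t ∈ region A {x}ᶜ, t * Φ x a ∈ K → t * a ∈ K)
    (h0 : ∀ b ∈ region B Set.univ, b ∈ K) : ∀ a ∈ region A Set.univ, a ∈ K := by
  classical
  -- The sites outside of `F` have already been reduced to `B`, while those in `F` still carry
  -- arbitrary elements of `A`. The induction is applied with `F` containing all sites of the given
  -- element and ends at the empty set.
  have key : ∀ F : Finset V, ∀ t ∈ region B (F : Set V)ᶜ, ∀ a ∈ region A (F : Set V),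
      t * a ∈ K := by
    intro F
    induction F using Finset.induction_on with
    | empty =>
      intro t ht a ha
      rw [Finset.coe_empty, region_empty] at ha
      obtain ⟨z, rfl⟩ := StarSubalgebra.mem_bot.1 ha
      rw [← Algebra.commutes, ← Algebra.smul_def]
      exact K.smul_mem _ (h0 _ (region_mono (Set.subset_univ _) ht))
    | insert x F hx ih =>
      intro t ht a ha
      rw [Finset.coe_insert, region_insert] at ha
      refine mem_of_mem_sup (A := A x) (B := region A (F : Set V))
        (CommAlg.region_right fun y hy => hA (by rintro rfl; exact hx hy))
        (K.comap (LinearMap.mulLeft ℂ t)) ?_ ha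
      intro c hc a' ha'
      have hcomm : CommAlg (A x) (region A (F : Set V)) :=
        CommAlg.region_right fun y hy => hA (by rintro rfl; exact hx hy)
      have htx : t ∈ region B {x}ᶜ := region_mono (by
        intro y hy h
        exact hy (by rw [Set.mem_singleton_iff] at h; simp [h])) ht
      have htx' : t ∈ region A {x}ᶜ := (region_le fun y hy => (hBA y).trans (le_region hy)) htx
      have hax : a' ∈ region A {x}ᶜ := region_mono (by
        rintro y hy h
        rw [Set.mem_singleton_iff] at h; subst h; exact hx hy) ha'
      change t * (c * a') ∈ K
      rw [(hcomm c hc a' ha').eq, ← mul_assoc]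
      refine hK x c hc (t * a') (mul_mem htx' hax) ?_
      rw [mul_assoc, ← (hcomm _ (hBA x (hΦ x c hc)) a' ha').eq, ← mul_assoc]
      refine ih _ (mul_mem (region_mono ?_ ht) (le_region ?_ (hΦ x c hc))) _ ha'
      · rw [Set.compl_subset_compl, Finset.coe_insert]; exact Set.subset_insert _ _
      · exact hx
  intro a ha
  obtain ⟨F, -, haF⟩ := exists_finset_of_mem_region ha
  have := key F 1 (one_mem _) a haF
  rwa [one_mul] at this

end Families

/-! ### Finite-dimensional algebras and their relative commutants. -/

section Decomposition

variable {M : Type*} [CStarAlgebra M]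

/-- An element of `A ⊇ R` that commutes with the centre of the finite-dimensional algebra `R` lies
in the algebra generated by `R` and its relative commutant in `A`. -/
theorem mem_sup_relComm {R A : StarSubalgebra ℂ M} [FiniteDimensional ℂ R] (hRA : R ≤ A) {a : M}
    (ha : a ∈ A) (hz : ∀ z ∈ relComm R R, Commute a z) : a ∈ R ⊔ relComm R A := by
  classical
  obtain ⟨D, hD, -⟩ := exists_isMasa R (one_mem R) (star_one M)
  have := finiteDimensional_of_le hD.le
  obtain ⟨n, f, hf⟩ := exists_isAtoms D hD.comm
  have hfR : ∀ i, f i ∈ R := fun i => hD.le (hf.mem i)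
  have hff : ∀ i j, f i * f j = if i = j then f i else 0 := by
    intro i j
    split_ifs with h
    · subst h; exact hf.idem i
    · exact hf.orth i j h
  -- `i ~ j` if `f i R f j ≠ 0`
  let rel : Fin n → Fin n → Prop := fun i j => ∃ v ∈ R, f i * v = v ∧ v * f j = v ∧
    star v * v = f j ∧ v * star v = f i
  have hrel : ∀ i j, ∀ r ∈ R, ¬ rel i j → f i * r * f j = 0 := by
    intro i j r hr hn
    by_contra hne
    apply hn
    set x := f i * r * f j with hx
    have hxR : x ∈ R := mul_mem (mul_mem (hfR i) hr) (hfR j)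
    have hfx : f i * x = x := by rw [hx, ← mul_assoc, ← mul_assoc, hf.idem]
    have hxf : x * f j = x := by rw [hx, mul_assoc, hf.idem]
    have hsx : star x * f i = star x := by
      have := congrArg star hfx; rwa [star_mul, hf.star_eq] at this
    have hsx' : f j * star x = star x := by
      have := congrArg star hxf; rwa [star_mul, hf.star_eq] at this
    -- Corners at atoms are scalar, so `star x * x` and `x * star x` are multiples of `f j` and `f
    -- i`. The two scalars agree and are positive, and dividing `x` by their square root gives the
    -- partial isometry.
    obtain ⟨α, hα⟩ := hD.atom_mul_mul_atom hf (mul_mem (star_mem hxR) hxR) j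
    obtain ⟨β, hβ⟩ := hD.atom_mul_mul_atom hf (mul_mem hxR (star_mem hxR)) i
    rw [← mul_assoc, hsx', mul_assoc, hxf] at hα
    rw [← mul_assoc, hfx, mul_assoc, hsx] at hβ
    have hα0 : 0 ≤ α := nonneg_of_smul_eq_star_mul_self (hf.idem j) (hf.ne_zero j) hα.symm
    have hαβ : α = β := by
      have h1 : α • x = β • x := by
        calc α • x = x * (star x * x) := by rw [hα, mul_smul_comm, hxf]
          _ = β • x := by rw [← mul_assoc, hβ, smul_mul_assoc, hfx]
      have h2 : (α - β) • x = 0 := by rw [sub_smul, h1, sub_self]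
      exact sub_eq_zero.1 ((smul_eq_zero.1 h2).resolve_right hne)
    have hαne : α ≠ 0 := by
      rintro rfl
      rw [zero_smul] at hα
      exact hne ((CStarRing.star_mul_self_eq_zero_iff _).1 hα)
    have hαre : ((α.re : ℝ) : ℂ) = α := by
      apply Complex.ext <;> simp [(Complex.le_def.1 hα0).2.symm]
    have hαpos : 0 < α.re := by
      rcases (Complex.le_def.1 hα0).1.lt_or_eq with h | h
      · simpa using h
      · exfalso; apply hαne; rw [← hαre, ← h]; simp
    set s : ℂ := (((Real.sqrt α.re)⁻¹ : ℝ) : ℂ) with hs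
    have hss : star s * s * α = 1 := by
      have h3 : Real.sqrt α.re * Real.sqrt α.re = α.re := Real.mul_self_sqrt hαpos.le
      have h4 : Real.sqrt α.re ≠ 0 := (Real.sqrt_pos.2 hαpos).ne'
      rw [hs, RCLike.star_def, Complex.conj_ofReal, ← hαre]
      rw [Complex.ofReal_re, ← Complex.ofReal_mul, ← Complex.ofReal_mul]
      have : (Real.sqrt α.re)⁻¹ * (Real.sqrt α.re)⁻¹ * α.re = 1 := by
        nth_rewrite 3 [← h3]; field_simp
      rw [this, Complex.ofReal_one]
    refine ⟨s • x, R.smul_mem hxR s, by rw [mul_smul_comm, hfx], by rw [smul_mul_assoc, hxf], ?_, ?_⟩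
    · rw [star_smul, smul_mul_assoc, mul_smul_comm, smul_smul, hα, smul_smul, hss, one_smul]
    · rw [star_smul, smul_mul_assoc, mul_smul_comm, smul_smul, hβ, smul_smul, ← hαβ, mul_comm s,
        hss, one_smul]
  have hrefl : ∀ i, rel i i := fun i =>
    ⟨f i, hfR i, hf.idem i, hf.idem i, by rw [hf.star_eq, hf.idem], by rw [hf.star_eq, hf.idem]⟩
  have hsymm : ∀ i j, rel i j → rel j i := by
    rintro i j ⟨v, hv, h1, h2, h3, h4⟩
    refine ⟨star v, star_mem hv, ?_, ?_, by rw [star_star, h4], by rw [star_star, h3]⟩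
    · have := congrArg star h2; rwa [star_mul, hf.star_eq] at this
    · have := congrArg star h1; rwa [star_mul, hf.star_eq] at this
  have htrans : ∀ i j k, rel i j → rel j k → rel i k := by
    rintro i j k ⟨v, hv, h1, h2, h3, h4⟩ ⟨w, hw, h1', h2', h3', h4'⟩
    refine ⟨v * w, mul_mem hv hw, by rw [← mul_assoc, h1], by rw [mul_assoc, h2'], ?_, ?_⟩
    · rw [star_mul, mul_assoc, ← mul_assoc (star v), h3, h1', h3']
    · rw [star_mul, mul_assoc, ← mul_assoc w, h4', ← mul_assoc, h2, h4]
  -- the summands `f i a f j`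
  have hsum : a = ∑ i, ∑ j, f i * a * f j := by
    simp_rw [← Finset.mul_sum, hf.sum_eq, mul_one, ← Finset.sum_mul, hf.sum_eq, one_mul]
  rw [hsum]
  refine sum_mem fun i _ => sum_mem fun j _ => ?_
  by_cases hij : rel i j
  · obtain ⟨v, hv, hv1, hv2, hv3, hv4⟩ := hij
    have hw : ∀ k, ∃ w, w ∈ R ∧ f k * w = w ∧ w * f j = w ∧ (rel k j → star w * w = f j ∧
        w * star w = f k) ∧ (¬ rel k j → w = 0) ∧ (k = j → w = f j) := by
      intro k
      by_cases hkj' : k = j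
      · subst hkj'
        exact ⟨f k, hfR k, hf.idem k, hf.idem k, fun _ => by simp [hf.star_eq, hf.idem],
          fun h => absurd (hrefl k) h, fun _ => rfl⟩
      by_cases hkj : rel k j
      · obtain ⟨w, h1, h2, h3, h4, h5⟩ := hkj
        exact ⟨w, h1, h2, h3, fun _ => ⟨h4, h5⟩, fun h => absurd ⟨w, h1, h2, h3, h4, h5⟩ h,
          fun h => absurd h hkj'⟩
      · exact ⟨0, zero_mem R, by simp, by simp, fun h => absurd h hkj, fun _ => rfl,
          fun h => absurd h hkj'⟩
    choose w hwR hfw hwf hww hw0 hwj using hw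
    have hfw' : ∀ k, f j * star (w k) = star (w k) := fun k => by
      have := congrArg star (hwf k); rwa [star_mul, hf.star_eq] at this
    have hwf' : ∀ k, star (w k) * f k = star (w k) := fun k => by
      have := congrArg star (hfw k); rwa [star_mul, hf.star_eq] at this
    have hfw0 : ∀ k l, k ≠ l → f k * w l = 0 := fun k l hkl => by
      rw [← hfw l, ← mul_assoc, hf.orth k l hkl, zero_mul]
    have hwf0 : ∀ k l, k ≠ l → star (w k) * f l = 0 := fun k l hkl => by
      rw [← hwf' k, mul_assoc, hf.orth k l hkl, mul_zero]
    -- The corner `f i * a * f j` is transported to the element `b` of the corner at `f j` and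
    -- copied along the whole block by the partial isometries `w k`, as with matrix units. The sum
    -- `c` of the copies commutes with `R`, and the original corner is `v * f j * c`.
    set b := star v * a * f j with hb
    have hbA : b ∈ A := mul_mem (mul_mem (star_mem (hRA hv)) ha) (hRA (hfR j))
    have hfb : f j * b = b := by
      rw [hb, ← mul_assoc, ← mul_assoc]
      have := congrArg star hv2
      rw [star_mul, hf.star_eq] at this
      rw [this]
    have hbf : b * f j = b := by rw [hb, mul_assoc, hf.idem]
    set c := ∑ k, w k * b * star (w k) with hc
    have hcA : c ∈ A := sum_mem fun k _ =>
      mul_mem (mul_mem (hRA (hwR k)) hbA) (star_mem (hRA (hwR k)))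
    have hcomm : ∀ r ∈ R, Commute c r := by
      intro r hr
      have hrkl : ∀ k l, ∃ z : ℂ, star (w k) * r * w l = z • f j := by
        intro k l
        obtain ⟨z, hz⟩ := hD.atom_mul_mul_atom hf
          (mul_mem (mul_mem (star_mem (hwR k)) hr) (hwR l)) j
        refine ⟨z, ?_⟩
        have h1 : f j * (star (w k) * r * w l) * f j = (f j * star (w k)) * r * (w l * f j) := by
          simp only [mul_assoc]
        rw [← hz, h1, hfw', hwf]
      choose z hz using hrkl
      have hrw : ∀ l, r * w l = ∑ k, z k l • w k := by
        intro l
        calc r * w l = ∑ k, f k * (r * w l) := by rw [← Finset.sum_mul, hf.sum_eq, one_mul]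
          _ = _ := by
            refine Finset.sum_congr rfl fun k _ => ?_
            by_cases hk : rel k j
            · rw [← (hww k hk).2, mul_assoc, ← mul_assoc (star _), hz, mul_smul_comm, hwf]
            · rw [hw0 k hk, smul_zero]
              by_cases hl : rel l j
              · have hkl : ¬ rel k l := fun h => hk (htrans _ _ _ h hl)
                rw [← hfw l, ← mul_assoc r, ← mul_assoc, ← mul_assoc, hrel k l r hr hkl, zero_mul]
              · rw [hw0 l hl]; simp
      have hwr : ∀ k, star (w k) * r = ∑ l, z k l • star (w l) := by
        intro k
        calc star (w k) * r = ∑ l, (star (w k) * r) * f l := by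
              rw [← Finset.mul_sum, hf.sum_eq, mul_one]
          _ = _ := by
            refine Finset.sum_congr rfl fun l _ => ?_
            by_cases hl : rel l j
            · rw [← (hww l hl).2, ← mul_assoc, hz, smul_mul_assoc, hfw']
            · rw [hw0 l hl, star_zero, smul_zero]
              by_cases hk : rel k j
              · have hkl : ¬ rel k l := fun h => hl (htrans _ _ _ (hsymm _ _ h) hk)
                rw [← hwf' k, mul_assoc, mul_assoc, ← mul_assoc (f k), hrel k l r hr hkl, mul_zero]
              · rw [hw0 k hk]; simp
      change c * r = r * c
      rw [hc, Finset.sum_mul, Finset.mul_sum]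
      simp_rw [mul_assoc _ _ r, hwr, ← mul_assoc r, hrw, Finset.sum_mul, Finset.mul_sum]
      rw [Finset.sum_comm]
      refine Finset.sum_congr rfl fun k _ => Finset.sum_congr rfl fun l _ => ?_
      simp only [smul_mul_assoc, mul_smul_comm]
    have hkey : f i * a * f j = (v * f j) * c := by
      have h1 : f j * c = b := by
        rw [hc, Finset.mul_sum, Finset.sum_eq_single j]
        · rw [hwj j rfl, hf.star_eq, ← mul_assoc, ← mul_assoc, hf.idem, hfb, hbf]
        · intro k _ hk
          rw [← mul_assoc, ← mul_assoc, hfw0 j k (Ne.symm hk), zero_mul, zero_mul]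
        · simp
      rw [mul_assoc v, h1, hb, ← mul_assoc, ← mul_assoc, hv4]
    rw [hkey]
    exact StarSubalgebra.mul_mem_sup (mul_mem hv (hfR j)) (mem_relComm.2 ⟨hcA, hcomm⟩)
  · -- the central support of `f i`
    set q := ∑ k with rel k i, f k with hq
    have hqR : q ∈ R := sum_mem fun k _ => hfR k
    have hfq : ∀ k, f k * q = if rel k i then f k else 0 := by
      intro k
      rw [hq, Finset.mul_sum]
      simp_rw [hff]
      rw [Finset.sum_ite_eq]
      simp
    have hqf : ∀ k, q * f k = if rel k i then f k else 0 := by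
      intro k
      rw [← hfq]
      exact hD.comm _ (sum_mem fun k _ => hf.mem k) _ (hf.mem k)
    have hqc : q ∈ relComm R R := by
      refine mem_relComm.2 ⟨hqR, fun r hr => ?_⟩
      have h1 : ∀ x : M, x = ∑ k, ∑ l, f k * x * f l := by
        intro x
        simp_rw [← Finset.mul_sum, hf.sum_eq, mul_one, ← Finset.sum_mul, hf.sum_eq, one_mul]
      change q * r = r * q
      rw [h1 (q * r), h1 (r * q)]
      refine Finset.sum_congr rfl fun k _ => Finset.sum_congr rfl fun l _ => ?_
      rw [← mul_assoc (f k) q, hfq, ← mul_assoc (f k) r, mul_assoc _ q, hqf]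
      by_cases hkl : rel k l
      · have : rel k i ↔ rel l i :=
          ⟨fun h => htrans _ _ _ (hsymm _ _ hkl) h, fun h => htrans _ _ _ hkl h⟩
        simp only [this]
        split_ifs <;> simp
      · have h2 := hrel k l r hr hkl
        split_ifs <;> simp [h2]
    -- Inequivalent atoms are separated by the central projection `q`, which is the identity on `f
    -- i` and zero on `f j` and commutes with `a` by hypothesis.
    have h1 := (hz q hqc).eq
    have h2 : f i * a * f j = 0 := by
      have hi : f i * q = f i := by rw [hfq, if_pos (hrefl i)]
      have hj : q * f j = 0 := by rw [hqf, if_neg fun h => hij (hsymm _ _ h)]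
      rw [← hi, mul_assoc (f i), ← h1, mul_assoc, mul_assoc, hj, mul_zero, mul_zero]
    rw [h2]
    exact zero_mem _

end Decomposition

/-! ### Rooted trees given by their parent function -/

section Rooted

variable {V : Type*}

/-- `o`, `par`, `lev` are the root, the parent function and the level function of a rooted tree. -/
structure IsRooted (o : V) (par : V → V) (lev : V → ℕ) : Prop where
  par_root : par o = o
  lev_root : lev o = 0
  lev_par : ∀ x, x ≠ o → lev (par x) + 1 = lev x

/-- The children of `x`. -/
def kids (o : V) (par : V → V) (x : V) : Set V := {y | y ≠ o ∧ par y = x}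

/-- The descendants of `x`, including `x`. -/
def desc (par : V → V) (x : V) : Set V := {w | ∃ k, par^[k] w = x}

variable {o : V} {par : V → V} {lev : V → ℕ}

theorem self_mem_desc (x : V) : x ∈ desc par x := ⟨0, rfl⟩

theorem desc_trans {x y w : V} (h : w ∈ desc par y) (h' : y ∈ desc par x) : w ∈ desc par x := by
  obtain ⟨k, rfl⟩ := h
  obtain ⟨l, rfl⟩ := h'
  exact ⟨l + k, by rw [Function.iterate_add_apply]⟩

theorem desc_subset {x y : V} (h : y ∈ desc par x) : desc par y ⊆ desc par x :=
  fun _ hw => desc_trans hw h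

namespace IsRooted

variable (h : IsRooted o par lev)
include h

theorem eq_root_of_lev {x : V} (hx : lev x = 0) : x = o := by
  by_contra hne
  have := h.lev_par x hne
  omega

theorem mem_desc_iff {x w : V} : w ∈ desc par x ↔ w = x ∨ (w ≠ o ∧ par w ∈ desc par x) := by
  constructor
  · rintro ⟨k, hk⟩
    rcases k with _ | k
    · exact Or.inl hk
    · by_cases hw : w = o
      · left
        subst hw
        rw [← hk]
        exact (Function.iterate_fixed h.par_root _).symm
      · exact Or.inr ⟨hw, k, hk⟩
  · rintro (rfl | ⟨-, k, hk⟩)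
    · exact self_mem_desc _
    · exact ⟨k + 1, hk⟩

theorem desc_induction {P : V → Prop} (hP : ∀ w, (w ≠ o → P (par w)) → P w) (w : V) : P w := by
  obtain ⟨n, hn⟩ : ∃ n, lev w = n := ⟨_, rfl⟩
  induction n generalizing w with
  | zero => exact hP w fun hw => absurd (h.eq_root_of_lev hn) hw
  | succ n ih => exact hP w fun hw => ih _ (by have := h.lev_par w hw; omega)

theorem desc_root : desc par o = Set.univ := by
  ext w
  simp only [Set.mem_univ, iff_true]
  induction w using h.desc_induction with
  | hP w ih =>
    rw [h.mem_desc_iff]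
    by_cases hw : w = o
    · exact Or.inl hw
    · exact Or.inr ⟨hw, ih hw⟩

theorem lev_le_of_mem_desc {x w : V} (hw : w ∈ desc par x) : lev x ≤ lev w := by
  induction w using h.desc_induction with
  | hP w ih =>
    rcases h.mem_desc_iff.1 hw with rfl | ⟨hwo, hw'⟩
    · exact le_rfl
    · have := ih hwo hw'
      have := h.lev_par w hwo
      omega

theorem lev_lt_of_mem_desc {x w : V} (hw : w ∈ desc par x) (hne : w ≠ x) : lev x < lev w := by
  rcases h.mem_desc_iff.1 hw with rfl | ⟨hwo, hw'⟩
  · exact absurd rfl hne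
  · have := h.lev_le_of_mem_desc hw'
    have := h.lev_par w hwo
    omega

theorem eq_of_mem_desc {x y w : V} (hx : w ∈ desc par x) (hy : w ∈ desc par y)
    (hl : lev x = lev y) : x = y := by
  induction w using h.desc_induction with
  | hP w ih =>
    by_cases hwx : w = x
    · subst hwx
      by_contra hne
      have := h.lev_lt_of_mem_desc hy hne
      omega
    by_cases hwy : w = y
    · subst hwy
      have := h.lev_lt_of_mem_desc hx hwx
      omega
    obtain ⟨hwo, hx'⟩ := (h.mem_desc_iff.1 hx).resolve_left hwx
    exact ih hwo hx' ((h.mem_desc_iff.1 hy).resolve_left hwy).2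

theorem lev_of_mem_kids {x y : V} (hy : y ∈ kids o par x) : lev y = lev x + 1 := by
  have := h.lev_par y hy.1
  rw [hy.2] at this
  omega

theorem mem_desc_of_mem_kids {x y : V} (hy : y ∈ kids o par x) : y ∈ desc par x :=
  h.mem_desc_iff.2 (Or.inr ⟨hy.1, by rw [hy.2]; exact self_mem_desc _⟩)

theorem desc_disjoint {x y : V} (hxy : x ≠ y) (hl : lev x = lev y) :
    Disjoint (desc par x) (desc par y) :=
  Set.disjoint_left.2 fun _ hx hy => hxy (h.eq_of_mem_desc hx hy hl)

theorem kids_desc_disjoint {x y y' : V} (hy : y ∈ kids o par x) (hy' : y' ∈ kids o par x)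
    (hne : y ≠ y') : Disjoint (desc par y) (desc par y') :=
  h.desc_disjoint hne (by rw [h.lev_of_mem_kids hy, h.lev_of_mem_kids hy'])

theorem self_notMem_desc_kid {x y : V} (hy : y ∈ kids o par x) : x ∉ desc par y := fun hx => by
  have := h.lev_le_of_mem_desc hx
  have := h.lev_of_mem_kids hy
  omega

theorem mem_desc_iff_kids {x w : V} :
    w ∈ desc par x ↔ w = x ∨ ∃ y ∈ kids o par x, w ∈ desc par y := by
  constructor
  · intro hw
    induction w using h.desc_induction with
    | hP w ih =>
      rcases h.mem_desc_iff.1 hw with rfl | ⟨hwo, hw'⟩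
      · exact Or.inl rfl
      · right
        rcases ih hwo hw' with h1 | ⟨y, hy, h1⟩
        · exact ⟨w, ⟨hwo, h1⟩, self_mem_desc _⟩
        · exact ⟨y, hy, h.mem_desc_iff.2 (Or.inr ⟨hwo, h1⟩)⟩
  · rintro (rfl | ⟨y, hy, h1⟩)
    · exact self_mem_desc _
    · exact desc_trans h1 (h.mem_desc_of_mem_kids hy)

theorem kids_subset_desc_of_mem {x w : V} (hw : w ∈ desc par x) : kids o par w ⊆ desc par x :=
  fun _ hy => desc_trans (h.mem_desc_of_mem_kids hy) hw

theorem kids_subset_compl_desc {x w : V} (hw : w ∉ desc par x) (hl : lev x ≤ lev w) :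
    kids o par w ⊆ (desc par x)ᶜ := by
  intro y hy hyx
  rcases h.mem_desc_iff.1 hyx with rfl | ⟨-, h2⟩
  · have := h.lev_of_mem_kids hy
    omega
  · rw [hy.2] at h2
    exact hw h2

end IsRooted

/-- A tree with a distinguished vertex is a rooted tree. -/
theorem exists_isRooted (G : SimpleGraph V) (hG : G.IsTree) (o : V) :
    ∃ par : V → V, IsRooted o par (G.dist o) ∧ (∀ x, succs G o x = kids o par x) ∧
      ∀ x y, G.Adj x y ↔ (x ≠ o ∧ par x = y) ∨ (y ≠ o ∧ par y = x) := by
  classical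
  choose q hq hql using hG.connected.exists_path_of_dist o
  let par : V → V := fun x => if x = o then o else (q x).penultimate
  have hnil : ∀ x, x ≠ o → ¬ (q x).Nil := fun x hx hn => hx hn.eq.symm
  have hadj : ∀ x, x ≠ o → G.Adj (par x) x := fun x hx => by
    simp only [par, if_neg hx]
    exact (q x).adj_penultimate (hnil x hx)
  have hlev : ∀ x, x ≠ o → G.dist o (par x) + 1 = G.dist o x := fun x hx => by
    rcases hG.dist_eq_dist_add_one_of_adj o (hadj x hx) with h1 | h1
    · exfalso
      have h2 : G.dist o (par x) ≤ (q x).dropLast.length := by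
        simp only [par, if_neg hx]
        exact SimpleGraph.dist_le _
      have h3 : (q x).dropLast.length ≤ (q x).length := by
        simp [SimpleGraph.Walk.dropLast]
      rw [hql] at h3
      omega
    · exact h1.symm
  have huniq : ∀ x v, G.Adj v x → G.dist o v < G.dist o x → x ≠ o ∧ par x = v := by
    intro x v hvx hlt
    have hx : x ≠ o := by rintro rfl; simp at hlt
    refine ⟨hx, ?_⟩
    have hxs : x ∉ (q v).support := by
      intro hmem
      have h1 : G.dist o x ≤ ((q v).takeUntil x hmem).length := SimpleGraph.dist_le _
      have h2 := (q v).length_takeUntil_le_length hmem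
      rw [hql] at h2
      omega
    have h1 := hG.isAcyclic.mem_support_of_ne_mem_support_of_adj_of_isPath (hq x) (hq v) hvx.symm hxs
    simp only [par, if_neg hx]
    exact (hG.isAcyclic.eq_penultimate_of_adj_end (hq x) hvx.symm h1).symm
  refine ⟨par, ⟨by simp [par], by simp, hlev⟩, ?_, ?_⟩
  · intro x
    ext y
    constructor
    · rintro ⟨h1, h2⟩
      exact huniq y x h1 h2
    · rintro ⟨h1, rfl⟩
      exact ⟨hadj y h1, by have := hlev y h1; omega⟩
  · intro x y
    constructor
    · intro hxy
      rcases hG.dist_eq_dist_add_one_of_adj o hxy with h1 | h1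
      · exact Or.inl (huniq x y hxy.symm (by omega))
      · exact Or.inr (huniq y x hxy (by omega))
    · rintro (⟨h1, rfl⟩ | ⟨h1, rfl⟩)
      · exact (hadj x h1).symm
      · exact hadj y h1

theorem finite_ball (G : SimpleGraph V) [G.LocallyFinite] (hG : G.IsTree) (o : V) (n : ℕ) :
    (ball G o n).Finite := by
  obtain ⟨par, hr, hk, hadj⟩ := exists_isRooted G hG o
  induction n with
  | zero =>
    refine (Set.finite_singleton o).subset fun x hx => ?_
    exact hr.eq_root_of_lev (Nat.le_zero.1 hx)
  | succ n ih =>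
    refine (ih.union (ih.biUnion fun x _ => (G.neighborSet x).toFinite)).subset fun x hx => ?_
    by_cases hxo : x = o
    · left; subst hxo; simp [ball]
    · right
      have h1 := hr.lev_par x hxo
      refine Set.mem_biUnion (x := par x) ?_ ((hadj _ _).2 (Or.inr ⟨hxo, rfl⟩))
      have : G.dist o x ≤ n + 1 := hx
      change G.dist o (par x) ≤ n
      omega

end Rooted

/-! ### The local algebras -/

section Local

variable {V : Type*} {d : V → ℕ} [∀ x, NeZero (d x)]

theorem Config.update_apply_self (s : Config d) (x : V) (i : Fin (d x)) : (s.update x i).1 x = i := by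
  simp [Config.update]

theorem Config.update_apply_of_ne (s : Config d) {x y : V} (h : y ≠ x) (i : Fin (d x)) :
    (s.update x i).1 y = s.1 y := by
  classical
  simp [Config.update, Function.update_of_ne h]

theorem Config.update_update (s : Config d) (x : V) (i j : Fin (d x)) :
    (s.update x i).update x j = s.update x j := by
  apply Subtype.ext
  simp [Config.update]

theorem Config.update_self (s : Config d) (x : V) : s.update x (s.1 x) = s := by
  apply Subtype.ext
  simp [Config.update]

theorem Config.update_comm (s : Config d) {x y : V} (h : x ≠ y) (i : Fin (d x)) (j : Fin (d y)) :
    (s.update x i).update y j = (s.update y j).update x i := by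
  classical
  apply Subtype.ext
  simp only [Config.update]
  exact Function.update_comm h _ _ _

theorem siteOp_mul (x : V) (a b : Matrix (Fin (d x)) (Fin (d x)) ℂ) :
    siteOp x (a * b) = siteOp x a * siteOp x b := by
  ext f s
  rw [mul_apply_eq_comp, siteOp_apply, siteOp_apply]
  simp_rw [siteOp_apply, Config.update_apply_self, Config.update_update, Matrix.mul_apply,
    Finset.sum_mul, Finset.mul_sum]
  rw [Finset.sum_comm]
  simp_rw [mul_assoc]

theorem siteOp_one (x : V) : siteOp x (1 : Matrix (Fin (d x)) (Fin (d x)) ℂ) = 1 := by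
  ext f s
  rw [siteOp_apply]
  simp [Matrix.one_apply, Config.update_self]

theorem siteOp_add (x : V) (a b : Matrix (Fin (d x)) (Fin (d x)) ℂ) :
    siteOp x (a + b) = siteOp x a + siteOp x b := by
  ext f s
  rw [add_apply, lp.coeFn_add, Pi.add_apply]
  simp_rw [siteOp_apply, Matrix.add_apply, add_mul, Finset.sum_add_distrib]

theorem siteOp_smul (x : V) (c : ℂ) (a : Matrix (Fin (d x)) (Fin (d x)) ℂ) :
    siteOp x (c • a) = c • siteOp x a := by
  ext f s
  rw [smul_apply, lp.coeFn_smul, Pi.smul_apply, smul_eq_mul]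
  simp_rw [siteOp_apply, Matrix.smul_apply, smul_eq_mul, Finset.mul_sum, mul_assoc]

open Classical in
theorem siteOp_single (x : V) (a : Matrix (Fin (d x)) (Fin (d x)) ℂ) (s : Config d) :
    siteOp x a (lp.single 2 s (1 : ℂ)) = ∑ j, a j (s.1 x) • lp.single 2 (s.update x j) (1 : ℂ) := by
  ext t
  rw [siteOp_apply, lp.coeFn_sum, Finset.sum_apply]
  simp_rw [lp.coeFn_smul, Pi.smul_apply, lp.single_apply, smul_eq_mul]
  by_cases h : t = s.update x (t.1 x)
  · rw [Finset.sum_eq_single (s.1 x), Finset.sum_eq_single (t.1 x)]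
    · rw [← h]
      have : t.update x (s.1 x) = s := by
        conv_lhs => rw [h, Config.update_update, Config.update_self]
      rw [this]
      simp
    · intro j _ hj
      rw [Pi.single_eq_of_ne, mul_zero]
      intro h2
      apply hj
      rw [h2, Config.update_apply_self]
    · simp
    · intro j _ hj
      rw [Pi.single_eq_of_ne, mul_zero]
      intro h2
      apply hj
      rw [← h2, Config.update_apply_self]
    · simp
  · rw [Finset.sum_eq_zero, Finset.sum_eq_zero]
    · intro j _
      rw [Pi.single_eq_of_ne, mul_zero]
      intro h2
      apply h
      rw [h2, Config.update_apply_self]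
    · intro j _
      rw [Pi.single_eq_of_ne, mul_zero]
      intro h2
      apply h
      rw [← h2, Config.update_update, Config.update_self]

theorem siteOp_star (x : V) (a : Matrix (Fin (d x)) (Fin (d x)) ℂ) :
    siteOp x (star a) = star (siteOp x a) := by
  classical
  ext f s
  have h1 : ∀ g : Hilb d, g s = inner ℂ (lp.single 2 s (1 : ℂ)) g := fun g => by
    rw [lp.inner_single_left]
    simp
  rw [h1 ((star (siteOp x a)) f), ContinuousLinearMap.star_eq_adjoint,
    ContinuousLinearMap.adjoint_inner_right, siteOp_single, sum_inner, siteOp_apply]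
  refine Finset.sum_congr rfl fun j _ => ?_
  rw [inner_smul_left, lp.inner_single_left]
  simp [Matrix.star_apply]

theorem siteOp_commute {x y : V} (h : x ≠ y) (a : Matrix (Fin (d x)) (Fin (d x)) ℂ)
    (b : Matrix (Fin (d y)) (Fin (d y)) ℂ) : Commute (siteOp x a) (siteOp y b) := by
  change _ * _ = _ * _
  ext f s
  rw [mul_apply_eq_comp, mul_apply_eq_comp, siteOp_apply, siteOp_apply]
  simp_rw [siteOp_apply, Config.update_apply_of_ne _ h, Config.update_apply_of_ne _ h.symm,
    Finset.mul_sum, Config.update_comm _ h]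
  rw [Finset.sum_comm]
  refine Finset.sum_congr rfl fun i _ => Finset.sum_congr rfl fun j _ => ?_
  ring

variable (𝒜 : ∀ x, StarSubalgebra ℂ (Matrix (Fin (d x)) (Fin (d x)) ℂ))

/-- The matrix algebra at the site `x` as operators. -/
def siteHom (x : V) : Matrix (Fin (d x)) (Fin (d x)) ℂ →⋆ₐ[ℂ] Op d :=
  { toFun := siteOp x
    map_one' := siteOp_one x
    map_mul' := siteOp_mul x
    map_zero' := by simpa using siteOp_smul x (0 : ℂ) 0
    map_add' := siteOp_add x
    commutes' := fun r => by
      rw [Algebra.algebraMap_eq_smul_one, siteOp_smul, siteOp_one, ← Algebra.algebraMap_eq_smul_one]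
    map_star' := siteOp_star x }

theorem locAlg_singleton (x : V) : locAlg 𝒜 {x} = (𝒜 x).map (siteHom x) := by
  refine le_antisymm (StarAlgebra.adjoin_le ?_) ?_
  · rintro T ⟨y, rfl, a, ha, rfl⟩
    exact ⟨a, ha, rfl⟩
  · rintro T ⟨a, ha, rfl⟩
    exact StarAlgebra.subset_adjoin ℂ _ ⟨x, rfl, a, ha, rfl⟩

theorem finiteDimensional_locAlg_singleton (x : V) : FiniteDimensional ℂ (locAlg 𝒜 {x}) := by
  rw [locAlg_singleton]
  have h : FiniteDimensional ℂ ((Subalgebra.toSubmodule (𝒜 x).toSubalgebra).map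
      (siteHom (d := d) x).toAlgHom.toLinearMap) := inferInstance
  exact h

theorem locAlg_eq_region (Λ : Set V) : locAlg 𝒜 Λ = region (fun x => locAlg 𝒜 {x}) Λ := by
  refine le_antisymm (StarAlgebra.adjoin_le ?_) (region_le fun x hx => locAlg_mono 𝒜 (by simpa using hx))
  rintro T ⟨x, hx, a, ha, rfl⟩
  exact le_region (A := fun x => locAlg 𝒜 {x}) hx
    (StarAlgebra.subset_adjoin ℂ _ ⟨x, rfl, a, ha, rfl⟩)

theorem pairwise_commAlg_locAlg : Pairwise fun x y => CommAlg (locAlg 𝒜 {x}) (locAlg 𝒜 {y}) := by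
  intro x y hxy a ha b hb
  rw [locAlg_singleton] at ha hb
  obtain ⟨a, -, rfl⟩ := ha
  obtain ⟨b, -, rfl⟩ := hb
  exact siteOp_commute hxy a b

end Local

/-! ### Unital Kadison–Schwarz maps -/

section KadisonSchwarz

variable {H : Type*} [NormedAddCommGroup H] [InnerProductSpace ℂ H] [CompleteSpace H]

/-- `G` restricts to a unital hermitian map `A → B` that satisfies the Kadison–Schwarz inequality. -/
structure IsKS (A B : StarSubalgebra ℂ (H →L[ℂ] H)) (G : (H →L[ℂ] H) →ₗ[ℂ] (H →L[ℂ] H)) : Prop where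
  mem : ∀ a ∈ A, G a ∈ B
  one : G 1 = 1
  star : ∀ a ∈ A, G (star a) = star (G a)
  ks : ∀ a ∈ A, ∀ ξ, ‖G a ξ‖ ^ 2 ≤ (inner ℂ ξ (G (Star.star a * a) ξ)).re

theorem inner_star_mul_self (a : H →L[ℂ] H) (ξ : H) :
    inner ℂ ξ ((star a * a) ξ) = ((‖a ξ‖ ^ 2 : ℝ) : ℂ) := by
  rw [mul_apply_eq_comp, ContinuousLinearMap.star_eq_adjoint,
    ContinuousLinearMap.adjoint_inner_right, inner_self_eq_norm_sq_to_K]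
  simp

variable {A B C : StarSubalgebra ℂ (H →L[ℂ] H)} {G G' : (H →L[ℂ] H) →ₗ[ℂ] (H →L[ℂ] H)}

theorem IsKS.mono (h : IsKS A B G) {A' B' : StarSubalgebra ℂ (H →L[ℂ] H)} (hA : A' ≤ A)
    (hB : B ≤ B') : IsKS A' B' G :=
  ⟨fun a ha => hB (h.mem a (hA ha)), h.one, fun a ha => h.star a (hA ha), fun a ha => h.ks a (hA ha)⟩

/-- The defect in the Kadison–Schwarz inequality is a positive operator in the closed algebra `B`
and so a square inside `B`. In this form it can be fed to functionals that are only known to be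
positive on `B`. -/
theorem IsKS.exists_defect (h : IsKS A B G) (hB : IsClosed (B : Set (H →L[ℂ] H)))
    {a : H →L[ℂ] H} (ha : a ∈ A) :
    ∃ c ∈ B, G (Star.star a * a) - Star.star (G a) * G a = Star.star c * c := by
  have haa : Star.star a * a ∈ A := mul_mem (star_mem ha) ha
  refine exists_eq_star_mul_self_of_nonneg hB
    (sub_mem (h.mem _ haa) (mul_mem (star_mem (h.mem _ ha)) (h.mem _ ha))) ?_
  rw [ContinuousLinearMap.nonneg_iff_isPositive, ContinuousLinearMap.isPositive_def']
  constructor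
  · have h1 := h.star _ haa
    rw [star_mul, star_star] at h1
    rw [isSelfAdjoint_iff, star_sub, ← h1, star_mul, star_star]
  · intro ξ
    rw [ContinuousLinearMap.reApplyInnerSelf_apply]
    rw [inner_re_symm, sub_apply, inner_sub_right, inner_star_mul_self]
    have := h.ks a ha ξ
    simp only [map_sub, RCLike.re_to_complex, Complex.ofReal_re]
    linarith

theorem IsKS.inner_nonneg (h : IsKS A B G) (hA : IsClosed (A : Set (H →L[ℂ] H)))
    {x : H →L[ℂ] H} (hx : x ∈ A) (h0 : 0 ≤ x) (ξ : H) : 0 ≤ (inner ℂ ξ (G x ξ)).re := by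
  obtain ⟨c, hc, rfl⟩ := exists_eq_star_mul_self_of_nonneg hA hx h0
  exact (sq_nonneg _).trans (h.ks c hc ξ)

/-- The second map keeps the defect of the first one positive, because that defect is `star c * c`
with `c` in the domain of the second map. -/
theorem IsKS.comp (h : IsKS A B G) (h' : IsKS B C G') (hB : IsClosed (B : Set (H →L[ℂ] H))) :
    IsKS A C (G' ∘ₗ G) where
  mem a ha := h'.mem _ (h.mem a ha)
  one := by rw [LinearMap.comp_apply, h.one, h'.one]
  star a ha := by
    rw [LinearMap.comp_apply, LinearMap.comp_apply, h.star a ha, h'.star _ (h.mem a ha)]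
  ks a ha ξ := by
    obtain ⟨c, hc, hcd⟩ := h.exists_defect hB ha
    have h1 := h'.ks _ (h.mem a ha) ξ
    have h2 := (sq_nonneg _).trans (h'.ks c hc ξ)
    rw [← hcd, map_sub, sub_apply, inner_sub_right, Complex.sub_re] at h2
    rw [LinearMap.comp_apply, LinearMap.comp_apply]
    linarith

/-- Apply the unital map to the positive element ‖a‖² − a* a and combine with Kadison–Schwarz. -/
theorem IsKS.norm_le (h : IsKS A B G) (hA : IsClosed (A : Set (H →L[ℂ] H)))
    {a : H →L[ℂ] H} (ha : a ∈ A) : ‖G a‖ ≤ ‖a‖ := by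
  refine ContinuousLinearMap.opNorm_le_bound _ (norm_nonneg a) fun ξ => ?_
  have h1 : 0 ≤ algebraMap ℝ (H →L[ℂ] H) (‖a‖ ^ 2) - Star.star a * a :=
    sub_nonneg.2 CStarAlgebra.star_mul_le_algebraMap_norm_sq
  have h2 : algebraMap ℝ (H →L[ℂ] H) (‖a‖ ^ 2) = ((‖a‖ ^ 2 : ℝ) : ℂ) • 1 := by
    rw [Algebra.algebraMap_eq_smul_one, Complex.coe_smul]
  rw [h2] at h1
  have h3 := h.inner_nonneg hA (sub_mem (A.smul_mem (one_mem A) _) (mul_mem (star_mem ha) ha)) h1 ξ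
  rw [map_sub, map_smul, h.one, sub_apply, inner_sub_right, smul_apply,
    inner_smul_right, one_apply_eq_self, inner_self_eq_norm_sq_to_K, Complex.sub_re] at h3
  have h4 := h.ks a ha ξ
  have h5 : ((((‖a‖ ^ 2 : ℝ) : ℂ)) * (((‖ξ‖ : ℝ) : ℂ)) ^ 2).re = (‖a‖ * ‖ξ‖) ^ 2 := by
    rw [← Complex.ofReal_pow, ← Complex.ofReal_mul, Complex.ofReal_re]; ring
  have h6 : ‖G a ξ‖ ^ 2 ≤ (‖a‖ * ‖ξ‖) ^ 2 := by
    rw [← h5]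
    have h3' := h3
    simp only [Complex.coe_algebraMap] at h3'
    linarith
  exact (pow_le_pow_iff_left₀ (norm_nonneg _) (by positivity) two_ne_zero).1 h6

theorem IsKS.of_tendsto {ι : Type*} {l : Filter ι} [NeBot l]
    {Gs : ι → (H →L[ℂ] H) →ₗ[ℂ] (H →L[ℂ] H)} (h : ∀ i, IsKS A B (Gs i))
    (hB : IsClosed (B : Set (H →L[ℂ] H))) (hlim : ∀ a ∈ A, Tendsto (fun i => Gs i a) l (𝓝 (G a))) :
    IsKS A B G where
  mem a ha := hB.mem_of_tendsto (hlim a ha) (Eventually.of_forall fun i => (h i).mem a ha)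
  one := by
    have h1 := hlim 1 (one_mem A)
    simp_rw [(h _).one] at h1
    exact tendsto_nhds_unique h1 tendsto_const_nhds
  star a ha := by
    have h1 := hlim _ (star_mem ha)
    simp_rw [(h _).star a ha] at h1
    exact tendsto_nhds_unique h1 (hlim a ha).star
  ks a ha ξ := by
    have h1 : Tendsto (fun i => ‖Gs i a ξ‖ ^ 2) l (𝓝 (‖G a ξ‖ ^ 2)) :=
      ((((ContinuousLinearMap.apply ℂ H ξ).continuous.tendsto _).comp (hlim a ha)).norm).pow 2
    have h2 := ((ContinuousLinearMap.apply ℂ H ξ).continuous.tendsto _).comp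
      (hlim _ (mul_mem (star_mem ha) ha))
    have h3 := (Complex.continuous_re.tendsto _).comp ((tendsto_const_nhds (x := ξ)).inner (𝕜 := ℂ) h2)
    exact le_of_tendsto_of_tendsto' h1 h3 fun i => (h i).ks a ha ξ

/-- Equality in the Kadison–Schwarz inequality under a positive functional. -/
theorem IsKS.map_star_mul (h : IsKS A B G) (hB : IsClosed (B : Set (H →L[ℂ] H)))
    {ψ : (H →L[ℂ] H) →ₗ[ℂ] ℂ} (hψ : PosOn B ψ) {k c : H →L[ℂ] H} (hk : k ∈ A) (hc : c ∈ A)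
    (h0 : ψ (Star.star (G k) * G k) = ψ (G (Star.star k * k))) :
    ψ (Star.star (G k) * G c) = ψ (G (Star.star k * c)) := by
  have key : ∀ z : ℂ, 0 ≤ (ψ (G (Star.star c * c)) - ψ (Star.star (G c) * G c))
      + z * (ψ (G (Star.star c * k)) - ψ (Star.star (G c) * G k))
      + (starRingEnd ℂ) z * (ψ (G (Star.star k * c)) - ψ (Star.star (G k) * G c)) := by
    intro z
    obtain ⟨e, he, hed⟩ := h.exists_defect hB (add_mem hc (A.smul_mem hk z))
    have h1 := hψ e he
    rw [← hed, map_sub, map_add G c, map_smul, star_add_smul_mul_self, star_add_smul_mul_self] at h1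
    simp only [map_add, map_smul, smul_eq_mul, h0] at h1
    convert h1 using 1
    ring
  exact (sub_eq_zero.1 (eq_zero_of_forall_nonneg key).2).symm

/-- The functionals and maps in use are arbitrary linear extensions to all operators, with no
continuity there; on the finite-dimensional algebras of balls continuity is automatic. -/
theorem tendsto_apply_of_finiteDimensional {E X : Type*} [NormedAddCommGroup E] [NormedSpace ℂ E]
    [AddCommGroup X] [Module ℂ X] [TopologicalSpace X] [IsTopologicalAddGroup X]
    [ContinuousSMul ℂ X] (S : Submodule ℂ E) [FiniteDimensional ℂ S]
    (ψ : E →ₗ[ℂ] X) {ι : Type*} {l : Filter ι} {u : ι → E} {b : E} (hu : ∀ i, u i ∈ S)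
    (hb : b ∈ S) (hlim : Tendsto u l (𝓝 b)) : Tendsto (fun i => ψ (u i)) l (𝓝 (ψ b)) := by
  have h1 : Tendsto (fun i => (⟨u i, hu i⟩ : S)) l (𝓝 ⟨b, hb⟩) := tendsto_subtype_rng.2 hlim
  exact ((ψ.comp S.subtype).continuous_of_finiteDimensional.tendsto _).comp h1

theorem IsKS.pow (h : IsKS A A G) (hA : IsClosed (A : Set (H →L[ℂ] H))) (k : ℕ) :
    IsKS A A (G ^ k) := by
  induction k with
  | zero =>
    refine ⟨fun a ha => ha, rfl, fun a _ => rfl, fun a _ ξ => ?_⟩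
    change ‖a ξ‖ ^ 2 ≤ (inner ℂ ξ ((Star.star a * a) ξ)).re
    rw [inner_star_mul_self, Complex.ofReal_re]
  | succ k ih =>
    rw [pow_succ']
    exact ih.comp h hA

/-- The powers of a contraction of a finite-dimensional space have an idempotent limit along an
ultrafilter. -/
theorem exists_idempotent_limit_pow {X : Type*} [NormedAddCommGroup X] [NormedSpace ℂ X]
    [FiniteDimensional ℂ X] (T : X →L[ℂ] X) (hT : ∀ k (x : X), ‖(T ^ k) x‖ ≤ ‖x‖) :
    ∃ (l : Ultrafilter ℕ) (m s : X →L[ℂ] X), Tendsto (fun k => T ^ (k + 1)) l (𝓝 m) ∧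
      Tendsto (fun k => T ^ k) l (𝓝 s) ∧ m * m = m ∧ T * s = m ∧ m * s = s * m := by
  have hbd : ∀ k, T ^ k ∈ Metric.closedBall (0 : X →L[ℂ] X) 1 := by
    intro k
    rw [mem_closedBall_zero_iff]
    refine ContinuousLinearMap.opNorm_le_bound _ zero_le_one fun a => ?_
    rw [one_mul]
    exact hT k a
  have hprop : ProperSpace (X →L[ℂ] X) := FiniteDimensional.proper ℂ _
  have hcpt : IsCompact (Metric.closedBall (0 : X →L[ℂ] X) 1) := isCompact_closedBall _ _
  let S0 : Subsemigroup (X →L[ℂ] X) :=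
    { carrier := Set.range fun k : ℕ => T ^ (k + 1)
      mul_mem' := by
        rintro _ _ ⟨k, rfl⟩ ⟨l, rfl⟩
        exact ⟨k + 1 + l, by rw [← pow_add]; rfl⟩ }
  have hsub : closure (S0 : Set (X →L[ℂ] X)) ⊆ Metric.closedBall 0 1 :=
    closure_minimal (by rintro _ ⟨k, rfl⟩; exact hbd _) Metric.isClosed_closedBall
  -- The closure of the positive powers is a compact semigroup, so it contains an idempotent
  -- (Ellis–Numakura).
  obtain ⟨m, hm, hmm⟩ := exists_idempotent_in_compact_subsemigroup
    (fun r : X →L[ℂ] X => continuous_mul_const r) (closure (S0 : Set (X →L[ℂ] X)))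
    ⟨T ^ (0 + 1), subset_closure ⟨0, rfl⟩⟩
    (hcpt.of_isClosed_subset isClosed_closure hsub)
    (fun x hx y hy => S0.topologicalClosure.mul_mem hx hy)
  have hne : NeBot (comap (fun k : ℕ => T ^ (k + 1)) (𝓝 m)) := by
    rw [comap_neBot_iff]
    intro t ht
    obtain ⟨x, hx, k, rfl⟩ := mem_closure_iff_nhds.1 hm t ht
    exact ⟨k, hx⟩
  let l := Ultrafilter.of (comap (fun k : ℕ => T ^ (k + 1)) (𝓝 m))
  -- The powers shifted by one converge along the same ultrafilter to `s` with `T * s = m`: on the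
  -- range of `m`, the limit `s` inverts `T`.
  obtain ⟨s, -, hs⟩ := hcpt.ultrafilter_le_nhds (l.map fun k : ℕ => T ^ k)
    (by
      rw [le_principal_iff]
      exact Filter.mem_map.2 (univ_mem' fun k => hbd k))
  have hm' : Tendsto (fun k => T ^ (k + 1)) l (𝓝 m) :=
    tendsto_comap.mono_left (Ultrafilter.of_le _)
  have hcomm : ∀ j, T ^ j * s = s * T ^ j := fun j =>
    tendsto_nhds_unique (((continuous_const_mul (T ^ j)).tendsto s).comp hs)
      ((((continuous_mul_const (T ^ j)).tendsto s).comp hs).congr fun k =>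
        (Commute.pow_pow (Commute.refl T) k j).eq)
  refine ⟨l, m, s, hm', hs, hmm, ?_, ?_⟩
  · exact tendsto_nhds_unique ((((continuous_const_mul T).tendsto s).comp hs).congr fun k =>
      (pow_succ' T k).symm) hm'
  · exact tendsto_nhds_unique (((continuous_mul_const s).tendsto m).comp hm')
      ((((continuous_const_mul s).tendsto m).comp hm').congr fun k => (hcomm (k + 1)).symm)

theorem exists_idempotent_limit_of_mapsTo {E : Type*} [NormedAddCommGroup E] [NormedSpace ℂ E]
    (X : Submodule ℂ E) [FiniteDimensional ℂ X] (G : E →ₗ[ℂ] E) (hmaps : ∀ a ∈ X, G a ∈ X)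
    (hbd : ∀ k, ∀ a ∈ X, ‖(G ^ k) a‖ ≤ ‖a‖) :
    ∃ (l : Ultrafilter ℕ) (F S : E →ₗ[ℂ] E),
      (∀ a ∈ X, Tendsto (fun k => (G ^ (k + 1)) a) l (𝓝 (F a))) ∧
      (∀ a ∈ X, Tendsto (fun k => (G ^ k) a) l (𝓝 (S a))) ∧ (∀ a ∈ X, F (F a) = F a) ∧
      (∀ a ∈ X, G (S a) = F a) ∧ ∀ a ∈ X, F (S a) = S (F a) := by
  let T : X →L[ℂ] X := LinearMap.toContinuousLinearMap (G.restrict hmaps)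
  have hT : ∀ k (a : X), ((T ^ k) a : E) = (G ^ k) a := by
    intro k
    induction k with
    | zero => intro a; rfl
    | succ k ih =>
      intro a
      rw [pow_succ, pow_succ]
      change ((T ^ k) (T a) : E) = (G ^ k) (G a)
      rw [ih]; rfl
  obtain ⟨l, m, s, hlm, hls, hmm, hTs, hms⟩ := exists_idempotent_limit_pow T (fun k a => by
    change ‖((T ^ k) a : E)‖ ≤ ‖(a : E)‖
    rw [hT]
    exact hbd k a a.2)
  obtain ⟨F, hF⟩ := LinearMap.exists_extend (X.subtype ∘ₗ (m : X →ₗ[ℂ] X))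
  obtain ⟨S, hS⟩ := LinearMap.exists_extend (X.subtype ∘ₗ (s : X →ₗ[ℂ] X))
  have hF' : ∀ a : X, F a = m a := fun a => LinearMap.congr_fun hF a
  have hS' : ∀ a : X, S a = s a := fun a => LinearMap.congr_fun hS a
  have hpt : ∀ (u : ℕ → X →L[ℂ] X) (v : X →L[ℂ] X) (a : X), Tendsto u l (𝓝 v) →
      Tendsto (fun k => ((u k) a : E)) l (𝓝 (v a)) := fun u v a hu =>
    (continuous_subtype_val.tendsto _).comp
      (((ContinuousLinearMap.apply ℂ X a).continuous.tendsto _).comp hu)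
  refine ⟨l, F, S, ?_, ?_, ?_, ?_, ?_⟩
  · intro a ha
    rw [hF' ⟨a, ha⟩]
    exact (hpt _ _ _ hlm).congr fun k => hT _ _
  · intro a ha
    rw [hS' ⟨a, ha⟩]
    exact (hpt _ _ _ hls).congr fun k => hT _ _
  · intro a ha
    rw [hF' ⟨a, ha⟩, hF' (m _)]
    exact congrArg Subtype.val (DFunLike.congr_fun hmm ⟨a, ha⟩)
  · intro a ha
    rw [hF' ⟨a, ha⟩, hS' ⟨a, ha⟩]
    exact congrArg Subtype.val (DFunLike.congr_fun hTs ⟨a, ha⟩)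
  · intro a ha
    rw [hF' ⟨a, ha⟩, hS' ⟨a, ha⟩, hF' (s _), hS' (m _)]
    exact congrArg Subtype.val (DFunLike.congr_fun hms ⟨a, ha⟩)

/-- The powers of a Kadison–Schwarz map of a finite-dimensional algebra have an idempotent limit
along an ultrafilter. -/
theorem IsKS.exists_idempotent_limit [hfd : FiniteDimensional ℂ A] (h : IsKS A A G) :
    ∃ (l : Ultrafilter ℕ) (F S : (H →L[ℂ] H) →ₗ[ℂ] (H →L[ℂ] H)),
      (∀ a ∈ A, Tendsto (fun k => (G ^ (k + 1)) a) l (𝓝 (F a))) ∧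
      (∀ a ∈ A, Tendsto (fun k => (G ^ k) a) l (𝓝 (S a))) ∧ (∀ a ∈ A, F (F a) = F a) ∧
      (∀ a ∈ A, G (S a) = F a) ∧ ∀ a ∈ A, F (S a) = S (F a) := by
  have hfd' : FiniteDimensional ℂ (Subalgebra.toSubmodule A.toSubalgebra) := hfd
  exact exists_idempotent_limit_of_mapsTo (Subalgebra.toSubmodule A.toSubalgebra) G
    (fun a ha => h.mem a ha)
    (fun k a ha => (h.pow (isClosed_of_finiteDimensional A) k).norm_le
      (isClosed_of_finiteDimensional A) ha)

/-- Completely positive unital maps satisfy the Kadison–Schwarz inequality. -/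
theorem isKS_of_form {A B : StarSubalgebra ℂ (H →L[ℂ] H)} {E : A →ₗ[ℂ] B}
    (hE : ∀ (m : ℕ) (a : Fin m → A) (ξ : Fin m → H),
      0 ≤ ∑ i, ∑ j, inner ℂ (ξ i) ((E (star (a i) * a j) : H →L[ℂ] H) (ξ j)))
    (h1 : E 1 = 1) (hG : ∀ a : A, G a = E a) : IsKS A B G := by
  have hform : ∀ (a : A) (ξ η : H), 0 ≤ inner ℂ ξ ξ + inner ℂ ξ ((E a : H →L[ℂ] H) η)
      + (inner ℂ η ((E (star a) : H →L[ℂ] H) ξ) + inner ℂ η ((E (star a * a) : H →L[ℂ] H) η)) := by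
    intro a ξ η
    have := hE 2 ![1, a] ![ξ, η]
    simpa [Fin.sum_univ_two, h1] using this
  have hstar : ∀ a : A, (E (star a) : H →L[ℂ] H) = star (E a : H →L[ℂ] H) := by
    intro a
    ext ξ
    refine ext_inner_left ℂ fun η => ?_
    rw [ContinuousLinearMap.star_eq_adjoint, ContinuousLinearMap.adjoint_inner_right]
    rw [← inner_conj_symm ((E a : H →L[ℂ] H) η) ξ]
    apply eq_conj_of_forall_nonneg (A := inner ℂ η ((E (star a * a) : H →L[ℂ] H) η))
      (B := inner ℂ ξ ξ)
    intro z
    have := hform a ((starRingEnd ℂ) z • ξ) η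
    simp only [inner_smul_left, inner_smul_right, map_smul, Complex.conj_conj] at this ⊢
    convert this using 1
    ring
  refine ⟨fun a ha => by rw [hG ⟨a, ha⟩]; exact Subtype.property _, ?_, ?_, ?_⟩
  · have := hG 1
    rw [h1] at this
    exact this
  · intro a ha
    have e1 := hG ⟨a, ha⟩
    have e2 := hG (star ⟨a, ha⟩)
    rw [hstar, ← e1] at e2
    exact e2
  · intro a ha ξ
    have e1 := hG ⟨a, ha⟩
    have e2 := hG (star ⟨a, ha⟩ * ⟨a, ha⟩)
    -- Two-by-two positivity on the pair 1, `a`, evaluated at the vectors −G(a)ξ and ξ, is the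
    -- Kadison–Schwarz inequality.
    have e3 := hform ⟨a, ha⟩ (-(G a ξ)) ξ
    rw [hstar, ← e1, ← e2] at e3
    have e4 := (Complex.le_def.1 e3).1
    simp only [inner_neg_left, inner_neg_right, map_neg, Complex.add_re, Complex.neg_re,
      ContinuousLinearMap.star_eq_adjoint, ContinuousLinearMap.adjoint_inner_right,
      Complex.zero_re] at e4
    have e5 : (inner ℂ (G a ξ) (G a ξ)).re = ‖G a ξ‖ ^ 2 := inner_self_eq_norm_sq (𝕜 := ℂ) _
    simp only [MulMemClass.coe_mul, StarMemClass.coe_star, ContinuousLinearMap.star_eq_adjoint,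
      e5] at e4 ⊢
    linarith

end KadisonSchwarz

/-! ### Localized Markov systems -/

section Splits

variable {H : Type*} [NormedAddCommGroup H] [InnerProductSpace ℂ H] [CompleteSpace H]
  {V : Type*}

/-- `G` is multiplicative over the partition of the sites into `U` and its complement, and maps the
observables of `Y` on either side to observables of `Z` on the same side. -/
structure Splits (A : V → StarSubalgebra ℂ (H →L[ℂ] H)) (U Y Z : Set V)
    (G : (H →L[ℂ] H) →ₗ[ℂ] (H →L[ℂ] H)) : Prop where
  left : ∀ a ∈ region A (U ∩ Y), G a ∈ region A (U ∩ Z)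
  right : ∀ b ∈ region A (Uᶜ ∩ Y), G b ∈ region A (Uᶜ ∩ Z)
  mul : ∀ a ∈ region A (U ∩ Y), ∀ b ∈ region A (Uᶜ ∩ Y), G (a * b) = G a * G b

variable {A : V → StarSubalgebra ℂ (H →L[ℂ] H)} {U W Y Z : Set V}
  {G G' : (H →L[ℂ] H) →ₗ[ℂ] (H →L[ℂ] H)}

theorem Splits.comp (h : Splits A U Y Z G) (h' : Splits A U Z W G') :
    Splits A U Y W (G' ∘ₗ G) where
  left a ha := h'.left _ (h.left a ha)
  right b hb := h'.right _ (h.right b hb)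
  mul a ha b hb := by
    simp only [LinearMap.comp_apply]
    rw [h.mul a ha b hb, h'.mul _ (h.left a ha) _ (h.right b hb)]

theorem Splits.mono (h : Splits A U Y Z G) {Y' Z' : Set V} (hY : Y' ⊆ Y) (hZ : Z ⊆ Z') :
    Splits A U Y' Z' G where
  left a ha := region_mono (Set.inter_subset_inter_right _ hZ)
    (h.left a (region_mono (Set.inter_subset_inter_right _ hY) ha))
  right a ha := region_mono (Set.inter_subset_inter_right _ hZ)
    (h.right a (region_mono (Set.inter_subset_inter_right _ hY) ha))
  mul a ha b hb := h.mul a (region_mono (Set.inter_subset_inter_right _ hY) ha) b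
    (region_mono (Set.inter_subset_inter_right _ hY) hb)

theorem Splits.pow (h : Splits A U Y Y G) (k : ℕ) : Splits A U Y Y (G ^ k) := by
  induction k with
  | zero => exact ⟨fun a ha => ha, fun a ha => ha, fun a _ b _ => rfl⟩
  | succ k ih =>
    rw [pow_succ']
    exact ih.comp h

theorem Splits.of_tendsto {ι : Type*} {l : Filter ι} [NeBot l]
    {Gs : ι → (H →L[ℂ] H) →ₗ[ℂ] (H →L[ℂ] H)} (h : ∀ i, Splits A U Y Z (Gs i))
    (hl : IsClosed (region A (U ∩ Z) : Set (H →L[ℂ] H)))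
    (hr : IsClosed (region A (Uᶜ ∩ Z) : Set (H →L[ℂ] H)))
    (hlim : ∀ a ∈ region A Y, Tendsto (fun i => Gs i a) l (𝓝 (G a))) : Splits A U Y Z G where
  left a ha := hl.mem_of_tendsto (hlim a (region_mono Set.inter_subset_right ha))
    (Eventually.of_forall fun i => (h i).left a ha)
  right a ha := hr.mem_of_tendsto (hlim a (region_mono Set.inter_subset_right ha))
    (Eventually.of_forall fun i => (h i).right a ha)
  mul a ha b hb := by
    have ha' := region_mono Set.inter_subset_right ha
    have hb' := region_mono Set.inter_subset_right hb
    have h1 := hlim (a * b) (mul_mem ha' hb')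
    simp_rw [(h _).mul a ha b hb] at h1
    exact tendsto_nhds_unique h1 ((hlim a ha').mul (hlim b hb'))

end Splits

/-! ### Transition maps on a rooted tree and their splitting over subtrees. -/

section System

variable {H : Type*} [NormedAddCommGroup H] [InnerProductSpace ℂ H] [CompleteSpace H]
  {V : Type*} (o : V) (par : V → V) (lev : V → ℕ)

/-- The vertices of level at most `n`. -/
def lball (n : ℕ) : Set V := {x | lev x ≤ n}

/-- A vertex and its children. -/
def fam (x : V) : Set V := {x} ∪ kids o par x

/-- The composition `φ ∘ E₀ ∘ ⋯ ∘ E_{n-1}`. -/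
def pullback (φ : (H →L[ℂ] H) →ₗ[ℂ] ℂ) (E : ℕ → (H →L[ℂ] H) →ₗ[ℂ] (H →L[ℂ] H)) :
    ℕ → (H →L[ℂ] H) →ₗ[ℂ] ℂ
  | 0 => φ
  | n + 1 => pullback φ E n ∘ₗ E n

/-- The data of a localized quantum Markov state on a rooted tree, for maps that are defined on all
operators. -/
structure IsMarkovSystem (A : V → StarSubalgebra ℂ (H →L[ℂ] H)) (φ : (H →L[ℂ] H) →ₗ[ℂ] ℂ)
    (E : ℕ → (H →L[ℂ] H) →ₗ[ℂ] (H →L[ℂ] H)) : Prop where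
  rooted : IsRooted o par lev
  comm : Pairwise fun x y => CommAlg (A x) (A y)
  fd : ∀ x, FiniteDimensional ℂ (A x)
  finite : ∀ n, (lball lev n).Finite
  ks : ∀ n, IsKS (region A (lball lev (n + 1))) (region A (lball lev n)) (E n)
  left : ∀ n, ∀ c ∈ region A {x | lev x < n}, ∀ a ∈ region A (lball lev (n + 1)),
    E n (c * a) = c * E n a
  loc : ∀ x, ∀ a ∈ region A (fam o par x), E (lev x) a ∈ A x
  mul : ∀ x, ∀ a ∈ region A (fam o par x), ∀ b ∈ region A (lball lev (lev x + 1) \ fam o par x),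
    E (lev x) (a * b) = E (lev x) a * E (lev x) b
  inv : ∀ x, ∀ a ∈ region A (fam o par x), φ (E (lev x) a) = φ a
  pos : PosOn (region A Set.univ) φ
  one : φ 1 = 1
  chain : ∀ n, ∀ a ∈ region A (lball lev n), φ a = pullback φ E (n + 1) a

variable {o par lev} {A : V → StarSubalgebra ℂ (H →L[ℂ] H)} {φ : (H →L[ℂ] H) →ₗ[ℂ] ℂ}
  {E : ℕ → (H →L[ℂ] H) →ₗ[ℂ] (H →L[ℂ] H)}

theorem lball_mono {m n : ℕ} (h : m ≤ n) : lball lev m ⊆ lball lev n :=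
  fun _ hx => le_trans (show lev _ ≤ m from hx) h

theorem lt_subset_lball {m n : ℕ} (h : m ≤ n + 1) : {x | lev x < m} ⊆ lball lev n :=
  fun x hx => show lev x ≤ n from Nat.lt_succ_iff.1 (lt_of_lt_of_le (show lev x < m from hx) h)

theorem lball_subset_lt {m n : ℕ} (h : m < n) : lball lev m ⊆ {x | lev x < n} :=
  fun x hx => lt_of_le_of_lt (show lev x ≤ m from hx) h

theorem self_mem_fam (x : V) : x ∈ fam o par x := Or.inl rfl

theorem IsRooted.fam_subset_desc (h : IsRooted o par lev) {x w : V} (hw : w ∈ desc par x) :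
    fam o par w ⊆ desc par x := by
  rintro y (rfl | hy)
  · exact hw
  · exact h.kids_subset_desc_of_mem hw hy

theorem IsRooted.fam_subset_compl_desc (h : IsRooted o par lev) {x w : V} (hw : w ∉ desc par x)
    (hl : lev x ≤ lev w) : fam o par w ⊆ (desc par x)ᶜ := by
  rintro y (rfl | hy)
  · exact hw
  · exact h.kids_subset_compl_desc hw hl hy

theorem IsRooted.fam_subset_lball (h : IsRooted o par lev) (x : V) :
    fam o par x ⊆ lball lev (lev x + 1) := by
  rintro y (rfl | hy)
  · exact Nat.le_succ _
  · exact (h.lev_of_mem_kids hy).le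

theorem IsRooted.lev_le_of_mem_fam (h : IsRooted o par lev) {x y : V} (hy : y ∈ fam o par x) :
    lev x ≤ lev y :=
  h.lev_le_of_mem_desc (h.fam_subset_desc (self_mem_desc x) hy)

theorem IsRooted.fam_disjoint (h : IsRooted o par lev) {x y : V} (hne : x ≠ y)
    (hl : lev x = lev y) : Disjoint (fam o par x) (fam o par y) :=
  (h.desc_disjoint hne hl).mono (h.fam_subset_desc (self_mem_desc x))
    (h.fam_subset_desc (self_mem_desc y))

/-- The sites at distance less than `n`, together with the families of the vertices in `T`. -/
def below (o : V) (par : V → V) (lev : V → ℕ) (n : ℕ) (T : Finset V) : Set V :=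
  {x | lev x < n} ∪ ⋃ y ∈ T, fam o par y

theorem below_subset (h : IsRooted o par lev) {n : ℕ} {T : Finset V} (hT : ∀ y ∈ T, lev y = n) :
    below o par lev n T ⊆ lball lev (n + 1) := by
  rintro x (hx | hx)
  · exact lt_subset_lball (by omega) hx
  · obtain ⟨y, hy, hx⟩ := Set.mem_iUnion₂.1 hx
    rw [← hT y hy]
    exact h.fam_subset_lball y hx

theorem below_disjoint_fam (h : IsRooted o par lev) {n : ℕ} {T : Finset V}
    (hT : ∀ y ∈ T, lev y = n) {y : V} (hy : lev y = n) (hyT : y ∉ T) :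
    Disjoint (below o par lev n T) (fam o par y) := by
  rw [Set.disjoint_left]
  rintro x (hx | hx) hxy
  · have h1 := h.lev_le_of_mem_fam hxy
    have h2 : lev x < n := hx
    omega
  · obtain ⟨w, hw, hx⟩ := Set.mem_iUnion₂.1 hx
    have hne : w ≠ y := fun e => hyT (e ▸ hw)
    exact Set.disjoint_left.1 (h.fam_disjoint hne ((hT w hw).trans hy.symm)) hx hxy

open Classical in
theorem below_insert {n : ℕ} {T : Finset V} {y : V} :
    below o par lev n (insert y T) = fam o par y ∪ below o par lev n T := by
  simp only [below, Finset.mem_insert, Set.iUnion_iUnion_eq_or_left]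
  rw [Set.union_left_comm]

theorem lball_succ_subset_below (h : IsRooted o par lev) {n : ℕ} {T : Finset V}
    (hT : ∀ y, lev y = n → y ∈ T) : lball lev (n + 1) ⊆ below o par lev n T := by
  intro x hx
  have hx' : lev x ≤ n + 1 := hx
  rcases lt_trichotomy (lev x) n with hlt | heq | hgt
  · exact Or.inl hlt
  · exact Or.inr (Set.mem_iUnion₂.2 ⟨x, hT x heq, self_mem_fam x⟩)
  · have hxo : x ≠ o := by
      rintro rfl
      rw [h.lev_root] at hgt
      omega
    have h1 := h.lev_par x hxo
    exact Or.inr (Set.mem_iUnion₂.2 ⟨par x, hT _ (by omega), Or.inr ⟨hxo, rfl⟩⟩)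

namespace IsMarkovSystem

variable (h : IsMarkovSystem o par lev A φ E)
include h

theorem commAlg {Y Z : Set V} (hd : Disjoint Y Z) : CommAlg (region A Y) (region A Z) :=
  CommAlg.region_region fun _ hx _ hy =>
    h.comm fun e => Set.disjoint_left.1 hd hx (e ▸ hy)

theorem finiteDimensional {Y : Set V} {n : ℕ} (hY : Y ⊆ lball lev n) :
    FiniteDimensional ℂ (region A Y) :=
  finiteDimensional_region h.fd h.comm ((h.finite n).subset hY)

theorem isClosed {Y : Set V} {n : ℕ} (hY : Y ⊆ lball lev n) :
    IsClosed (region A Y : Set (H →L[ℂ] H)) :=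
  have := h.finiteDimensional hY
  isClosed_of_finiteDimensional _

theorem map_left {n : ℕ} {c : H →L[ℂ] H} (hc : c ∈ region A {x | lev x < n}) : E n c = c := by
  have := h.left n c hc 1 (one_mem _)
  rwa [mul_one, (h.ks n).one, mul_one] at this

theorem map_region {n : ℕ} {U : Set V}
    (hU : ∀ y, lev y = n → fam o par y ⊆ U ∨ fam o par y ⊆ Uᶜ) (T : Finset V)
    (hT : ∀ y ∈ T, lev y = n) :
    ∀ a ∈ region A (U ∩ below o par lev n T), E n a ∈ region A (U ∩ lball lev n) := by
  classical
  induction T using Finset.induction_on with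
  | empty =>
    intro a ha
    have hs : U ∩ below o par lev n ∅ ⊆ U ∩ {x | lev x < n} := by simp [below]
    have ha' := region_mono hs ha
    rw [h.map_left (region_mono Set.inter_subset_right ha')]
    exact region_mono (Set.inter_subset_inter_right _ (lt_subset_lball (by omega))) ha'
  | insert y T hyT ih =>
    have hT' : ∀ y ∈ T, lev y = n := fun w hw => hT w (Finset.mem_insert_of_mem hw)
    have hy : lev y = n := hT y (Finset.mem_insert_self y T)
    have hd := below_disjoint_fam h.rooted hT' hy hyT
    specialize ih hT'
    intro a ha
    rcases hU y hy with hyU | hyU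
    · have hs : U ∩ below o par lev n (insert y T) ⊆ fam o par y ∪ U ∩ below o par lev n T := by
        rw [below_insert]
        rintro x ⟨hxU, hx | hx⟩
        exacts [Or.inl hx, Or.inr ⟨hxU, hx⟩]
      have ha' := region_mono hs ha
      rw [region_union] at ha'
      refine mem_of_mem_sup (h.commAlg (hd.symm.mono_right Set.inter_subset_right))
        ((Subalgebra.toSubmodule (region A (U ∩ lball lev n)).toSubalgebra).comap (E n)) ?_ ha'
      intro b hb c hc
      change E n (b * c) ∈ region A (U ∩ lball lev n)
      subst hy
      rw [h.mul y b hb c (region_mono (Set.subset_sdiff.2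
        ⟨Set.inter_subset_right.trans (below_subset h.rooted hT'),
          hd.mono_left Set.inter_subset_right⟩) hc)]
      exact mul_mem (le_region (Y := U ∩ lball lev (lev y)) ⟨hyU (self_mem_fam y), le_refl (lev y)⟩
        (h.loc y b hb))
        (ih c hc)
    · refine ih a (region_mono ?_ ha)
      rw [below_insert]
      rintro x ⟨hxU, hx | hx⟩
      exacts [absurd hxU (hyU hx), ⟨hxU, hx⟩]

/-- Multiplicativity is given for one family against the rest of the ball. Each family lies wholly
in `U` or in its complement and is peeled off on its side; on the complement side its image has to
be commuted past `E n a`. -/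
theorem map_mul_of_saturated {n : ℕ} {U : Set V}
    (hU : ∀ y, lev y = n → fam o par y ⊆ U ∨ fam o par y ⊆ Uᶜ) (T : Finset V)
    (hT : ∀ y ∈ T, lev y = n) :
    ∀ a ∈ region A (U ∩ below o par lev n T), ∀ b ∈ region A (Uᶜ ∩ below o par lev n T),
      E n (a * b) = E n a * E n b := by
  classical
  have hU' : ∀ y, lev y = n → fam o par y ⊆ Uᶜ ∨ fam o par y ⊆ Uᶜᶜ := fun y hy => by
    rw [compl_compl]; exact (hU y hy).symm
  induction T using Finset.induction_on with
  | empty =>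
    intro a ha b hb
    have hs : below o par lev n ∅ ⊆ {x | lev x < n} := by simp [below]
    have ha' := region_mono (Set.inter_subset_right.trans hs) ha
    have hb' := region_mono (Set.inter_subset_right.trans hs) hb
    rw [h.map_left (mul_mem ha' hb'), h.map_left ha', h.map_left hb']
  | insert y T hyT ih =>
    have hT' : ∀ y ∈ T, lev y = n := fun w hw => hT w (Finset.mem_insert_of_mem hw)
    have hy : lev y = n := hT y (Finset.mem_insert_self y T)
    have hd := below_disjoint_fam h.rooted hT' hy hyT
    specialize ih hT'
    have hmul : ∀ a ∈ region A (fam o par y), ∀ b ∈ region A (below o par lev n T),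
        E n (a * b) = E n a * E n b := by
      intro a ha b hb
      subst hy
      exact h.mul y a ha b (region_mono (Set.subset_sdiff.2
        ⟨below_subset h.rooted hT', hd⟩) hb)
    intro a ha b hb
    rcases hU y hy with hyU | hyU
    · have hs : U ∩ below o par lev n (insert y T) ⊆ fam o par y ∪ U ∩ below o par lev n T := by
        rw [below_insert]
        rintro x ⟨hxU, hx | hx⟩
        exacts [Or.inl hx, Or.inr ⟨hxU, hx⟩]
      have ha' := region_mono hs ha
      have hb' : b ∈ region A (Uᶜ ∩ below o par lev n T) := by
        refine region_mono ?_ hb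
        rw [below_insert]
        rintro x ⟨hxU, hx | hx⟩
        exacts [absurd (hyU hx) hxU, ⟨hxU, hx⟩]
      have hb'' := region_mono Set.inter_subset_right hb'
      rw [region_union] at ha'
      refine mem_of_mem_sup (h.commAlg (hd.symm.mono_right Set.inter_subset_right))
        (LinearMap.eqLocus (E n ∘ₗ LinearMap.mulRight ℂ b)
          (LinearMap.mulRight ℂ (E n b) ∘ₗ E n)) ?_ ha'
      intro c hc e he
      have he' := region_mono Set.inter_subset_right he
      change E n (c * e * b) = E n (c * e) * E n b
      rw [mul_assoc, hmul c hc _ (mul_mem he' hb''), ih e he b hb', hmul c hc e he', mul_assoc]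
    · have hs : Uᶜ ∩ below o par lev n (insert y T) ⊆ fam o par y ∪ Uᶜ ∩ below o par lev n T := by
        rw [below_insert]
        rintro x ⟨hxU, hx | hx⟩
        exacts [Or.inl hx, Or.inr ⟨hxU, hx⟩]
      have hb' := region_mono hs hb
      have ha' : a ∈ region A (U ∩ below o par lev n T) := by
        refine region_mono ?_ ha
        rw [below_insert]
        rintro x ⟨hxU, hx | hx⟩
        exacts [absurd hxU (hyU hx), ⟨hxU, hx⟩]
      have ha'' := region_mono Set.inter_subset_right ha'
      rw [region_union] at hb'
      refine mem_of_mem_sup (h.commAlg (hd.symm.mono_right Set.inter_subset_right))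
        (LinearMap.eqLocus (E n ∘ₗ LinearMap.mulLeft ℂ a)
          (LinearMap.mulLeft ℂ (E n a) ∘ₗ E n)) ?_ hb'
      intro c hc e he
      have he' := region_mono Set.inter_subset_right he
      change E n (a * (c * e)) = E n a * E n (c * e)
      have h1 : a * c = c * a := h.commAlg hd _ ha'' _ hc
      have h2 : E n a * E n c = E n c * E n a := by
        have h3 := h.map_region hU T hT' a ha'
        have h4 : E n c ∈ A y := by subst hy; exact h.loc y c hc
        rw [← region_singleton (A := A) y] at h4
        exact h.commAlg (Set.disjoint_singleton_right.2
          fun hyy => hyU (self_mem_fam y) hyy.1) _ h3 _ h4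
      rw [← mul_assoc, h1, mul_assoc, hmul c hc _ (mul_mem ha'' he'), ih a ha' e he,
        hmul c hc e he', ← mul_assoc, ← mul_assoc, h2]

theorem exists_level (n : ℕ) : ∃ T : Finset V, ∀ y, y ∈ T ↔ lev y = n := by
  have hfin : {y | lev y = n}.Finite :=
    (h.finite n).subset fun y hy => le_of_eq (show lev y = n from hy)
  exact ⟨hfin.toFinset, fun y => by simp⟩

/-- As `x` has level at most `n`, the subtree below `x` cuts no family of a vertex of level `n`. -/
theorem splits {x : V} {n : ℕ} (hx : lev x ≤ n) :
    Splits A (desc par x) (lball lev (n + 1)) (lball lev n) (E n) := by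
  obtain ⟨T, hT⟩ := h.exists_level n
  have hU : ∀ y, lev y = n → fam o par y ⊆ desc par x ∨ fam o par y ⊆ (desc par x)ᶜ := by
    intro y hy
    by_cases hyx : y ∈ desc par x
    · exact Or.inl (h.rooted.fam_subset_desc hyx)
    · exact Or.inr (h.rooted.fam_subset_compl_desc hyx (hx.trans hy.ge))
  have hU' : ∀ y, lev y = n → fam o par y ⊆ (desc par x)ᶜ ∨ fam o par y ⊆ (desc par x)ᶜᶜ :=
    fun y hy => by rw [compl_compl]; exact (hU y hy).symm
  have hs := lball_succ_subset_below h.rooted fun y => (hT y).2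
  have hT' : ∀ y ∈ T, lev y = n := fun y => (hT y).1
  exact ⟨fun a ha => h.map_region hU T hT' a (region_mono (Set.inter_subset_inter_right _ hs) ha),
    fun a ha => h.map_region hU' T hT' a (region_mono (Set.inter_subset_inter_right _ hs) ha),
    fun a ha b hb => h.map_mul_of_saturated hU T hT' a
      (region_mono (Set.inter_subset_inter_right _ hs) ha) b
      (region_mono (Set.inter_subset_inter_right _ hs) hb)⟩

end IsMarkovSystem

end System

/-! ### Invariance of the state under the transition maps. -/

section Invariance

variable {H : Type*} [NormedAddCommGroup H] [InnerProductSpace ℂ H] [CompleteSpace H]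
  {V : Type*} {o : V} {par : V → V} {lev : V → ℕ} {A : V → StarSubalgebra ℂ (H →L[ℂ] H)}
  {φ : (H →L[ℂ] H) →ₗ[ℂ] ℂ} {E : ℕ → (H →L[ℂ] H) →ₗ[ℂ] (H →L[ℂ] H)}

theorem IsRooted.desc_inter_lball (h : IsRooted o par lev) (x : V) :
    desc par x ∩ lball lev (lev x) = {x} := by
  ext y
  constructor
  · rintro ⟨hy, hl⟩
    by_contra hne
    exact absurd (h.lev_lt_of_mem_desc hy hne) (not_lt.2 hl)
  · rintro rfl
    exact ⟨self_mem_desc _, le_refl (lev _)⟩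

theorem IsRooted.desc_inter_lball_succ (h : IsRooted o par lev) (x : V) :
    desc par x ∩ lball lev (lev x + 1) = fam o par x := by
  apply Set.Subset.antisymm
  · rintro y ⟨hy, hl⟩
    rw [h.mem_desc_iff_kids] at hy
    rcases hy with rfl | ⟨z, hz, hy⟩
    · exact self_mem_fam _
    · have h1 := h.lev_of_mem_kids hz
      by_cases hyz : y = z
      · subst hyz; exact Or.inr hz
      · have h2 := h.lev_lt_of_mem_desc hy hyz
        have h3 : lev y ≤ lev x + 1 := hl
        omega
  · exact Set.subset_inter (h.fam_subset_desc (self_mem_desc x)) (h.fam_subset_lball x)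

namespace IsMarkovSystem

variable (h : IsMarkovSystem o par lev A φ E)
include h

theorem posOn (Y : Set V) : PosOn (region A Y) φ := h.pos.mono (region_mono (Set.subset_univ Y))

/-- The restriction of `E n` to the observables of the ball of radius `n`. -/
theorem ks_self (n : ℕ) : IsKS (region A (lball lev n)) (region A (lball lev n)) (E n) :=
  (h.ks n).mono (region_mono (lball_mono n.le_succ)) le_rfl

theorem pullback_eq {n : ℕ} (hinv : ∀ k < n, ∀ a ∈ region A (lball lev (k + 1)), φ (E k a) = φ a) :
    ∀ a ∈ region A (lball lev n), pullback φ E n a = φ a := by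
  induction n with
  | zero => intro a _; rfl
  | succ n ih =>
    intro a ha
    change pullback φ E n (E n a) = φ a
    rw [ih (fun k hk => hinv k (hk.trans n.lt_succ_self)) _ ((h.ks n).mem a ha)]
    exact hinv n n.lt_succ_self a ha

/-- An idempotent limit of powers of `E n` on the ball of radius `n`. -/
theorem exists_limit (n : ℕ) (hT : ∀ a ∈ region A (lball lev n), φ (E n a) = φ a) :
    ∃ F S : (H →L[ℂ] H) →ₗ[ℂ] (H →L[ℂ] H),
      IsKS (region A (lball lev n)) (region A (lball lev n)) F ∧
      IsKS (region A (lball lev n)) (region A (lball lev n)) S ∧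
      (∀ x, lev x ≤ n → Splits A (desc par x) (lball lev n) (lball lev n) F) ∧
      (∀ x, lev x ≤ n → Splits A (desc par x) (lball lev n) (lball lev n) S) ∧
      (∀ a ∈ region A (lball lev n), φ (F a) = φ a) ∧
      (∀ a ∈ region A (lball lev n), φ (S a) = φ a) ∧
      (∀ a ∈ region A (lball lev n), F (F a) = F a) ∧
      (∀ a ∈ region A (lball lev n), E n (S a) = F a) ∧
      (∀ a ∈ region A (lball lev n), S (E n a) = F a) ∧
      (∀ a ∈ region A (lball lev n), F (S a) = S (F a)) ∧
      (∀ a ∈ region A (lball lev n), ∃ l : Ultrafilter ℕ,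
        Tendsto (fun k => (E n ^ (k + 1)) a) l (𝓝 (F a))) := by
  have hfd := h.finiteDimensional (subset_refl (lball lev n))
  have hfd' : FiniteDimensional ℂ
    (Subalgebra.toSubmodule (region A (lball lev n)).toSubalgebra) := hfd
  have hcl := h.isClosed (subset_refl (lball lev n))
  obtain ⟨l, F, S, hF, hS, hFF, hES, hFS⟩ := (h.ks_self n).exists_idempotent_limit
  have hpow := (h.ks_self n).pow hcl
  have hφ : ∀ k, ∀ a ∈ region A (lball lev n), φ ((E n ^ k) a) = φ a := by
    intro k
    induction k with
    | zero => intro a _; rfl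
    | succ k ih =>
      intro a ha
      rw [pow_succ]
      exact (ih _ ((h.ks_self n).mem a ha)).trans (hT a ha)
  have hsplit : ∀ x, lev x ≤ n → Splits A (desc par x) (lball lev n) (lball lev n) (E n) :=
    fun x hx => (h.splits hx).mono (lball_mono n.le_succ) subset_rfl
  have hlim : ∀ (e : ℕ → ℕ) (G : (H →L[ℂ] H) →ₗ[ℂ] (H →L[ℂ] H)),
      (∀ a ∈ region A (lball lev n), Tendsto (fun k => (E n ^ e k) a) l (𝓝 (G a))) →
      IsKS (region A (lball lev n)) (region A (lball lev n)) G ∧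
      (∀ x, lev x ≤ n → Splits A (desc par x) (lball lev n) (lball lev n) G) ∧
      (∀ a ∈ region A (lball lev n), φ (G a) = φ a) := by
    intro e G hG
    have hks := IsKS.of_tendsto (fun k => hpow (e k)) hcl hG
    refine ⟨hks, fun x hx => ?_, fun a ha => ?_⟩
    · exact Splits.of_tendsto (fun k => (hsplit x hx).pow (e k)) (h.isClosed Set.inter_subset_right)
        (h.isClosed Set.inter_subset_right) hG
    · have h1 := tendsto_apply_of_finiteDimensional
        (Subalgebra.toSubmodule (region A (lball lev n)).toSubalgebra) φ
        (fun k => (hpow (e k)).mem a ha) (hks.mem a ha) (hG a ha)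
      exact tendsto_nhds_unique h1 (tendsto_const_nhds.congr fun k => (hφ (e k) a ha).symm)
  obtain ⟨f1, f2, f3⟩ := hlim (fun k => k + 1) F hF
  obtain ⟨s1, s2, s3⟩ := hlim (fun k => k) S hS
  refine ⟨F, S, f1, s1, f2, s2, f3, s3, hFF, hES, fun a ha => ?_, hFS, fun a ha => ⟨l, hF a ha⟩⟩
  exact tendsto_nhds_unique (hS _ ((h.ks_self n).mem a ha))
    ((hF a ha).congr fun k => by rw [pow_succ]; rfl)

/-- The correlations of a single family with its surroundings. -/
theorem map_mul_defect_eq_zero {n : ℕ}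
    (hinv : ∀ k < n, ∀ a ∈ region A (lball lev (k + 1)), φ (E k a) = φ a) {y : V} (hy : lev y = n)
    {v b : H →L[ℂ] H} (hv : v ∈ region A (fam o par y))
    (hb : b ∈ region A ((desc par y)ᶜ ∩ lball lev n)) :
    φ (b * E n (v - E (n + 1) v)) = 0 := by
  have hfam : fam o par y ⊆ lball lev (n + 1) := hy ▸ h.rooted.fam_subset_lball y
  -- The chain identity at radius `n` and the induction hypothesis give invariance on the smaller
  -- ball; invariance on radius `n + 1` is what is being proved.
  have hball : ∀ a ∈ region A (lball lev n), φ (E n a) = φ a := by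
    intro a ha
    have h1 := h.chain n a ha
    change φ a = pullback φ E n (E n a) at h1
    rw [h1, h.pullback_eq hinv _ ((h.ks_self n).mem a ha)]
  have hfam_eq : desc par y ∩ lball lev (n + 1) = fam o par y := by
    subst hy; exact h.rooted.desc_inter_lball_succ y
  have hy_eq : desc par y ∩ lball lev n = {y} := by subst hy; exact h.rooted.desc_inter_lball y
  have hmapv : ∀ u ∈ region A (fam o par y), E (n + 1) u ∈ region A (fam o par y) := by
    intro u hu
    have h1 := (h.splits (x := y) (n := n + 1) (by omega)).left u (region_mono
      (Set.subset_inter (h.rooted.fam_subset_desc (self_mem_desc y))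
        (hfam.trans (lball_mono (by omega)))) hu)
    rwa [hfam_eq] at h1
  have hmapE : ∀ u ∈ region A (fam o par y), E n u ∈ region A ({y} : Set V) := by
    intro u hu
    rw [region_singleton]
    subst hy
    exact h.loc y u hu
  -- The chain identity at radius `n + 1` reduces to φ ∘ Eₙ ∘ Eₙ₊₁. The map Eₙ₊₁ keeps the family of
  -- `y`, so the Markov hypothesis at `y` removes Eₙ.
  have hφ : ∀ u ∈ region A (fam o par y), φ (E (n + 1) u) = φ u := by
    intro u hu
    have h1 := h.chain (n + 1) u (region_mono hfam hu)
    change φ u = pullback φ E n (E n (E (n + 1) u)) at h1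
    rw [h.pullback_eq hinv _ ((h.ks n).mem _ (region_mono hfam (hmapv u hu)))] at h1
    rw [h1]
    subst hy
    exact (h.inv y _ (hmapv u hu)).symm
  obtain ⟨F, S, hFks, hSks, hFsp, hSsp, hFφ, hSφ, hFF, hES, hSE, hFS, hFlim⟩ := h.exists_limit n hball
  have hyn : lev y ≤ n := hy.le
  have hyb : ({y} : Set V) ⊆ lball lev n := Set.singleton_subset_iff.2 hyn
  have hyfam : ({y} : Set V) ⊆ fam o par y := Set.subset_union_left
  have hlocF : ∀ u ∈ region A ({y} : Set V), F u ∈ region A ({y} : Set V) := fun u hu => by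
    have := (hFsp y hyn).left u (by rwa [hy_eq]); rwa [hy_eq] at this
  have hlocS : ∀ u ∈ region A ({y} : Set V), S u ∈ region A ({y} : Set V) := fun u hu => by
    have := (hSsp y hyn).left u (by rwa [hy_eq]); rwa [hy_eq] at this
  have hcl := h.isClosed (subset_refl (lball lev n))
  have hfd := h.finiteDimensional (subset_refl (lball lev n))
  have hfd' : FiniteDimensional ℂ
    (Subalgebra.toSubmodule (region A (lball lev n)).toSubalgebra) := hfd
  set w := v - E (n + 1) v with hw
  have hwfam : w ∈ region A (fam o par y) := sub_mem hv (hmapv v hv)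
  set g := E n w with hg
  have hgy : g ∈ region A ({y} : Set V) := hmapE w hwfam
  have hgn := region_mono hyb hgy
  set k := F g with hk
  have hky : k ∈ region A ({y} : Set V) := hlocF g hgy
  have hkn := region_mono hyb hky
  have hFk : F k = k := hFF g hgn
  -- The vector `k` is fixed by `F`, and `S` inverts `E n` there; so `s` is a preimage of `k` under
  -- `E n`.
  set s := S k with hs
  have hsy : s ∈ region A ({y} : Set V) := hlocS k hky
  have hsn := region_mono hyb hsy
  have hEs : E n s = k := (hES k hkn).trans hFk
  have hFs : F s = s := (hFS k hkn).trans (by rw [hFk])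
  -- By Kadison–Schwarz and invariance no power of `E n` increases φ(x* x). It maps `s` to `k`, and
  -- `s` is a limit of images of `k`, so both inequalities hold.
  have hnorm : φ (star s * s) = φ (star k * k) := by
    obtain ⟨l, hl⟩ := hFlim s hsn
    rw [hFs] at hl
    have hmono : ∀ j, φ (star ((E n ^ (j + 1)) s) * (E n ^ (j + 1)) s) ≤ φ (star k * k) := by
      intro j
      obtain ⟨c, hc, hcd⟩ := ((h.ks_self n).pow hcl j).exists_defect hcl hkn
      have h1 := h.posOn _ c hc
      rw [← hcd, map_sub] at h1
      have h2 : φ ((E n ^ j) (star k * k)) = φ (star k * k) := by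
        clear hcd h1 hc c
        have : ∀ a ∈ region A (lball lev n), φ ((E n ^ j) a) = φ a := by
          induction j with
          | zero => intro a _; rfl
          | succ j ih =>
            intro a ha
            rw [pow_succ]
            exact (ih _ ((h.ks_self n).mem a ha)).trans (hball a ha)
        exact this _ (mul_mem (star_mem hkn) hkn)
      rw [h2] at h1
      have h3 : (E n ^ (j + 1)) s = (E n ^ j) k := by rw [pow_succ, ← hEs]; rfl
      rw [h3]
      exact sub_nonneg.1 h1
    have hle1 : φ (star s * s) ≤ φ (star k * k) := by
      have h1 : Tendsto (fun j => star ((E n ^ (j + 1)) s) * (E n ^ (j + 1)) s) l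
          (𝓝 (star s * s)) := hl.star.mul hl
      have hm : ∀ j, (E n ^ (j + 1)) s ∈ region A (lball lev n) := fun j =>
        ((h.ks_self n).pow hcl (j + 1)).mem s hsn
      have h2 := tendsto_apply_of_finiteDimensional
        (Subalgebra.toSubmodule (region A (lball lev n)).toSubalgebra) φ
        (fun j => (mul_mem (star_mem (hm j)) (hm j) : _ ∈ region A (lball lev n)))
        (mul_mem (star_mem hsn) hsn : _ ∈ region A (lball lev n)) h1
      exact le_of_tendsto' h2 hmono
    refine le_antisymm hle1 ?_
    obtain ⟨c, hc, hcd⟩ := (h.ks_self n).exists_defect hcl hsn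
    have h1 := h.posOn _ c hc
    rw [← hcd, map_sub, hball _ (mul_mem (star_mem hsn) hsn), hEs] at h1
    exact sub_nonneg.1 h1
  -- By `hnorm`, Kadison–Schwarz is an equality for `s`, which turns φ(k* g) into φ(s* w). Since `s`
  -- lies in the ball of radius `n`, left linearity gives s* w = u − Eₙ₊₁ u with u = s* v, and φ
  -- kills this difference.
  have hkg : φ (star k * g) = 0 := by
    have h1 := (h.ks n).map_star_mul hcl (h.posOn _) (k := s) (c := w)
      (region_mono (lball_mono n.le_succ) hsn) (region_mono hfam hwfam)
      (by rw [hEs, hball _ (mul_mem (star_mem hsn) hsn), hnorm])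
    rw [hEs] at h1
    have hsf := region_mono hyfam hsy
    have h2 : φ (E n (star s * w)) = φ (star s * w) := by
      subst hy
      exact h.inv y _ (mul_mem (star_mem hsf) hwfam)
    have h3 : star s * E (n + 1) v = E (n + 1) (star s * v) :=
      (h.left (n + 1) _ (star_mem (region_mono (lball_subset_lt n.lt_succ_self) hsn)) v
        (region_mono (hfam.trans (lball_mono (by omega))) hv)).symm
    rw [h1, h2, hw, mul_sub, h3, map_sub, hφ _ (mul_mem (star_mem hsf) hv), sub_self]
  -- Kadison–Schwarz for `F` is an equality at its fixed point `k`, so φ(k* k) = φ(F(k)* F(g)) =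
  -- φ(k* g).
  have hkk : φ (star k * k) = 0 := by
    have h1 := hFks.map_star_mul hcl (h.posOn _) (k := k) (c := g) hkn hgn
      (by rw [hFφ _ (mul_mem (star_mem hkn) hkn), hFk])
    rw [hFk, hFφ _ (mul_mem (star_mem hkn) hgn), hkg] at h1
    exact h1
  have hbn := region_mono Set.inter_subset_right hb
  have hcomm : b * g = g * b :=
    h.commAlg (Y := (desc par y)ᶜ ∩ lball lev n) (Z := {y}) (Set.disjoint_singleton_right.2
      fun hh => hh.1 (self_mem_desc y)) b hb g hgy
  -- `F` factors over `b` and `g`, and `k = F g` is a null vector of φ.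
  rw [← hFφ _ (mul_mem hbn hgn), hcomm, (hFsp y hyn).mul g (by rwa [hy_eq]) b hb]
  have hc2 : k * F b = F b * k :=
    (h.commAlg (Y := (desc par y)ᶜ ∩ lball lev n) (Z := {y}) (Set.disjoint_singleton_right.2
      fun hh => hh.1 (self_mem_desc y)) _ ((hFsp y hyn).right b hb) k hky).symm
  rw [← hk, hc2]
  exact (h.posOn (lball lev n)).map_mul_eq_zero (hFks.mem b hbn) hkn hkk

/-- Strong induction reduces the chain identity to φ = φ ∘ Eₙ ∘ Eₙ₊₁ on the ball of radius n + 1, so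
it is enough that φ ∘ Eₙ does not see Eₙ₊₁. On products over the families of level n this is checked
by telescoping, one family at a time. -/
theorem invariant (n : ℕ) : ∀ a ∈ region A (lball lev (n + 1)), φ (E n a) = φ a := by
  classical
  induction n using Nat.strong_induction_on with
  | _ n hinv =>
  have hP := h.pullback_eq hinv
  obtain ⟨T, hT⟩ := h.exists_level n
  have key : ∀ T : Finset V, (∀ y ∈ T, lev y = n) →
      ∀ a ∈ region A (⋃ y ∈ T, fam o par y), ∀ b ∈ region A (lball lev n \ T),
        φ (b * E n (a - E (n + 1) a)) = 0 := by
    intro T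
    induction T using Finset.induction_on with
    | empty =>
      intro _ a ha b _
      have hs : (⋃ y ∈ (∅ : Finset V), fam o par y) ⊆ {x | lev x < n + 1} := by simp
      rw [h.map_left (region_mono hs ha), sub_self, map_zero, mul_zero, map_zero]
    | insert y T hyT ih =>
      intro hTn a ha
      have hT' : ∀ y ∈ T, lev y = n := fun w hw => hTn w (Finset.mem_insert_of_mem hw)
      have hy : lev y = n := hTn y (Finset.mem_insert_self y T)
      have hd := below_disjoint_fam h.rooted hT' hy hyT
      have hTs : (⋃ y ∈ T, fam o par y) ⊆ below o par lev n T := Set.subset_union_right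
      have hTs' : (⋃ y ∈ T, fam o par y) ⊆ (desc par y)ᶜ ∩ lball lev (n + 1) :=
        Set.subset_inter (Set.iUnion₂_subset fun w hw => h.rooted.fam_subset_compl_desc
          (fun hwy => hyT (by
            have := h.rooted.eq_of_mem_desc (self_mem_desc w) hwy ((hT' w hw).trans hy.symm)
            exact this ▸ hw)) (by rw [hT' w hw, hy])) (hTs.trans (below_subset h.rooted hT'))
      have hfs : fam o par y ⊆ desc par y ∩ lball lev (n + 1) :=
        Set.subset_inter (h.rooted.fam_subset_desc (self_mem_desc y))
          (hy ▸ h.rooted.fam_subset_lball y)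
      have hs1 := h.splits (x := y) (n := n) hy.le
      have hs2 := (h.splits (x := y) (n := n + 1) (by omega)).mono
        (lball_mono (n + 1).le_succ) subset_rfl
      rw [Finset.set_biUnion_insert, region_union] at ha
      intro b hb
      refine mem_of_mem_sup (h.commAlg (hd.symm.mono_right hTs))
        (LinearMap.ker (φ ∘ₗ LinearMap.mulLeft ℂ b ∘ₗ E n ∘ₗ (LinearMap.id - E (n + 1)))) ?_ ha
      intro v hv c hc
      change φ (b * E n (v * c - E (n + 1) (v * c))) = 0
      have hv' := region_mono hfs hv
      have hc' := region_mono hTs' hc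
      rw [hs2.mul v hv' c hc', map_sub, hs1.mul v hv' c hc', hs1.mul _ (hs2.left v hv') _
        (hs2.right c hc')]
      -- Telescoping: the first term has its defect in the family of `y`, the second one in the
      -- families already treated.
      have e1 : E n v * E n c - E n (E (n + 1) v) * E n (E (n + 1) c)
          = E n (v - E (n + 1) v) * E n c + E n (E (n + 1) v) * E n (c - E (n + 1) c) := by
        rw [map_sub, map_sub]; noncomm_ring
      rw [e1, mul_add, map_add]
      have hyball : desc par y ∩ lball lev n = {y} := by
        subst hy; exact h.rooted.desc_inter_lball y
      have hz1 : φ (b * (E n (v - E (n + 1) v) * E n c)) = 0 := by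
        have h1 : E n (v - E (n + 1) v) ∈ region A (desc par y ∩ lball lev n) :=
          hs1.left _ (sub_mem hv' (hs2.left v hv'))
        have h2 := hs1.right c hc'
        have h3 : E n (v - E (n + 1) v) * E n c = E n c * E n (v - E (n + 1) v) :=
          h.commAlg (Set.disjoint_left.2 fun x hx hx' => hx'.1 hx.1) _ h1 _ h2
        rw [h3, ← mul_assoc]
        refine h.map_mul_defect_eq_zero hinv hy hv (mul_mem (region_mono ?_ hb) h2)
        rintro x ⟨hx, hxT⟩
        refine ⟨fun hxy => hxT ?_, hx⟩
        have : x ∈ desc par y ∩ lball lev n := ⟨hxy, hx⟩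
        rw [hyball] at this
        rw [show x = y from this]
        exact Finset.mem_insert_self y T
      have hz2 : φ (b * (E n (E (n + 1) v) * E n (c - E (n + 1) c))) = 0 := by
        rw [← mul_assoc]
        refine ih hT' c hc _ (mul_mem (region_mono ?_ hb) (region_mono ?_
          (hs1.left _ (hs2.left v hv'))))
        · exact Set.sdiff_subset_sdiff_right (Finset.coe_subset.2 (Finset.subset_insert y T))
        · rw [hyball]
          exact Set.singleton_subset_iff.2 ⟨hy.le, fun hh => hyT hh⟩
      rw [hz1, hz2, add_zero]
  have hTn : ∀ y ∈ T, lev y = n := fun y => (hT y).1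
  have hzero : ∀ a ∈ region A (lball lev (n + 1)), φ (E n (a - E (n + 1) a)) = 0 := by
    intro a ha
    have ha' := region_mono (lball_succ_subset_below h.rooted fun y => (hT y).2) ha
    unfold below at ha'
    rw [region_union] at ha'
    have hdj : Disjoint {x | lev x < n} (⋃ y ∈ T, fam o par y) := by
      rw [Set.disjoint_left]
      intro x hx hx'
      obtain ⟨y, hy, hxy⟩ := Set.mem_iUnion₂.1 hx'
      have h1 := h.rooted.lev_le_of_mem_fam hxy
      have h2 := hTn y hy
      have h3 : lev x < n := hx
      omega
    refine mem_of_mem_sup (h.commAlg hdj)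
      (LinearMap.ker (φ ∘ₗ E n ∘ₗ (LinearMap.id - E (n + 1)))) ?_ ha'
    intro c hc b hb
    change φ (E n (c * b - E (n + 1) (c * b))) = 0
    have hb' : b ∈ region A (lball lev (n + 1)) := region_mono
      (Set.subset_union_right.trans (below_subset h.rooted hTn)) hb
    rw [h.left (n + 1) c (region_mono (fun x hx => show lev x < n + 1 from
      lt_trans (show lev x < n from hx) n.lt_succ_self) hc) b
      (region_mono (lball_mono (n + 1).le_succ) hb'), ← mul_sub, h.left n c hc _
      (sub_mem hb' ((h.ks (n + 1)).mem b (region_mono (lball_mono (n + 1).le_succ) hb')))]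
    refine key T hTn b hb c (region_mono ?_ hc)
    intro x hx
    have h3 : lev x < n := hx
    exact ⟨h3.le, fun hxT => by have := hTn x hxT; omega⟩
  intro a ha
  have h1 := h.chain (n + 1) a ha
  change φ a = pullback φ E n (E n (E (n + 1) a)) at h1
  have h2 := hzero a ha
  have h3 := (h.ks (n + 1)).mem a (region_mono (lball_mono (n + 1).le_succ) ha)
  rw [hP _ ((h.ks n).mem _ h3)] at h1
  rw [map_sub, map_sub, sub_eq_zero] at h2
  rw [h2, h1]

end IsMarkovSystem

end Invariance

/-! ### Projecting large balls onto the ball that ends at a vertex. -/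

section Theta

variable {H : Type*} [NormedAddCommGroup H] [InnerProductSpace ℂ H] [CompleteSpace H]
  {V : Type*} {o : V} {par : V → V} {lev : V → ℕ} {A : V → StarSubalgebra ℂ (H →L[ℂ] H)}
  {φ : (H →L[ℂ] H) →ₗ[ℂ] ℂ} {E : ℕ → (H →L[ℂ] H) →ₗ[ℂ] (H →L[ℂ] H)}

namespace IsMarkovSystem

variable (h : IsMarkovSystem o par lev A φ E)
include h

/-- With l the level of `x`, the map is E(l+1) ∘ ⋯ ∘ E(l+j). It stops at radius l + 1, so that the
ball of radius l stays fixed. -/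
theorem exists_iterate (x : V) (j : ℕ) : ∃ Ψ : (H →L[ℂ] H) →ₗ[ℂ] (H →L[ℂ] H),
    IsKS (region A (lball lev (lev x + 1 + j))) (region A (lball lev (lev x + 1))) Ψ ∧
    Splits A (desc par x) (lball lev (lev x + 1 + j)) (lball lev (lev x + 1)) Ψ ∧
    (∀ a ∈ region A (lball lev (lev x + 1 + j)), φ (Ψ a) = φ a) ∧
    ∀ a ∈ region A (lball lev (lev x)), Ψ a = a := by
  induction j with
  | zero =>
    refine ⟨LinearMap.id, ⟨fun a ha => ha, rfl, fun a _ => rfl, fun a _ ξ => ?_⟩,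
      ⟨fun a ha => ha, fun a ha => ha, fun a _ b _ => rfl⟩, fun a _ => rfl, fun a _ => rfl⟩
    rw [LinearMap.id_apply, LinearMap.id_apply, inner_star_mul_self, Complex.ofReal_re]
  | succ j ih =>
    obtain ⟨Ψ, h1, h2, h3, h4⟩ := ih
    refine ⟨Ψ ∘ₗ E (lev x + 1 + j), (h.ks _).comp h1 (h.isClosed subset_rfl),
      (h.splits (by simp only [Nat.add_eq]; omega)).comp h2, fun a ha => ?_, fun a ha => ?_⟩
    · exact (h3 _ ((h.ks _).mem a ha)).trans (h.invariant _ a ha)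
    · rw [LinearMap.comp_apply, h.map_left (region_mono (lball_subset_lt (by omega)) ha), h4 a ha]

/-- Idempotent maps of the observables of a large ball onto observables of the ball that ends at
`x`. -/
theorem exists_theta (x : V) : ∃ F : (H →L[ℂ] H) →ₗ[ℂ] (H →L[ℂ] H), ∀ j,
    ∃ Θ : (H →L[ℂ] H) →ₗ[ℂ] (H →L[ℂ] H),
      IsKS (region A (lball lev (lev x + 1 + j))) (region A (lball lev (lev x))) Θ ∧
      Splits A (desc par x) (lball lev (lev x + 1 + j)) (lball lev (lev x)) Θ ∧
      (∀ a ∈ region A (lball lev (lev x + 1 + j)), φ (Θ a) = φ a) ∧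
      (∀ a ∈ region A (lball lev (lev x)), Θ a = F a) ∧
      ∀ a ∈ region A (lball lev (lev x + 1 + j)), F (Θ a) = Θ a := by
  have hball : ∀ a ∈ region A (lball lev (lev x)), φ (E (lev x) a) = φ a := fun a ha =>
    h.invariant _ a (region_mono (lball_mono (Nat.le_succ _)) ha)
  have hcl := h.isClosed (subset_refl (lball lev (lev x)))
  obtain ⟨F, S, hFks, hSks, hFsp, hSsp, hFφ, hSφ, hFF, -, hSE, -, -⟩ := h.exists_limit _ hball
  refine ⟨F, fun j => ?_⟩
  obtain ⟨Ψ, h1, h2, h3, h4⟩ := h.exists_iterate x j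
  have hEΨ := h1.comp (h.ks _) (h.isClosed subset_rfl)
  have hSEΨ := hEΨ.comp hSks hcl
  -- The factor `S` cancels `E (lev x)` on the small ball up to `F`. So there the composition is `F`
  -- itself, the same for all `j`.
  refine ⟨F ∘ₗ S ∘ₗ E (lev x) ∘ₗ Ψ, hSEΨ.comp hFks hcl,
    (((h2.comp (h.splits le_rfl)).comp (hSsp x le_rfl)).comp (hFsp x le_rfl)),
    fun a ha => ?_, fun a ha => ?_, fun a ha => ?_⟩
  · exact (hFφ _ (hSEΨ.mem a ha)).trans ((hSφ _ (hEΨ.mem a ha)).trans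
      ((h.invariant _ _ (h1.mem a ha)).trans (h3 a ha)))
  · simp only [LinearMap.comp_apply]
    rw [h4 a ha, hSE a ha, hFF a ha]
  · exact hFF _ (hSEΨ.mem a ha)

end IsMarkovSystem

end Theta

/-! ### The algebra that separates a vertex from its ancestors -/

section Support

variable {M : Type*} [Ring M] [StarRing M] [Algebra ℂ M] [StarModule ℂ M]

/-- `p` is the support projection of the functional `φ` on `C`. -/
structure IsSupport (C : StarSubalgebra ℂ M) (φ : M →ₗ[ℂ] ℂ) (p : M) : Prop where
  pos : PosOn C φ
  mem : p ∈ C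
  star_eq : star p = p
  idem : p * p = p
  map_compl : φ (1 - p) = 0
  faithful : ∀ a ∈ C, φ (star a * a) = 0 → a * p = 0

variable {C : StarSubalgebra ℂ M} {φ : M →ₗ[ℂ] ℂ} {p : M}

theorem IsSupport.map_star_mul_compl (h : IsSupport C φ p) :
    φ (star (1 - p) * (1 - p)) = 0 := by
  have : star (1 - p) * (1 - p) = 1 - p := by
    rw [star_sub, star_one, h.star_eq]
    simp [mul_sub, sub_mul, h.idem]
  rw [this, h.map_compl]

/-- The projection 1 − p is a null vector of φ, so it can be dropped on the far right and, after
moving p past `a`, on the far left. -/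
theorem map_mul_compress {B : StarSubalgebra ℂ M} (h : IsSupport C φ p) (hB : PosOn B φ)
    (hCB : C ≤ B) {a X : M} (ha : a ∈ B) (hX : X ∈ B) (hap : Commute a p) :
    φ (a * (p * X * p)) = φ (a * X) := by
  have hp := hCB h.mem
  have h1 : φ (a * X * (1 - p)) = 0 :=
    hB.map_mul_eq_zero (mul_mem ha hX) (sub_mem (one_mem _) hp) h.map_star_mul_compl
  have h2 : φ ((1 - p) * (a * X * p)) = 0 := by
    have := hB.map_star_mul_eq_zero' (b := 1 - p) (mul_mem (mul_mem ha hX) hp)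
      (sub_mem (one_mem _) hp) h.map_star_mul_compl
    rwa [star_sub, star_one, h.star_eq] at this
  have h3 : a * X = a * (p * X * p) + (a * X * (1 - p) + (1 - p) * (a * X * p)) := by
    have h4 : a * (p * X * p) = p * (a * X * p) := by
      rw [← mul_assoc, ← mul_assoc, hap.eq]; simp only [mul_assoc]
    rw [h4]; noncomm_ring
  conv_rhs => rw [h3, map_add, map_add, h1, h2, add_zero, add_zero]

theorem IsSupport.map_compress (h : IsSupport C φ p) {X : M} (hX : X ∈ C) :
    φ (p * X * p) = φ X := by
  have := map_mul_compress h h.pos le_rfl (one_mem C) hX (Commute.one_left p)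
  rwa [one_mul, one_mul] at this

/-- Polarization gives φ(v* X u) = 0 for all u, v in pC. With u = p and v = p X p, faithfulness on
the support gives the claim. -/
theorem IsSupport.compress_eq_zero (h : IsSupport C φ p) {X : M} (hX : X ∈ C)
    (h0 : ∀ u ∈ C, p * u = u → φ (star u * X * u) = 0) : p * X * p = 0 := by
  have key : ∀ u ∈ C, ∀ v ∈ C, p * u = u → p * v = v → φ (star v * X * u) = 0 := by
    intro u hu v hv hpu hpv
    refine (eq_zero_of_forall_nonneg (A := 0) (w := φ (star v * X * u))
      (w' := φ (star u * X * v)) fun z => ?_).1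
    have h1 := h0 (v + z • u) (add_mem hv (C.smul_mem hu z)) (by rw [mul_add, mul_smul_comm, hpu, hpv])
    have h2 : star (v + z • u) * X * (v + z • u) = star v * X * v
        + z • (star v * X * u) + (starRingEnd ℂ) z • (star u * X * v)
        + ((starRingEnd ℂ) z * z) • (star u * X * u) := by
      rw [star_add, star_smul]
      simp only [add_mul, mul_add, smul_mul_assoc, mul_smul_comm, smul_add, mul_smul, starRingEnd_apply]
      rw [smul_comm z (star z)]
      abel
    rw [h2] at h1
    simp only [map_add, map_smul, smul_eq_mul, h0 v hv hpv, h0 u hu hpu, mul_zero, add_zero] at h1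
    rw [h1]
  have hXC : p * X * p ∈ C := mul_mem (mul_mem h.mem hX) h.mem
  have h1 := key p h.mem (p * X * p) hXC h.idem (by simp only [← mul_assoc, h.idem])
  have h2 : star (p * X * p) * X * p = star (p * X * p) * (p * X * p) := by
    simp only [star_mul, h.star_eq, mul_assoc]
    rw [← mul_assoc p p, h.idem]
  rw [h2] at h1
  have h3 := h.faithful _ hXC h1
  rwa [mul_assoc, h.idem] at h3

end Support

/-! ### Compressing an invariant Kadison–Schwarz map to the support of the state. -/

section Compress

variable {H : Type*} [NormedAddCommGroup H] [InnerProductSpace ℂ H] [CompleteSpace H]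
  {B C : StarSubalgebra ℂ (H →L[ℂ] H)} {φ : (H →L[ℂ] H) →ₗ[ℂ] ℂ} {p : H →L[ℂ] H}
  {F Θ : (H →L[ℂ] H) →ₗ[ℂ] (H →L[ℂ] H)}

/-- On its support φ is faithful, and an element fixed by the compression leaves no slack in the
Kadison–Schwarz inequality; it therefore belongs to the multiplicative domain of the compressed map.
-/
theorem IsSupport.map_mul (h : IsSupport C φ p) (hC : IsClosed (C : Set (H →L[ℂ] H))) (hCB : C ≤ B)
    (hΘ : IsKS B C Θ) (hφ : ∀ a ∈ C, φ (Θ a) = φ a) {r b : H →L[ℂ] H} (hr : r ∈ C)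
    (hrp : Commute r p) (hΘr : p * Θ r * p = r * p) (hb : b ∈ B) :
    p * Θ (r * b) * p = r * (p * Θ b * p) := by
  obtain ⟨k, hk⟩ : ∃ k, k = star r := ⟨_, rfl⟩
  have hkr : star k = r := by rw [hk, star_star]
  have hkC : k ∈ C := hk ▸ star_mem hr
  have hkp : Commute k p := by
    have := hrp.star_star
    rwa [h.star_eq, ← hk] at this
  have hΘk : p * Θ k * p = k * p := by
    have h1 := congrArg star hΘr
    rw [star_mul, star_mul, star_mul, h.star_eq, ← hΘ.star r (hCB hr), ← hk, ← mul_assoc] at h1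
    rw [h1, hkp.eq]
  obtain ⟨y, hy⟩ : ∃ y, y = Θ k := ⟨_, rfl⟩
  rw [← hy] at hΘk
  have hyC : y ∈ C := hy ▸ hΘ.mem k (hCB hkC)
  obtain ⟨d, hd, hdd⟩ := hΘ.exists_defect hC (hCB hkC)
  rw [← hy] at hdd
  have hkkC : star k * k ∈ C := mul_mem (star_mem hkC) hkC
  have hwC : (1 - p) * y * p ∈ C := mul_mem (mul_mem (sub_mem (one_mem C) h.mem) hyC) h.mem
  -- Over p, `y` consists of p y p = k p and the off-diagonal corner (1 − p) y p. Invariance makes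
  -- the φ-masses of the corner and of the defect `d` sum to zero, so both vanish on p.
  have e1 : p * (star y * y) * p
      = p * (star k * k) * p + star ((1 - p) * y * p) * ((1 - p) * y * p) := by
    have e2 : p * (star k * k) * p = star (p * y * p) * (p * y * p) := by
      rw [hΘk, star_mul, h.star_eq]; simp only [mul_assoc]
    rw [e2]
    simp only [star_mul, star_sub, star_one, h.star_eq]
    have e3 : p * (star y * (1 - p)) * ((1 - p) * y * p) = p * star y * ((1 - p) * (1 - p)) * y * p := by
      simp only [mul_assoc]
    have e4 : p * (star y * p) * (p * y * p) = p * star y * (p * p) * y * p := by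
      simp only [mul_assoc]
    have e5 : (1 - p) * (1 - p) = 1 - p := by simp [mul_sub, sub_mul, h.idem]
    rw [e3, e4, e5, h.idem]
    noncomm_ring
  have e2 := congrArg φ e1
  rw [map_add, h.map_compress (mul_mem (star_mem hyC) hyC), h.map_compress hkkC] at e2
  have e3 := congrArg φ hdd
  rw [map_sub, hφ _ hkkC, e2] at e3
  have p1 := h.pos _ hwC
  have p2 := h.pos _ hd
  have hw0 : φ (star ((1 - p) * y * p) * ((1 - p) * y * p)) = 0 := by
    refine le_antisymm ?_ p1
    rw [← e3] at p2
    have := sub_nonneg.1 p2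
    exact (add_le_iff_nonpos_right _).1 this
  have hd0 : φ (star d * d) = 0 := by
    rw [← e3, hw0]; ring
  have hyp : y * p = k * p := by
    have h1 := h.faithful _ hwC hw0
    rw [mul_assoc, h.idem, sub_mul, one_mul, sub_mul, sub_eq_zero, hΘk] at h1
    exact h1
  have hdp := h.faithful d hd hd0
  -- The defect of `k` vanishes on p, so Kadison–Schwarz is an equality not only under φ but under
  -- all X ↦ φ(u* X u) with p u = u. These functionals determine the compression.
  have hX : p * (Θ (r * b) - star y * Θ b) * p = 0 := by
    refine h.compress_eq_zero (sub_mem (hΘ.mem _ (mul_mem (hCB hr) hb))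
      (mul_mem (star_mem hyC) (hΘ.mem b hb))) fun u hu hpu => ?_
    let ψ : (H →L[ℂ] H) →ₗ[ℂ] ℂ := φ ∘ₗ LinearMap.mulRight ℂ u ∘ₗ LinearMap.mulLeft ℂ (star u)
    have hψ : ∀ X, ψ X = φ (star u * X * u) := fun X => rfl
    have hψpos : PosOn C ψ := by
      intro a ha
      have := h.pos (a * u) (mul_mem ha hu)
      rw [hψ]
      simpa [star_mul, mul_assoc] using this
    have hdu : d * u = 0 := by rw [← hpu, ← mul_assoc, hdp, zero_mul]
    have h1 := hΘ.map_star_mul hC hψpos (hCB hkC) hb (by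
      rw [← hy]
      refine (sub_eq_zero.1 ?_).symm
      rw [← map_sub, hdd, hψ, mul_assoc, mul_assoc, hdu, mul_zero, mul_zero, map_zero])
    rw [← hy, hkr] at h1
    rw [← hψ, map_sub, h1, sub_self]
  rw [mul_sub, sub_mul, sub_eq_zero] at hX
  have h6 : p * star y = p * r := by
    have := congrArg star hyp
    rwa [star_mul, star_mul, h.star_eq, hkr] at this
  rw [hX, ← mul_assoc, h6, ← hrp.eq]
  simp only [mul_assoc]

theorem IsSupport.map_mul_right (h : IsSupport C φ p) (hC : IsClosed (C : Set (H →L[ℂ] H)))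
    (hCB : C ≤ B) (hΘ : IsKS B C Θ) (hφ : ∀ a ∈ C, φ (Θ a) = φ a) {r b : H →L[ℂ] H} (hr : r ∈ C)
    (hrp : Commute r p) (hΘr : p * Θ r * p = r * p) (hb : b ∈ B) :
    p * Θ (b * r) * p = p * Θ b * p * r := by
  have hrp' : Commute (star r) p := by
    have := hrp.star_star
    rwa [h.star_eq] at this
  have h1 := h.map_mul hC hCB hΘ hφ (star_mem hr) hrp' (by
    have h1 := congrArg star hΘr
    rw [star_mul, star_mul, star_mul, h.star_eq, ← hΘ.star r (hCB hr), ← mul_assoc] at h1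
    rw [h1, hrp'.eq]) (star_mem hb)
  have h2 := congrArg star h1
  rw [← star_mul, hΘ.star _ (mul_mem hb (hCB hr)), hΘ.star _ hb] at h2
  simpa [star_mul, h.star_eq, mul_assoc] using h2

/-- Invariance and Kadison–Schwarz show that F(X(1 − p)) is a null vector of φ, so it vanishes on p;
the adjoint statement handles the other side. -/
theorem IsSupport.compress_compress (h : IsSupport C φ p) (hC : IsClosed (C : Set (H →L[ℂ] H)))
    (hF : IsKS C C F) (hφ : ∀ a ∈ C, φ (F a) = φ a) {X : H →L[ℂ] H} (hX : X ∈ C) :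
    p * F (p * X * p) * p = p * F X * p := by
  have hq : 1 - p ∈ C := sub_mem (one_mem C) h.mem
  have key : ∀ X ∈ C, F (X * (1 - p)) * p = 0 := by
    intro X hX
    have hXq := mul_mem hX hq
    refine h.faithful _ (hF.mem _ hXq) ?_
    obtain ⟨d, hd, hdd⟩ := hF.exists_defect hC hXq
    have h1 := h.pos d hd
    have h2 : φ (star (X * (1 - p)) * (X * (1 - p))) = 0 := by
      rw [← mul_assoc]
      exact h.pos.map_mul_eq_zero (mul_mem (star_mem hXq) hX) hq h.map_star_mul_compl
    rw [← hdd, map_sub, hφ _ (mul_mem (star_mem hXq) hXq), h2, zero_sub] at h1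
    exact le_antisymm (neg_nonneg.1 h1) (h.pos _ (hF.mem _ hXq))
  have key' : ∀ X ∈ C, p * F ((1 - p) * X) = 0 := by
    intro X hX
    have h1 := congrArg star (key _ (star_mem hX))
    have h2 : star ((1 - p) * X) = star X * (1 - p) := by
      rw [star_mul, star_sub, star_one, h.star_eq]
    rw [← h2, hF.star _ (mul_mem hq hX), star_mul, star_star, h.star_eq, star_zero] at h1
    exact h1
  have e : X = p * X * p + (X * (1 - p) + (1 - p) * (X * p)) := by noncomm_ring
  conv_rhs => rw [e]
  rw [map_add, map_add, mul_add, mul_add, add_mul, add_mul, key' _ (mul_mem hX h.mem), zero_mul,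
    mul_assoc p (F (X * (1 - p))), key X hX, mul_zero, add_zero, add_zero]

/-- The algebra of the elements that are fixed by the compression of `F` to the support. -/
def fixedAlg (h : IsSupport C φ p) (hC : IsClosed (C : Set (H →L[ℂ] H)))
    (hF : IsKS C C F) (hφ : ∀ a ∈ C, φ (F a) = φ a) : StarSubalgebra ℂ (H →L[ℂ] H) where
  carrier := {r | r ∈ C ∧ Commute r p ∧ p * F r * p = r * p}
  mul_mem' := by
    rintro r s ⟨hr, hrp, hFr⟩ ⟨hs, hsp, hFs⟩
    refine ⟨mul_mem hr hs, hrp.mul_left hsp, ?_⟩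
    rw [h.map_mul hC le_rfl hF hφ hr hrp hFr hs, hFs, mul_assoc]
  add_mem' := by
    rintro r s ⟨hr, hrp, hFr⟩ ⟨hs, hsp, hFs⟩
    refine ⟨add_mem hr hs, hrp.add_left hsp, ?_⟩
    rw [map_add, mul_add, add_mul, hFr, hFs, add_mul]
  algebraMap_mem' := by
    intro c
    refine ⟨C.algebraMap_mem c, Algebra.commutes c p, ?_⟩
    rw [Algebra.algebraMap_eq_smul_one, map_smul, hF.one, mul_smul_comm, mul_one, smul_mul_assoc,
      h.idem, smul_mul_assoc, one_mul]
  star_mem' := by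
    rintro r ⟨hr, hrp, hFr⟩
    have hrp' : Commute (star r) p := by
      have := hrp.star_star
      rwa [h.star_eq] at this
    refine ⟨star_mem hr, hrp', ?_⟩
    have h1 := congrArg star hFr
    rw [star_mul, star_mul, star_mul, h.star_eq, ← hF.star r hr, ← mul_assoc] at h1
    rw [h1, hrp'.eq]

end Compress

/-- A commuting pair of properties that say that `R ⊆ A x` separates the vertex `x` and its
descendants from the other vertices. -/
structure IsSeparating {M : Type*} [Ring M] [StarRing M] [Algebra ℂ M] [StarModule ℂ M]
    {V : Type*} (par : V → V) (A : V → StarSubalgebra ℂ M) (φ : M →ₗ[ℂ] ℂ) (x : V)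
    (R : StarSubalgebra ℂ M) : Prop where
  le : R ≤ A x
  central : ∀ z ∈ relComm R R, ∀ a ∈ region A (desc par x)ᶜ, ∀ b ∈ region A (desc par x),
    φ (a * z * b) = φ (a * b * z)
  reduce : ∀ b ∈ relComm R (region A (desc par x)), ∃ e ∈ relComm R R,
    ∀ a ∈ region A (desc par x)ᶜ, ∀ r ∈ R, φ (a * r * b) = φ (a * r * e)

/-! ### Existence of the separating algebra of a vertex. -/

section Separating

variable {H : Type*} [NormedAddCommGroup H] [InnerProductSpace ℂ H] [CompleteSpace H]
  {V : Type*} {o : V} {par : V → V} {lev : V → ℕ} {A : V → StarSubalgebra ℂ (H →L[ℂ] H)}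
  {φ : (H →L[ℂ] H) →ₗ[ℂ] ℂ} {E : ℕ → (H →L[ℂ] H) →ₗ[ℂ] (H →L[ℂ] H)}

theorem exists_lball_of_mem_region {Y : Set V} (n : ℕ) {a : H →L[ℂ] H} (ha : a ∈ region A Y) :
    ∃ N, ∀ j ≥ N, a ∈ region A (Y ∩ lball lev (n + j)) := by
  obtain ⟨T, hT, ha⟩ := exists_finset_of_mem_region ha
  have hs : ∀ j ≥ T.sup lev, (T : Set V) ⊆ Y ∩ lball lev (n + j) := by
    intro j hj x hx
    have h1 : lev x ≤ T.sup lev := Finset.le_sup hx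
    exact ⟨hT hx, show lev x ≤ n + j by omega⟩
  exact ⟨T.sup lev, fun j hj => region_mono (hs j hj) ha⟩

/-- `R` consists of the site observables fixed by the compression of `F` to the support p (and of
anything on the complement of p). The map b ↦ p Θ(b) p sends descendants of `x` into `R`, is an
`R`-bimodule map, and does not change correlations with the outside. Centrality and reduction both
follow from this. -/
theorem IsMarkovSystem.exists_isSeparating (h : IsMarkovSystem o par lev A φ E) (x : V) :
    ∃ R, IsSeparating par A φ x R := by
  have hfdx := h.fd x
  have hC : IsClosed (A x : Set (H →L[ℂ] H)) := isClosed_of_finiteDimensional _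
  have hAx : region A (desc par x ∩ lball lev (lev x)) = A x := by
    rw [h.rooted.desc_inter_lball, region_singleton]
  have hAxle : ∀ j, A x ≤ region A (desc par x ∩ lball lev (lev x + 1 + j)) := fun j =>
    le_region (Y := desc par x ∩ lball lev (lev x + 1 + j))
      ⟨self_mem_desc x, show lev x ≤ lev x + 1 + j by omega⟩
  have hpos : PosOn (A x) φ := h.pos.mono (le_region (Set.mem_univ x))
  obtain ⟨p, hp, hps, hpp, hp1, hpf⟩ := exists_support (A x) hpos
  have hsup : IsSupport (A x) φ p := ⟨hpos, hp, hps, hpp, hp1, hpf⟩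
  obtain ⟨F, hF⟩ := h.exists_theta x
  choose Θ hΘks hΘsp hΘφ hΘF hFΘ using hF
  have hks : ∀ j, IsKS (region A (desc par x ∩ lball lev (lev x + 1 + j))) (A x) (Θ j) := by
    intro j
    refine ⟨fun a ha => ?_, (hΘks j).one,
      fun a ha => (hΘks j).star a (region_mono Set.inter_subset_right ha),
      fun a ha => (hΘks j).ks a (region_mono Set.inter_subset_right ha)⟩
    rw [← hAx]
    exact (hΘsp j).left a ha
  have hxb : A x ≤ region A (lball lev (lev x)) := le_region (le_refl (lev x))
  have hFks : IsKS (A x) (A x) F := by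
    have h1 := (hks 0).mono (hAxle 0) le_rfl
    have h2 : ∀ a ∈ A x, Θ 0 a = F a := fun a ha => hΘF 0 a (hxb ha)
    exact ⟨fun a ha => h2 a ha ▸ h1.mem a ha, by rw [← h2 1 (one_mem _), h1.one],
      fun a ha => by rw [← h2 a ha, ← h2 _ (star_mem ha), h1.star a ha],
      fun a ha ξ => by rw [← h2 a ha, ← h2 _ (mul_mem (star_mem ha) ha)]; exact h1.ks a ha ξ⟩
  have hFφ : ∀ a ∈ A x, φ (F a) = φ a := fun a ha => by
    rw [← hΘF 0 a (hxb ha), hΘφ 0 a (region_mono (lball_mono (by omega)) (hxb ha))]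
  have hΘφ' : ∀ j, ∀ a ∈ A x, φ (Θ j a) = φ a := fun j a ha => by
    rw [hΘF j a (hxb ha), hFφ a ha]
  let R := fixedAlg hsup hC hFks hFφ
  have hRmem : ∀ r, r ∈ R ↔ r ∈ A x ∧ Commute r p ∧ p * F r * p = r * p := fun r => Iff.rfl
  have hRΘ : ∀ j, ∀ r ∈ R, p * Θ j r * p = r * p := fun j r hr => by
    rw [hΘF j r (hxb hr.1), hr.2.2]
  have hL : ∀ j, ∀ r ∈ R, ∀ b ∈ region A (desc par x ∩ lball lev (lev x + 1 + j)),
      p * Θ j (r * b) * p = r * (p * Θ j b * p) := fun j r hr b hb =>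
    hsup.map_mul hC (hAxle j) (hks j) (hΘφ' j) hr.1 hr.2.1 (hRΘ j r hr) hb
  have hRt : ∀ j, ∀ r ∈ R, ∀ b ∈ region A (desc par x ∩ lball lev (lev x + 1 + j)),
      p * Θ j (b * r) * p = p * Θ j b * p * r := fun j r hr b hb =>
    hsup.map_mul_right hC (hAxle j) (hks j) (hΘφ' j) hr.1 hr.2.1 (hRΘ j r hr) hb
  have hmemR : ∀ j, ∀ b ∈ region A (desc par x ∩ lball lev (lev x + 1 + j)),
      p * Θ j b * p ∈ R := by
    intro j b hb
    have hb' := (hks j).mem b hb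
    refine ⟨mul_mem (mul_mem hp hb') hp, ?_, ?_⟩
    · change p * Θ j b * p * p = p * (p * Θ j b * p)
      rw [mul_assoc, hpp]
      simp only [← mul_assoc, hpp]
    · rw [hsup.compress_compress hC hFks hFφ hb', hFΘ j b (region_mono Set.inter_subset_right hb),
        mul_assoc, mul_assoc, mul_assoc, hpp]
  -- Invariance and splitting turn φ(a b) into φ(Θ(b) Θ(a)). Since Θ(b) is fixed by `F`, which is Θ
  -- on the site, the same value results from Θ(b) in place of `b`.
  have hred : ∀ j, ∀ a ∈ region A ((desc par x)ᶜ ∩ lball lev (lev x + 1 + j)),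
      ∀ b ∈ region A (desc par x ∩ lball lev (lev x + 1 + j)),
      φ (a * b) = φ (a * (p * Θ j b * p)) := by
    intro j a ha b hb
    have hb' := (hks j).mem b hb
    have hap : Commute a p := h.commAlg (Y := (desc par x)ᶜ) (Z := {x})
      (Set.disjoint_singleton_right.2 fun hh => hh (self_mem_desc x)) a
      (region_mono Set.inter_subset_left ha) p (by rwa [region_singleton])
    have hu : ∀ {Y : Set V} {c : H →L[ℂ] H}, c ∈ region A Y → c ∈ region A Set.univ :=
      fun hc => region_mono (Set.subset_univ _) hc
    have hxu : A x ≤ region A Set.univ := le_region (Set.mem_univ x)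
    rw [map_mul_compress hsup h.pos hxu (hu ha) (hxu hb') hap]
    have ha2 := region_mono Set.inter_subset_right ha
    have hb2 := region_mono Set.inter_subset_right hb
    have hb3 := region_mono Set.inter_subset_right (hAxle j hb')
    rw [← hΘφ j _ (mul_mem ha2 hb2), ← hΘφ j _ (mul_mem ha2 hb3)]
    have hc : ∀ c ∈ region A (desc par x ∩ lball lev (lev x + 1 + j)), a * c = c * a :=
      fun c hc => h.commAlg (Set.disjoint_left.2 fun y hy hy' => hy.1 hy'.1) a ha c hc
    rw [hc b hb, hc _ (hAxle j hb'), (hΘsp j).mul b hb a ha, (hΘsp j).mul _ (hAxle j hb') a ha,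
      hΘF j _ (hxb hb'), hFΘ j b hb2]
  refine ⟨R, fun r hr => hr.1, ?_, ?_⟩
  · intro z hz a ha b hb
    rw [mem_relComm] at hz
    obtain ⟨N1, hN1⟩ := exists_lball_of_mem_region (lev := lev) (lev x + 1) ha
    obtain ⟨N2, hN2⟩ := exists_lball_of_mem_region (lev := lev) (lev x + 1) hb
    have ha' := hN1 (max N1 N2) (le_max_left _ _)
    have hb' := hN2 (max N1 N2) (le_max_right _ _)
    have hz' := hAxle (max N1 N2) hz.1.1
    rw [mul_assoc, mul_assoc, hred _ a ha' _ (mul_mem hz' hb'), hred _ a ha' _ (mul_mem hb' hz'),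
      hL _ z hz.1 b hb', hRt _ z hz.1 b hb', (hz.2 _ (hmemR _ b hb')).eq]
  · intro b hb
    rw [mem_relComm] at hb
    obtain ⟨hb, hbR⟩ := hb
    obtain ⟨N, hN⟩ := exists_lball_of_mem_region (lev := lev) (lev x + 1) hb
    -- An element `b` that commutes with `R` has its image in the centre. The image may depend on
    -- `j`, which has to be large enough for the outside observable; a compactness limit in the
    -- finite-dimensional centre serves all of them at once.
    let e : ℕ → (H →L[ℂ] H) := fun j => p * Θ (j + N) b * p
    have heZ : ∀ j, e j ∈ relComm R R := by
      intro j
      have hbj := hN (j + N) (by omega)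
      refine mem_relComm.2 ⟨hmemR _ b hbj, fun r hr => ?_⟩
      have h1 := hL _ r hr b hbj
      rw [← (hbR r hr).eq, hRt _ r hr b hbj] at h1
      exact h1
    have hbd : ∀ j, ‖e j‖ ≤ ‖p‖ * ‖b‖ * ‖p‖ := by
      intro j
      have hbj := hN (j + N) (by omega)
      have h1 : ‖Θ (j + N) b‖ ≤ ‖b‖ := (hΘks (j + N)).norm_le (h.isClosed subset_rfl)
        (region_mono Set.inter_subset_right hbj)
      exact (norm_mul_le _ _).trans (mul_le_mul_of_nonneg_right ((norm_mul_le _ _).trans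
        (mul_le_mul_of_nonneg_left h1 (norm_nonneg p))) (norm_nonneg p))
    have hfdZ : FiniteDimensional ℂ (relComm R R) :=
      finiteDimensional_of_le (relComm_le.trans fun r hr => hr.1)
    have hcl : IsClosed (relComm R R : Set (H →L[ℂ] H)) := isClosed_of_finiteDimensional _
    have hprop : ProperSpace (relComm R R) := FiniteDimensional.proper ℂ _
    obtain ⟨e0, -, he0⟩ := (isCompact_closedBall (0 : relComm R R) (‖p‖ * ‖b‖ * ‖p‖)).ultrafilter_le_nhds
      ((Filter.hyperfilter ℕ).map fun j => (⟨e j, heZ j⟩ : relComm R R)) (by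
        rw [le_principal_iff]
        exact Filter.mem_map.2 (univ_mem' fun j => mem_closedBall_zero_iff.2 (hbd j)))
    refine ⟨e0, e0.2, fun a ha r hr => ?_⟩
    obtain ⟨N1, hN1⟩ := exists_lball_of_mem_region (lev := lev) (lev x + 1) ha
    let ψ : relComm R R →ₗ[ℂ] ℂ := φ ∘ₗ LinearMap.mulLeft ℂ (a * r) ∘ₗ
      (Subalgebra.toSubmodule (relComm R R).toSubalgebra).subtype
    have hψ : Continuous ψ := ψ.continuous_of_finiteDimensional
    have h1 : Tendsto (fun j => ψ ⟨e j, heZ j⟩) (Filter.hyperfilter ℕ) (𝓝 (ψ e0)) :=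
      (hψ.tendsto e0).comp he0
    refine tendsto_nhds_unique (tendsto_const_nhds.congr' ?_) h1
    have h2 : ∀ᶠ j in (Filter.hyperfilter ℕ : Filter ℕ), N1 ≤ j :=
      (Nat.hyperfilter_le_atTop) (eventually_ge_atTop N1)
    filter_upwards [h2] with j hj
    have ha' := hN1 (j + N) (by omega)
    have hb' := hN (j + N) (by omega)
    change φ (a * r * b) = φ (a * r * e j)
    rw [mul_assoc, mul_assoc, hred _ a ha' _ (mul_mem (hAxle _ hr.1) hb'), hL _ r hr b hb']

/-- Nothing lies outside of the subtree of the root, so an observable can be replaced by its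
expectation. This choice is needed because `R o` has no parent to which it could be moved. -/
theorem isSeparating_bot {M : Type*} [Ring M] [StarRing M] [Algebra ℂ M] [StarModule ℂ M]
    {A : V → StarSubalgebra ℂ M} {φ : M →ₗ[ℂ] ℂ} (h : IsRooted o par lev) (h1 : φ 1 = 1) :
    IsSeparating par A φ o ⊥ := by
  have hz : ∀ z ∈ (⊥ : StarSubalgebra ℂ M), ∃ c : ℂ, z = c • 1 := by
    intro z hz
    obtain ⟨c, rfl⟩ := StarSubalgebra.mem_bot.1 hz
    exact ⟨c, Algebra.algebraMap_eq_smul_one c⟩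
  refine ⟨bot_le, ?_, ?_⟩
  · intro z hz' a _ b _
    obtain ⟨c, rfl⟩ := hz z (relComm_le hz')
    simp
  · intro b _
    refine ⟨φ b • 1, mem_relComm.2 ⟨(⊥ : StarSubalgebra ℂ M).smul_mem (one_mem _) _,
      fun r _ => (Commute.one_left r).smul_left _⟩, ?_⟩
    intro a ha r hr
    rw [h.desc_root, Set.compl_univ, region_empty] at ha
    obtain ⟨c, rfl⟩ := hz a ha
    obtain ⟨c', rfl⟩ := hz r hr
    simp [h1]
    ring

end Separating

/-! ### Pinching by the atoms of a commutative algebra -/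

section Pinch

variable {M : Type*} [CStarAlgebra M] {ι : Type*} [Fintype ι] {ι' : Type*} [Fintype ι']
  {D D' : StarSubalgebra ℂ M} {p : ι → M} {p' : ι' → M}

/-- The map `a ↦ ∑ i, p i * a * p i`. -/
def pinch (p : ι → M) : M →ₗ[ℂ] M :=
  ∑ i, LinearMap.mulLeft ℂ (p i) ∘ₗ LinearMap.mulRight ℂ (p i)

theorem pinch_apply (p : ι → M) (a : M) : pinch p a = ∑ i, p i * (a * p i) := by
  simp [pinch, LinearMap.sum_apply]

theorem IsAtoms.commute_of_forall (hp : IsAtoms D p) {a : M} (h : ∀ i, Commute a (p i)) {d : M}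
    (hd : d ∈ D) : Commute a d := by
  obtain ⟨c, rfl⟩ := hp.eq_sum hd
  exact Commute.sum_right _ _ _ fun i _ => (h i).smul_right _

theorem IsAtoms.commute (hp : IsAtoms D p) {a b : M} (ha : a ∈ D) (hb : b ∈ D) : Commute a b := by
  refine hp.commute_of_forall (fun i => (hp.commute_of_forall (fun j => ?_) ha).symm) hb
  by_cases hij : i = j
  · rw [hij]
  · exact (hp.orth i j hij).trans (hp.orth j i (Ne.symm hij)).symm

theorem IsAtoms.commute_pinch (hp : IsAtoms D p) (a : M) {d : M} (hd : d ∈ D) :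
    Commute (pinch p a) d := by
  classical
  refine hp.commute_of_forall (fun j => ?_) hd
  rw [pinch_apply]
  have h1 : (∑ i, p i * (a * p i)) * p j = p j * (a * p j) := by
    rw [Finset.sum_mul, Finset.sum_eq_single j]
    · rw [mul_assoc, mul_assoc, hp.idem]
    · intro i _ hij
      rw [mul_assoc, mul_assoc, hp.orth i j hij, mul_zero, mul_zero]
    · intro h; exact absurd (Finset.mem_univ j) h
  have h2 : p j * ∑ i, p i * (a * p i) = p j * (a * p j) := by
    rw [Finset.mul_sum, Finset.sum_eq_single j]
    · rw [← mul_assoc, hp.idem]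
    · intro i _ hij
      rw [← mul_assoc, hp.orth j i (Ne.symm hij), zero_mul]
    · intro h; exact absurd (Finset.mem_univ j) h
  exact h1.trans h2.symm

theorem IsAtoms.pinch_mul_left (hp : IsAtoms D p) {b : M} (hb : ∀ d ∈ D, Commute b d) (a : M) :
    pinch p (b * a) = b * pinch p a := by
  rw [pinch_apply, pinch_apply, Finset.mul_sum]
  refine Finset.sum_congr rfl fun i _ => ?_
  rw [mul_assoc, ← mul_assoc, ← (hb _ (hp.mem i)).eq, mul_assoc]

theorem IsAtoms.pinch_mul_right (hp : IsAtoms D p) {b : M} (hb : ∀ d ∈ D, Commute b d) (a : M) :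
    pinch p (a * b) = pinch p a * b := by
  rw [pinch_apply, pinch_apply, Finset.sum_mul]
  refine Finset.sum_congr rfl fun i _ => ?_
  rw [mul_assoc, (hb _ (hp.mem i)).eq, mul_assoc, mul_assoc]

theorem IsAtoms.pinch_one (hp : IsAtoms D p) : pinch p 1 = 1 := by
  rw [pinch_apply, ← hp.sum_eq]
  exact Finset.sum_congr rfl fun i _ => by rw [hp.sum_eq, one_mul, hp.idem]

theorem IsAtoms.pinch_eq_self (hp : IsAtoms D p) {b : M} (hb : ∀ d ∈ D, Commute b d) :
    pinch p b = b := by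
  have := hp.pinch_mul_left hb 1
  rwa [mul_one, hp.pinch_one, mul_one] at this

/-- The coarse projections commute with the fine pinching and can be collected into their sum 1. -/
theorem IsAtoms.pinch_pinch (hp : IsAtoms D p) (hp' : IsAtoms D' p') (h : D ≤ D') (a : M) :
    pinch p' (pinch p a) = pinch p' a := by
  have hc : ∀ i, ∀ d ∈ D', Commute (p i) d := fun i d hd => hp'.commute (h (hp.mem i)) hd
  rw [pinch_apply p a, map_sum]
  calc ∑ i, pinch p' (p i * (a * p i)) = ∑ i, pinch p' a * p i := by
        refine Finset.sum_congr rfl fun i _ => ?_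
        rw [hp'.pinch_mul_left (hc i), hp'.pinch_mul_right (hc i), ← mul_assoc,
          ← (hp'.commute_pinch a (h (hp.mem i))).eq, mul_assoc, hp.idem]
    _ = pinch p' a := by rw [← Finset.mul_sum, hp.sum_eq, mul_one]

theorem IsAtoms.map_pinch (hp : IsAtoms D p) {φ : M →ₗ[ℂ] ℂ}
    (hφ : ∀ d ∈ D, ∀ a, φ (d * a) = φ (a * d)) (a : M) : φ (pinch p a) = φ a := by
  rw [pinch_apply, map_sum]
  calc ∑ i, φ (p i * (a * p i)) = ∑ i, φ (a * p i) :=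
        Finset.sum_congr rfl fun i _ => by rw [hφ _ (hp.mem i), mul_assoc, hp.idem]
    _ = φ a := by rw [← map_sum, ← Finset.mul_sum, hp.sum_eq, mul_one]

theorem IsAtoms.pinch_star_mul_self (hp : IsAtoms D p) (a : M) :
    pinch p (star a * a) = ∑ i, star (a * p i) * (a * p i) := by
  rw [pinch_apply]
  exact Finset.sum_congr rfl fun i _ => by rw [star_mul, hp.star_eq, mul_assoc, mul_assoc]

/-- Pinching |a − pinch a|² gives |pinch a|² ≤ pinch(a* a), and the right side is at most ‖a‖² by
positivity and unitality. -/
theorem IsAtoms.norm_pinch_le (hp : IsAtoms D p) (a : M) : ‖pinch p a‖ ≤ ‖a‖ := by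
  let : PartialOrder M := CStarAlgebra.spectralOrder M
  have : StarOrderedRing M := CStarAlgebra.spectralOrderedRing M
  have hpos : ∀ x : M, 0 ≤ x → 0 ≤ pinch p x := by
    intro x hx
    rw [pinch_apply]
    refine Finset.sum_nonneg fun i _ => ?_
    have := star_left_conjugate_nonneg hx (p i)
    rwa [hp.star_eq, mul_assoc] at this
  have h1 : star (pinch p a) * pinch p a ≤ pinch p (star a * a) := by
    have e : star (pinch p a) * pinch p a = pinch p (star a * pinch p a) := by
      rw [hp.pinch_mul_right fun d hd => hp.commute_pinch a hd]
      congr 1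
      rw [pinch_apply, pinch_apply, star_sum]
      exact Finset.sum_congr rfl fun i _ => by
        rw [star_mul, star_mul, hp.star_eq, mul_assoc]
    have h2 : pinch p (star (a - pinch p a) * (a - pinch p a))
        = pinch p (star a * a) - star (pinch p a) * pinch p a := by
      have e' : pinch p (star (pinch p a) * a) = star (pinch p a) * pinch p a :=
        hp.pinch_mul_left (fun d hd => by
          have := (hp.commute_pinch a (star_mem hd)).star_star
          rwa [star_star] at this) a
      have e'' : pinch p (star (pinch p a) * pinch p a) = star (pinch p a) * pinch p a := by
        rw [hp.pinch_mul_right fun d hd => hp.commute_pinch a hd]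
        congr 1
        exact hp.pinch_eq_self fun d hd => by
          have := (hp.commute_pinch a (star_mem hd)).star_star
          rwa [star_star] at this
      rw [star_sub, sub_mul, mul_sub, mul_sub, map_sub, map_sub, map_sub, ← e, e', e'']
      abel
    have h3 := hpos _ (star_mul_self_nonneg (a - pinch p a))
    rw [h2] at h3
    exact sub_nonneg.1 h3
  have h2 : pinch p (star a * a) ≤ algebraMap ℝ M (‖a‖ ^ 2) := by
    have h3 := hpos _ (sub_nonneg.2 (CStarAlgebra.star_mul_le_algebraMap_norm_sq (a := a)))
    have h4 : pinch p (algebraMap ℝ M (‖a‖ ^ 2)) = algebraMap ℝ M (‖a‖ ^ 2) :=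
      hp.pinch_eq_self fun d _ => Algebra.commutes _ d
    rw [map_sub, h4] at h3
    exact sub_nonneg.1 h3
  have h3 := (CStarAlgebra.norm_le_iff_le_algebraMap (star (pinch p a) * pinch p a)
    (sq_nonneg ‖a‖) (star_mul_self_nonneg _)).2 (h1.trans h2)
  rw [CStarRing.norm_star_mul_self, ← sq] at h3
  exact (pow_le_pow_iff_left₀ (norm_nonneg _) (norm_nonneg _) two_ne_zero).1 h3

end Pinch

/-- Contractions that are eventually constant at every point of a dense set form a Cauchy net at
every point. -/
theorem exists_limit_of_dense {M : Type*} [NormedAddCommGroup M] [NormedSpace ℂ M] [CompleteSpace M]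
    {ι : Type*} [SemilatticeSup ι] [Nonempty ι] (π : ι → M →ₗ[ℂ] M) (hπ : ∀ i a, ‖π i a‖ ≤ ‖a‖)
    {S : Set M} (hS : Dense S) (hc : ∀ a ∈ S, ∃ b, ∀ᶠ i in atTop, π i a = b) :
    ∃ P : M →ₗ[ℂ] M, ∀ a, Tendsto (fun i => π i a) atTop (𝓝 (P a)) := by
  have hlim : ∀ a, ∃ b, Tendsto (fun i => π i a) atTop (𝓝 b) := by
    intro a
    refine cauchySeq_tendsto_of_complete (Metric.cauchySeq_iff'.2 fun ε hε => ?_)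
    obtain ⟨s, hs, has⟩ := Metric.mem_closure_iff.1 (hS a) (ε / 2) (half_pos hε)
    obtain ⟨b, hb⟩ := hc s hs
    obtain ⟨N, hN⟩ := eventually_atTop.1 hb
    refine ⟨N, fun i hi => ?_⟩
    have e : π i a - π N a = π i (a - s) - π N (a - s) := by
      rw [map_sub, map_sub, hN i hi, hN N le_rfl]; abel
    rw [dist_eq_norm] at has
    rw [dist_eq_norm, e]
    have h1 := norm_sub_le (π i (a - s)) (π N (a - s))
    have h2 := hπ i (a - s)
    have h3 := hπ N (a - s)
    linarith
  choose P hP using hlim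
  refine ⟨{ toFun := P, map_add' := fun a b => ?_, map_smul' := fun z a => ?_ }, hP⟩
  · refine tendsto_nhds_unique (hP (a + b)) ?_
    simpa only [map_add] using (hP a).add (hP b)
  · refine tendsto_nhds_unique (hP (z • a)) ?_
    exact ((hP a).const_smul z).congr fun i => (map_smul (π i) z a).symm

/-! ### Separating systems -/

section Separating

variable {M : Type*} [CStarAlgebra M] {V : Type*}

/-- A state with a separating algebra `R x` at every vertex `x`. -/
structure IsSepSystem (o : V) (par : V → V) (lev : V → ℕ) (L R : V → StarSubalgebra ℂ M)
    (φ : M →ₗ[ℂ] ℂ) : Prop where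
  rooted : IsRooted o par lev
  finite : ∀ x, (kids o par x).Finite
  comm : Pairwise fun x y => CommAlg (L x) (L y)
  fd : ∀ x, FiniteDimensional ℂ (L x)
  sep : ∀ x, IsSeparating par L φ x (R x)
  root : R o = ⊥
  pos : PosOn ⊤ φ
  one : φ 1 = 1
  dense : Dense (region L Set.univ : Set M)

/-- The algebra of the vertex `x` for the passage to the abelian subalgebra. -/
def cAlg (o : V) (par : V → V) (L R : V → StarSubalgebra ℂ M) (x : V) : StarSubalgebra ℂ M :=
  relComm (R x) (L x) ⊔ region R (kids o par x)

variable {o : V} {par : V → V} {lev : V → ℕ} {L R D : V → StarSubalgebra ℂ M} {φ : M →ₗ[ℂ] ℂ}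

namespace IsSepSystem

variable (h : IsSepSystem o par lev L R φ)
include h

theorem commAlg {Y Z : Set V} (hd : Disjoint Y Z) : CommAlg (region L Y) (region L Z) :=
  CommAlg.region_region fun _ hx _ hy => h.comm fun e => Set.disjoint_left.1 hd hx (e ▸ hy)

theorem commAlg_compl {Y : Set V} : CommAlg (region L Yᶜ) (region L Y) :=
  h.commAlg disjoint_compl_left

theorem cAlg_le (x : V) : cAlg o par L R x ≤ region L (fam o par x) :=
  sup_le (relComm_le.trans (le_region (self_mem_fam x)))
    (region_le fun y hy => (h.sep y).le.trans (le_region (Or.inr hy)))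

theorem commAlg_R {x y : V} (hxy : x ≠ y) : CommAlg (R x) (R y) :=
  (h.comm hxy).mono (h.sep x).le (h.sep y).le

theorem commAlg_relComm_R (x y : V) : CommAlg (relComm (R x) (L x)) (R y) := by
  by_cases hxy : x = y
  · subst hxy
    exact fun a ha b hb => (mem_relComm.1 ha).2 b hb
  · exact (h.comm hxy).mono relComm_le (h.sep y).le

theorem finiteDimensional_cAlg (x : V) : FiniteDimensional ℂ (cAlg o par L R x) := by
  have hfd : FiniteDimensional ℂ (region L (insert x (kids o par x))) :=
    finiteDimensional_region h.fd h.comm ((h.finite x).insert x)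
  refine finiteDimensional_of_le (hB := hfd) ((h.cAlg_le x).trans (region_mono ?_))
  rintro y (rfl | hy)
  exacts [Set.mem_insert _ _, Set.mem_insert_of_mem _ hy]

theorem commAlg_cAlg : Pairwise fun x y => CommAlg (cAlg o par L R x) (cAlg o par L R y) := by
  intro x y hxy
  refine CommAlg.sup_left (CommAlg.sup_right ((h.comm hxy).mono relComm_le relComm_le)
    (CommAlg.region_right fun w _ => h.commAlg_relComm_R x w)) (CommAlg.region_left fun w hw =>
    CommAlg.sup_right (h.commAlg_relComm_R y w).symm (CommAlg.region_right fun w' hw' =>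
      h.commAlg_R ?_))
  rintro rfl
  exact hxy (hw.2.symm.trans hw'.2)

theorem commAlg_region_cAlg {Y Z : Set V} (hd : Disjoint Y Z) :
    CommAlg (region (cAlg o par L R) Y) (region (cAlg o par L R) Z) :=
  CommAlg.region_region fun _ hx _ hy => h.commAlg_cAlg fun e => Set.disjoint_left.1 hd hx (e ▸ hy)

theorem center_le_relComm (x : V) : relComm (R x) (R x) ≤ relComm (R x) (L x) := fun _ hz =>
  mem_relComm.2 ⟨(h.sep x).le (mem_relComm.1 hz).1, (mem_relComm.1 hz).2⟩

theorem center_le_cAlg (x : V) : relComm (R x) (R x) ≤ cAlg o par L R x :=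
  (h.center_le_relComm x).trans le_sup_left

omit h in
theorem center_le_cAlg_of_mem_kids {x y : V} (hy : y ∈ kids o par x) :
    relComm (R y) (R y) ≤ cAlg o par L R x :=
  relComm_le.trans ((le_region hy).trans le_sup_right)

theorem commute_center {x : V} {z : M} (hz : z ∈ relComm (R x) (R x)) {Y : Set V} :
    ∀ c ∈ region (cAlg o par L R) Y, Commute z c := by
  refine commute_region fun w _ => commute_sup (fun c hc => ?_) (commute_region fun y _ c hc => ?_)
  · exact (h.commAlg_relComm_R w x c hc z (mem_relComm.1 hz).1).symm
  · exact h.commAlg_relComm_R x y z (h.center_le_relComm x hz) c hc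

theorem commute_center_cAlg {x w : V} {z : M} (hz : z ∈ relComm (R x) (R x)) {c : M}
    (hc : c ∈ cAlg o par L R w) : Commute z c :=
  h.commute_center hz (Y := {w}) c (by rwa [region_singleton])

/-- `R y` has been moved to the parent of `y`, so below `y` only observables commuting with it
remain. Dually, `R y` is all that crosses the edge above `y` from below, which is the content of
`region_cAlg_compl_desc_le`. -/
theorem region_cAlg_desc_le (y : V) : region (cAlg o par L R) (desc par y) ≤
    relComm (R y) (region L (desc par y)) := by
  intro b hb
  refine mem_relComm.2 ⟨region_le (fun w hw => (h.cAlg_le w).trans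
    (region_mono (h.rooted.fam_subset_desc hw))) hb, fun r hr => ?_⟩
  refine (commute_region (fun w hw => commute_sup (fun c hc => ?_)
    (commute_region fun w' hw' c hc => ?_)) b hb).symm
  · exact (h.commAlg_relComm_R w y c hc r hr).symm
  · refine h.commAlg_R ?_ r hr c hc
    rintro rfl
    have h1 := h.rooted.lev_le_of_mem_desc hw
    have h2 := h.rooted.lev_of_mem_kids hw'
    omega

theorem region_cAlg_compl_desc_le (y : V) : region (cAlg o par L R) (desc par y)ᶜ ≤
    region L (desc par y)ᶜ ⊔ R y := by
  refine region_le fun w hw => sup_le (relComm_le.trans ((le_region hw).trans le_sup_left))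
    (region_le fun w' hw' => ?_)
  by_cases hw'y : w' ∈ desc par y
  · rcases h.rooted.mem_desc_iff.1 hw'y with rfl | ⟨-, h2⟩
    · exact le_sup_right
    · rw [hw'.2] at h2
      exact absurd h2 hw
  · exact (h.sep w').le.trans ((le_region hw'y).trans le_sup_left)

theorem exists_reduce (y : V) {b : M} (hb : b ∈ region (cAlg o par L R) (desc par y)) :
    ∃ e ∈ relComm (R y) (R y), ∀ X ∈ region L (desc par y)ᶜ ⊔ R y, φ (X * b) = φ (X * e) := by
  obtain ⟨e, he, heq⟩ := (h.sep y).reduce b (h.region_cAlg_desc_le y hb)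
  refine ⟨e, he, fun X hX => ?_⟩
  have hc : CommAlg (region L (desc par y)ᶜ) (R y) := h.commAlg_compl.mono le_rfl
    ((h.sep y).le.trans (le_region (self_mem_desc y)))
  refine mem_of_mem_sup hc (LinearMap.eqLocus (φ ∘ₗ LinearMap.mulRight ℂ b)
    (φ ∘ₗ LinearMap.mulRight ℂ e)) ?_ hX
  intro a ha r hr
  exact heq a ha r hr

/-- Conditional independence of the descendants of `y` and of the other vertices, given the value
of the centre of `R y`. -/
theorem map_mul_atom (y : V) {p : M} (hp : p ∈ relComm (R y) (R y))
    (hsc : ∀ z ∈ relComm (R y) (R y), ∃ c : ℂ, z * p = c • p)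
    {X b : M} (hX : X ∈ region (cAlg o par L R) (desc par y)ᶜ)
    (hb : b ∈ region (cAlg o par L R) (desc par y)) :
    φ p * φ (p * X * b) = φ (p * X) * φ (p * b) := by
  obtain ⟨e, he, heq⟩ := h.exists_reduce y hb
  obtain ⟨c, hc⟩ := hsc e he
  have hpR : p ∈ region L (desc par y)ᶜ ⊔ R y :=
    (le_sup_right : R y ≤ _) (mem_relComm.1 hp).1
  have hpX := h.commute_center hp X hX
  have hpe : p * e = c • p := by
    rw [((mem_relComm.1 he).2 p (mem_relComm.1 hp).1).eq.symm, hc]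
  have h1 : φ (p * X * b) = c * φ (p * X) := by
    rw [heq _ (mul_mem hpR (h.region_cAlg_compl_desc_le y hX)), hpX.eq, mul_assoc, hpe,
      mul_smul_comm, map_smul, smul_eq_mul]
  have h2 : φ (p * b) = c * φ p := by
    rw [heq p hpR, hpe, map_smul, smul_eq_mul]
  rw [h1, h2]
  ring

/-- Every `R x` is recovered from the algebra of the parent, and at the root it is trivial. -/
theorem region_R_sup_relComm_le : region (fun x => R x ⊔ relComm (R x) (L x)) Set.univ ≤
    region (cAlg o par L R) Set.univ := by
  have h0 : ∀ x, cAlg o par L R x ≤ region (cAlg o par L R) Set.univ := fun x =>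
    le_region (Set.mem_univ x)
  have h3 : ∀ x, relComm (R x) (L x) ≤ cAlg o par L R x := fun x => le_sup_left
  refine region_le fun x _ => sup_le ?_ ((h3 x).trans (h0 x))
  by_cases hx : x = o
  · rw [hx, h.root]
    exact bot_le
  · have h1 : R x ≤ region R (kids o par (par x)) := le_region ⟨hx, rfl⟩
    have h2 : R x ≤ cAlg o par L R (par x) := h1.trans le_sup_right
    exact h2.trans (h0 (par x))

/-- The reduction from local observables to the algebras `cAlg`. -/
theorem region_induction (K : Submodule ℂ M)
    (hK : ∀ x, ∀ (n : ℕ) (p : Fin n → M), IsAtoms (relComm (R x) (R x)) p →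
      ∀ a ∈ region L Set.univ, pinch p a ∈ K → a ∈ K)
    (h0 : ∀ b ∈ region (cAlg o par L R) Set.univ, b ∈ K) : ∀ a ∈ region L Set.univ, a ∈ K := by
  have hfd : ∀ x, FiniteDimensional ℂ (R x) := fun x =>
    have := h.fd x
    finiteDimensional_of_le (h.sep x).le
  have hfdZ : ∀ x, FiniteDimensional ℂ (relComm (R x) (R x)) := fun x =>
    have := hfd x
    finiteDimensional_of_le relComm_le
  choose n p hp using fun x => exists_isAtoms (relComm (R x) (R x)) fun a ha b hb =>
    (mem_relComm.1 ha).2 b (mem_relComm.1 hb).1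
  have hZL : ∀ x, relComm (R x) (R x) ≤ L x := fun x => relComm_le.trans (h.sep x).le
  -- A pinched site observable commutes with the centre of `R x`, so it lies in the algebra
  -- generated by `R x` and its relative commutant.
  refine region_univ_induction (B := fun x => R x ⊔ relComm (R x) (L x)) K (fun x => pinch (p x))
    h.comm (fun x => sup_le (h.sep x).le relComm_le) (fun x a ha => ?_) (fun x a ha t ht htK => ?_)
    fun b hb => h0 b (h.region_R_sup_relComm_le hb)
  · refine mem_sup_relComm (h.sep x).le ?_ fun z hz => (hp x).commute_pinch a hz
    rw [pinch_apply]
    exact sum_mem fun i _ => mul_mem (hZL x ((hp x).mem i)) (mul_mem ha (hZL x ((hp x).mem i)))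
  · refine hK x (n x) (p x) (hp x) _ (mul_mem (region_mono (Set.subset_univ _) ht)
      (le_region (Set.mem_univ x) ha)) ?_
    rw [(hp x).pinch_mul_left fun z hz => h.commAlg (Y := {x}ᶜ) (Z := {x}) disjoint_compl_left t ht z
      (by rw [region_singleton]; exact hZL x hz)]
    exact htK

/-- The centre of `R x` is in the centralizer of the state. -/
theorem map_center_mul (x : V) {z : M} (hz : z ∈ relComm (R x) (R x)) {a : M}
    (ha : a ∈ region L Set.univ) : φ (z * a) = φ (a * z) := by
  rw [← Set.compl_union_self (desc par x), region_union] at ha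
  refine mem_of_mem_sup h.commAlg_compl (LinearMap.eqLocus (φ ∘ₗ LinearMap.mulLeft ℂ z)
    (φ ∘ₗ LinearMap.mulRight ℂ z)) ?_ ha
  intro a ha b hb
  change φ (z * (a * b)) = φ (a * b * z)
  have hza : a * z = z * a := h.commAlg_compl a ha z
    (le_region (self_mem_desc x) ((h.sep x).le (mem_relComm.1 hz).1))
  rw [← (h.sep x).central z hz a ha b hb, hza, mul_assoc]

/-- The abelian algebras `D x`: maximal abelian subalgebras of `cAlg x` that lie in the
centralizer of the state. -/
theorem exists_diag : ∃ D : V → StarSubalgebra ℂ M, ∀ x, IsMasa (D x) (cAlg o par L R x) ∧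
    ∀ d ∈ D x, ∀ a ∈ cAlg o par L R x, φ (d * a) = φ (a * d) := by
  have := h.finiteDimensional_cAlg
  choose D hD using fun x => exists_isMasa_centralizer (cAlg o par L R x)
    (h.pos.mono (le_top : cAlg o par L R x ≤ ⊤))
  exact ⟨D, hD⟩

variable (hD : ∀ x, IsMasa (D x) (cAlg o par L R x) ∧
    ∀ d ∈ D x, ∀ a ∈ cAlg o par L R x, φ (d * a) = φ (a * d))
include hD

/-- The centre of `R x` commutes with all the algebras `cAlg`, so any maximal abelian subalgebra of
one that contains it must include it. This applies at `x` and at the parent of `x`; both ends of the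
edge see the same central variable. -/
theorem center_le_diag (x : V) : relComm (R x) (R x) ≤ D x := fun z hz =>
  (hD x).1.maximal z (h.center_le_cAlg x hz) fun _ hd =>
    h.commute_center_cAlg hz ((hD x).1.le hd)

theorem center_le_diag_of_mem_kids {x y : V} (hy : y ∈ kids o par x) :
    relComm (R y) (R y) ≤ D x := fun z hz =>
  (hD x).1.maximal z (center_le_cAlg_of_mem_kids hy hz) fun _ hd =>
    h.commute_center_cAlg hz ((hD x).1.le hd)

omit h in
theorem region_diag_le (Y : Set V) : region D Y ≤ region (cAlg o par L R) Y :=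
  region_le fun x hx => (hD x).1.le.trans (le_region hx)

theorem commute_diag {x y : V} {a b : M} (ha : a ∈ D x) (hb : b ∈ D y) : Commute a b := by
  by_cases hxy : x = y
  · subst hxy
    exact (hD x).1.comm a ha b hb
  · exact h.commAlg_cAlg hxy a ((hD x).1.le ha) b ((hD y).1.le hb)

theorem commAlg_diag (Y Z : Set V) : CommAlg (region D Y) (region D Z) :=
  CommAlg.region_region fun _ _ _ _ _ ha _ hb => h.commute_diag hD ha hb

/-- The centralizer property of `D x` inside `cAlg x` survives multiplication by observables of the
other vertices, since these act only through the centres of `R x` and of the `R y` of the children.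
The children are absorbed one at a time. -/
theorem map_mul_commutator {x : V} {d : M} (hd : d ∈ D x) (T : Finset V)
    (hT : ∀ y ∈ T, y ∈ kids o par x) : ∀ c ∈ cAlg o par L R x,
    ∀ a ∈ region (cAlg o par L R) ((desc par x)ᶜ ∪ ⋃ y ∈ T, desc par y),
      φ (a * (d * c - c * d)) = 0 := by
  classical
  have hdC := (hD x).1.le hd
  induction T using Finset.induction_on with
  | empty =>
    intro c hc a ha
    have ha' : a ∈ region (cAlg o par L R) (desc par x)ᶜ := by simpa using ha
    have hbC : d * c - c * d ∈ cAlg o par L R x := sub_mem (mul_mem hdC hc) (mul_mem hc hdC)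
    obtain ⟨e, he, heq⟩ := h.exists_reduce x (le_region (self_mem_desc x) hbC)
    have hes := star_mem he
    have hesR : star e ∈ region L (desc par x)ᶜ ⊔ R x :=
      (le_sup_right : R x ≤ _) (mem_relComm.1 hes).1
    -- The commutator is replaced by a central `e`. Testing against `star e`, which lies in `cAlg x`
    -- and commutes with `d`, gives φ(e* e) = 0.
    have h1 : φ (star e * (d * c - c * d)) = 0 := by
      have h2 := (hD x).2 d hd (star e * c) (mul_mem (h.center_le_cAlg x hes) hc)
      have h3 : d * (star e * c) = star e * (d * c) := by
        rw [← mul_assoc, ← (h.commute_center_cAlg hes hdC).eq, mul_assoc]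
      rw [h3, mul_assoc] at h2
      rw [mul_sub, map_sub, h2, sub_self]
    rw [heq _ hesR] at h1
    rw [heq _ (h.region_cAlg_compl_desc_le x ha')]
    exact h.pos.map_mul_eq_zero (StarSubalgebra.mem_top) (StarSubalgebra.mem_top) h1
  | insert y T hyT ih =>
    intro c hc a ha
    have hy := hT y (Finset.mem_insert_self y T)
    specialize ih fun w hw => hT w (Finset.mem_insert_of_mem hw)
    rw [Finset.set_biUnion_insert, Set.union_left_comm, region_union] at ha
    have hs : (desc par x)ᶜ ∪ ⋃ w ∈ T, desc par w ⊆ (desc par y)ᶜ := by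
      refine Set.union_subset (Set.compl_subset_compl.2
        (desc_subset (h.rooted.mem_desc_of_mem_kids hy))) (Set.iUnion₂_subset fun w hw => ?_)
      exact Set.disjoint_left.1 (h.rooted.kids_desc_disjoint
        (hT w (Finset.mem_insert_of_mem hw)) hy fun e => hyT (e ▸ hw))
    refine mem_of_mem_sup (h.commAlg_region_cAlg (Set.disjoint_right.2 fun w hw => hs hw))
      (LinearMap.ker (φ ∘ₗ LinearMap.mulRight ℂ (d * c - c * d))) ?_ ha
    intro b hb a' ha'
    change φ (b * a' * (d * c - c * d)) = 0
    have hxy := h.rooted.self_notMem_desc_kid hy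
    have hbC : d * c - c * d ∈ cAlg o par L R x := sub_mem (mul_mem hdC hc) (mul_mem hc hdC)
    have hX : a' * (d * c - c * d) ∈ region (cAlg o par L R) (desc par y)ᶜ :=
      mul_mem (region_mono hs ha') (le_region hxy hbC)
    have hcomm : b * (a' * (d * c - c * d)) = a' * (d * c - c * d) * b :=
      (h.commAlg_region_cAlg disjoint_compl_left _ hX b hb).symm
    obtain ⟨e, he, heq⟩ := h.exists_reduce y hb
    rw [mul_assoc, hcomm, heq _ (h.region_cAlg_compl_desc_le y hX), mul_assoc]
    -- The central element that replaces the subtree of `y` lies in `cAlg x` and commutes with `d`,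
    -- so the result is again a commutator with `d`.
    have h3 : (d * c - c * d) * e = d * (c * e) - c * e * d := by
      rw [sub_mul, mul_assoc, mul_assoc, mul_assoc, (h.commute_center_cAlg he hdC).eq]
    rw [h3]
    exact ih (c * e) (mul_mem hc (center_le_cAlg_of_mem_kids hy he)) a' ha'

theorem map_diag_mul_of_mem_cAlg {x : V} {d : M} (hd : d ∈ D x) {a : M}
    (ha : a ∈ region (cAlg o par L R) Set.univ) : φ (d * a) = φ (a * d) := by
  have hdC := (hD x).1.le hd
  rw [← Set.union_compl_self {x}, region_union, region_singleton] at ha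
  have hcx : CommAlg (cAlg o par L R x) (region (cAlg o par L R) {x}ᶜ) := by
    have := h.commAlg_region_cAlg (Y := {x}) (Z := {x}ᶜ) disjoint_compl_right
    rwa [region_singleton] at this
  refine mem_of_mem_sup hcx (LinearMap.eqLocus (φ ∘ₗ LinearMap.mulLeft ℂ d)
    (φ ∘ₗ LinearMap.mulRight ℂ d)) ?_ ha
  intro c hc a ha
  change φ (d * (c * a)) = φ (c * a * d)
  have hs : ({x}ᶜ : Set V) ⊆ (desc par x)ᶜ ∪ ⋃ y ∈ (h.finite x).toFinset, desc par y := by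
    intro w hw
    by_cases hwx : w ∈ desc par x
    · rcases h.rooted.mem_desc_iff_kids.1 hwx with rfl | ⟨y, hy, hwy⟩
      · exact absurd rfl hw
      · exact Or.inr (Set.mem_iUnion₂.2 ⟨y, by simpa using hy, hwy⟩)
    · exact Or.inl hwx
  have h1 := h.map_mul_commutator hD hd (h.finite x).toFinset (fun y hy => by simpa using hy) c hc a
    (region_mono hs ha)
  rw [mul_sub, map_sub, sub_eq_zero] at h1
  have h2 : d * (c * a) = a * (d * c) := by
    rw [← mul_assoc, hcx _ (mul_mem hdC hc) a ha]
  have h3 : c * a * d = a * (c * d) := by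
    rw [mul_assoc, ← (hcx d hdC a ha).eq, ← mul_assoc, hcx _ (mul_mem hc hdC) a ha]
  rw [h2, h3, h1]

/-- Pinching by the centre of any `R x'` preserves φ on local observables and commutes with
multiplication by `d`. So the identity passes back from the algebras `cAlg` to all local
observables. -/
theorem map_diag_mul_of_local {x : V} {d : M} (hd : d ∈ D x) :
    ∀ a ∈ region L Set.univ, φ (d * a) = φ (a * d) := by
  refine h.region_induction (LinearMap.eqLocus (φ ∘ₗ LinearMap.mulLeft ℂ d)
    (φ ∘ₗ LinearMap.mulRight ℂ d)) (fun x' n p hp a ha hpa => ?_)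
    fun b hb => h.map_diag_mul_of_mem_cAlg hD hd hb
  change φ (d * a) = φ (a * d)
  change φ (d * pinch p a) = φ (pinch p a * d) at hpa
  have hdL : d ∈ region L Set.univ := region_mono (Set.subset_univ _)
    (h.cAlg_le x ((hD x).1.le hd))
  have hpd : ∀ i, Commute (p i) d := fun i => h.commute_center_cAlg (hp.mem i) ((hD x).1.le hd)
  have hpL : ∀ i, p i ∈ region L Set.univ := fun i => le_region (Set.mem_univ x')
    ((h.sep x').le (mem_relComm.1 (hp.mem i)).1)
  have hdZ : ∀ z ∈ relComm (R x') (R x'), Commute d z := fun z hz =>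
    (h.commute_center_cAlg hz ((hD x).1.le hd)).symm
  have key : ∀ b ∈ region L Set.univ, φ (pinch p b) = φ b := by
    intro b hb
    rw [pinch_apply, map_sum]
    calc ∑ i, φ (p i * (b * p i)) = ∑ i, φ (b * p i) :=
          Finset.sum_congr rfl fun i _ => by
            rw [h.map_center_mul x' (hp.mem i) (mul_mem hb (hpL i)), mul_assoc, hp.idem]
      _ = φ b := by rw [← map_sum, ← Finset.mul_sum, hp.sum_eq, mul_one]
  rw [← key _ (mul_mem hdL ha), ← key _ (mul_mem ha hdL), hp.pinch_mul_left hdZ,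
    hp.pinch_mul_right hdZ, hpa]

end IsSepSystem

end Separating

/-! ### The conditional expectation onto the diagonal algebra -/

section CondExp

variable {M : Type*} [CStarAlgebra M]

theorem PosOn.norm_le {φ : M →ₗ[ℂ] ℂ} (h : PosOn ⊤ φ) (h1 : φ 1 = 1) (a : M) : ‖φ a‖ ≤ ‖a‖ := by
  let : PartialOrder M := CStarAlgebra.spectralOrder M
  have : StarOrderedRing M := CStarAlgebra.spectralOrderedRing M
  have e1 : 0 ≤ φ (star a * a) - (starRingEnd ℂ) (φ a) * φ a := by
    have h2 := h (a + (-φ a) • 1) trivial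
    rw [star_add_smul_mul_self] at h2
    simp only [star_one, mul_one, one_mul, map_add, map_smul, smul_eq_mul, h1, h.map_star
      (StarSubalgebra.mem_top : a ∈ _), map_neg] at h2
    convert h2 using 1
    ring
  have e2 : 0 ≤ ((‖a‖ ^ 2 : ℝ) : ℂ) - φ (star a * a) := by
    obtain ⟨c, -, hc⟩ := exists_eq_star_mul_self_of_nonneg (S := (⊤ : StarSubalgebra ℂ M))
      (by rw [StarSubalgebra.coe_top]; exact isClosed_univ) StarSubalgebra.mem_top
      (sub_nonneg.2 (CStarAlgebra.star_mul_le_algebraMap_norm_sq (a := a)))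
    have h2 := h c trivial
    rw [← hc, map_sub, Algebra.algebraMap_eq_smul_one, ← Complex.coe_smul, map_smul, h1,
      smul_eq_mul, mul_one] at h2
    exact h2
  have e3 := add_nonneg e1 e2
  have e4 := (Complex.le_def.1 e3).1
  rw [← Complex.normSq_eq_conj_mul_self, Complex.normSq_eq_norm_sq] at e4
  simp only [Complex.zero_re, Complex.add_re, Complex.sub_re, Complex.ofReal_re] at e4
  exact (pow_le_pow_iff_left₀ (norm_nonneg _) (norm_nonneg _) two_ne_zero).1 (by linarith)

theorem continuous_of_norm_le {N : Type*} [NormedAddCommGroup N] [NormedSpace ℂ N]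
    {P : M →ₗ[ℂ] N} (h : ∀ a, ‖P a‖ ≤ ‖a‖) : Continuous P :=
  AddMonoidHomClass.continuous_of_bound P 1 fun a => by rw [one_mul]; exact h a

/-- The elements that are in the centralizer of the state `φ`. -/
def stateCentralizer {φ : M →ₗ[ℂ] ℂ} (h : PosOn ⊤ φ) : StarSubalgebra ℂ M where
  carrier := {d | ∀ a, φ (d * a) = φ (a * d)}
  mul_mem' := by
    intro c d hc hd a
    rw [mul_assoc, hc, mul_assoc, hd, mul_assoc]
  add_mem' := by
    intro c d hc hd a
    rw [add_mul, mul_add, map_add, map_add, hc, hd]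
  algebraMap_mem' := by
    intro z a
    rw [Algebra.commutes]
  star_mem' := by
    intro d hd a
    have h1 := hd (star a)
    have h2 := congrArg (starRingEnd ℂ) h1
    rw [← h.map_star trivial, ← h.map_star trivial, star_mul, star_mul, star_star] at h2
    exact h2.symm

theorem commute_topologicalClosure {S : StarSubalgebra ℂ M} (hS : ∀ a ∈ S, ∀ b ∈ S, Commute a b) :
    ∀ a ∈ S.topologicalClosure, ∀ b ∈ S.topologicalClosure, Commute a b := by
  have key : ∀ t : M, (∀ b ∈ S, Commute t b) → ∀ b ∈ S.topologicalClosure, Commute t b := by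
    intro t ht b hb
    have hcl : IsClosed {b : M | t * b = b * t} :=
      isClosed_eq (continuous_const_mul t) (continuous_mul_const t)
    exact closure_minimal (s := (S : Set M)) (fun b hb => ht b hb) hcl hb
  exact fun a ha => key a fun b hb => (key b (fun c hc => hS b hb c hc) a ha).symm

namespace IsSepSystem

variable {V : Type*} {o : V} {par : V → V} {lev : V → ℕ} {L R D : V → StarSubalgebra ℂ M}
  {φ : M →ₗ[ℂ] ℂ} (h : IsSepSystem o par lev L R φ) (hD : ∀ x, IsMasa (D x) (cAlg o par L R x) ∧
    ∀ d ∈ D x, ∀ a ∈ cAlg o par L R x, φ (d * a) = φ (a * d))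
include h hD

theorem map_diag_mul {d : M} (hd : d ∈ region D Set.univ) (a : M) : φ (d * a) = φ (a * d) := by
  have hφ := continuous_of_norm_le (h.pos.norm_le h.one)
  have h1 : region D Set.univ ≤ stateCentralizer h.pos := by
    refine region_le fun x _ d hd => ?_
    have h2 : (fun a => φ (d * a)) = fun a => φ (a * d) :=
      Continuous.ext_on h.dense (hφ.comp (continuous_const_mul d)) (hφ.comp (continuous_mul_const d))
        fun a ha => h.map_diag_mul_of_local hD hd a ha
    exact fun a => congrFun h2 a
  exact h1 hd a

theorem finiteDimensional_diag (x : V) : FiniteDimensional ℂ (D x) :=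
  have := h.finiteDimensional_cAlg x
  finiteDimensional_of_le (hD x).1.le

theorem exists_atoms : ∃ (n : Finset V → ℕ) (p : ∀ F, Fin (n F) → M),
    ∀ F : Finset V, IsAtoms (region D (F : Set V)) (p F) := by
  have hfd : ∀ F : Finset V, FiniteDimensional ℂ (region D (F : Set V)) :=
    finiteDimensional_region_finset (h.finiteDimensional_diag hD)
      fun x y _ _ ha _ hb => h.commute_diag hD ha hb
  choose n p hp using fun F : Finset V => exists_isAtoms (region D (F : Set V))
    fun a ha b hb => h.commAlg_diag hD _ _ a ha b hb
  exact ⟨n, p, hp⟩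

/-- A finer pinching absorbs a coarser one. Hence pinching by the centre of `R x` or by `D x` does
not affect the eventual value once `F` contains `x`, and these pinchings reduce a local observable
to the diagonal algebra. -/
theorem exists_eventually_pinch_eq {n : Finset V → ℕ} {p : ∀ F, Fin (n F) → M}
    (hp : ∀ F : Finset V, IsAtoms (region D (F : Set V)) (p F)) :
    ∀ a ∈ region L Set.univ, ∃ b ∈ region D Set.univ, ∀ᶠ F in atTop, pinch (p F) a = b := by
  let K : Submodule ℂ M :=
    { carrier := {a | ∃ b ∈ region D Set.univ, ∀ᶠ F in atTop, pinch (p F) a = b}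
      add_mem' := by
        rintro a a' ⟨b, hb, hab⟩ ⟨b', hb', hab'⟩
        refine ⟨b + b', add_mem hb hb', ?_⟩
        filter_upwards [hab, hab'] with F h1 h2
        rw [map_add, h1, h2]
      zero_mem' := ⟨0, zero_mem _, Eventually.of_forall fun F => map_zero _⟩
      smul_mem' := by
        rintro z a ⟨b, hb, hab⟩
        refine ⟨z • b, (region D Set.univ).smul_mem hb z, ?_⟩
        filter_upwards [hab] with F h1
        rw [map_smul, h1] }
  have hK : ∀ (x : V) (m : ℕ) (q : Fin m → M) (Q : StarSubalgebra ℂ M), IsAtoms Q q → Q ≤ D x →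
      ∀ a, pinch q a ∈ K → a ∈ K := by
    rintro x m q Q hq hQ a ⟨b, hb, hab⟩
    refine ⟨b, hb, ?_⟩
    filter_upwards [hab, eventually_ge_atTop {x}] with F h1 h2
    rw [← h1, hq.pinch_pinch (hp F) (hQ.trans (le_region (Finset.singleton_subset_iff.1 h2)))]
  have hfd := h.finiteDimensional_diag hD
  choose m q hq using fun x => exists_isAtoms (D x) (hD x).1.comm
  refine h.region_induction K (fun x m q hq a _ => hK x m q _ hq (h.center_le_diag hD x) a) ?_
  refine region_univ_induction K (fun x => pinch (q x)) h.commAlg_cAlg (B := D)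
    (fun x => (hD x).1.le) (fun x a ha => ?_) (fun x a ha t ht htK => ?_) fun b hb => ?_
  · refine (hD x).1.maximal _ ?_ fun d hd => (hq x).commute_pinch a hd
    rw [pinch_apply]
    exact sum_mem fun i _ => mul_mem ((hD x).1.le ((hq x).mem i))
      (mul_mem ha ((hD x).1.le ((hq x).mem i)))
  · refine hK x _ _ _ (hq x) le_rfl _ ?_
    rw [(hq x).pinch_mul_left fun d hd => h.commAlg_region_cAlg (Y := {x}ᶜ) (Z := {x})
      disjoint_compl_left t ht d (by rw [region_singleton]; exact (hD x).1.le hd)]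
    exact htK
  · exact ⟨b, hb, Eventually.of_forall fun F =>
      (hp F).pinch_eq_self fun d hd => h.commAlg_diag hD _ _ b hb d hd⟩

/-- The conditional expectation onto the diagonal algebra. -/
theorem exists_condExp : ∃ P : M →ₗ[ℂ] M,
    (∀ a, P a ∈ (region D Set.univ).topologicalClosure) ∧
    (∀ a, (∀ b ∈ (region D Set.univ).topologicalClosure, a * b = b * a) → P a = a) ∧
    (∀ a, ‖P a‖ ≤ ‖a‖) ∧
    (∀ a, ∃ b ∈ (region D Set.univ).topologicalClosure, P (star a * a) = star b * b) ∧
    (∀ b ∈ (region D Set.univ).topologicalClosure, ∀ a, P (b * a) = b * P a) ∧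
    (∀ b ∈ (region D Set.univ).topologicalClosure, ∀ a, P (a * b) = P a * b) ∧
    ∀ a, φ (P a) = φ a := by
  classical
  obtain ⟨n, p, hp⟩ := h.exists_atoms hD
  have hev := h.exists_eventually_pinch_eq hD hp
  obtain ⟨P, hP⟩ := exists_limit_of_dense (fun F => pinch (p F)) (fun F a => (hp F).norm_pinch_le a)
    h.dense fun a ha => (hev a ha).imp fun b hb => hb.2
  have hnorm : ∀ a, ‖P a‖ ≤ ‖a‖ := fun a =>
    le_of_tendsto' (hP a).norm fun F => (hp F).norm_pinch_le a
  have hcl : IsClosed ((region D Set.univ).topologicalClosure : Set M) :=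
    StarSubalgebra.isClosed_topologicalClosure _
  have hle : region D Set.univ ≤ (region D Set.univ).topologicalClosure :=
    StarSubalgebra.le_topologicalClosure _
  have hPcont := continuous_of_norm_le hnorm
  have hφ := continuous_of_norm_le (h.pos.norm_le h.one)
  have hmem : ∀ a, P a ∈ (region D Set.univ).topologicalClosure := by
    intro a
    refine closure_minimal (s := (region L Set.univ : Set M)) (fun a ha => ?_)
      (hcl.preimage hPcont) (h.dense a)
    obtain ⟨b, hb, hab⟩ := hev a ha
    have h1 : P a = b := tendsto_nhds_unique (hP a) (tendsto_const_nhds.congr' (hab.mono fun F h1 => h1.symm))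
    change P a ∈ (region D Set.univ).topologicalClosure
    rw [h1]
    exact hle hb
  have hDF : ∀ F : Finset V, region D (F : Set V) ≤ (region D Set.univ).topologicalClosure :=
    fun F => (region_mono (Set.subset_univ _)).trans hle
  have hcomm := commute_topologicalClosure (h.commAlg_diag hD Set.univ Set.univ)
  refine ⟨P, hmem, fun a ha => ?_, hnorm, fun a => ?_, fun b hb a => ?_, fun b hb a => ?_, fun a => ?_⟩
  -- An element that commutes with the diagonal algebra is fixed by every pinching and so by the
  -- limit; maximality of the diagonal algebra rests on this.
  · exact tendsto_nhds_unique (hP a) (tendsto_const_nhds.congr fun F =>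
      ((hp F).pinch_eq_self fun d hd => ha d (hDF F hd)).symm)
  · let : PartialOrder M := CStarAlgebra.spectralOrder M
    have : StarOrderedRing M := CStarAlgebra.spectralOrderedRing M
    refine exists_eq_star_mul_self_of_nonneg hcl (hmem _) (ge_of_tendsto' (hP (star a * a)) fun F => ?_)
    rw [(hp F).pinch_star_mul_self]
    exact Finset.sum_nonneg fun i _ => star_mul_self_nonneg _
  · refine tendsto_nhds_unique (hP (b * a)) (((hP a).const_mul b).congr fun F => ?_)
    exact ((hp F).pinch_mul_left (fun d hd => hcomm b hb d (hDF F hd)) a).symm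
  · refine tendsto_nhds_unique (hP (a * b)) (((hP a).mul_const b).congr fun F => ?_)
    exact ((hp F).pinch_mul_right (fun d hd => hcomm b hb d (hDF F hd)) a).symm
  · refine tendsto_nhds_unique ((hφ.tendsto _).comp (hP a)) (tendsto_const_nhds.congr fun F => ?_)
    exact ((hp F).map_pinch (fun d hd a => h.map_diag_mul hD (region_mono (Set.subset_univ _) hd) a)
      a).symm

end IsSepSystem

end CondExp

/-! ### The Markov property -/

section Markov

variable {M : Type*} [CStarAlgebra M] {V : Type*}

/-- Conditionally on the projection `s`, the algebras `D x` with `x ∈ Y` and with `x ∉ Y` are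
independent under `φ`. -/
def Factors (D : V → StarSubalgebra ℂ M) (φ : M →ₗ[ℂ] ℂ) (s : M) (Y : Set V) : Prop :=
  ∀ u ∈ region D Y, ∀ v ∈ region D Yᶜ, φ s * φ (s * (u * v)) = φ (s * u) * φ (s * v)

variable {D : V → StarSubalgebra ℂ M} {φ : M →ₗ[ℂ] ℂ}

theorem PosOn.map_proj_mul_eq_zero (h : PosOn ⊤ φ) {s : M} (hs : star s = s) (hss : s * s = s)
    (h0 : φ s = 0) (a : M) : φ (s * a) = 0 := by
  have := h.map_star_mul_eq_zero' (a := a) (b := s) trivial trivial (by rw [hs, hss, h0])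
  rwa [hs] at this

theorem Factors.compl (hc : ∀ a ∈ region D Set.univ, ∀ b ∈ region D Set.univ, Commute a b) {s : M}
    {Y : Set V} (h : Factors D φ s Y) : Factors D φ s Yᶜ := by
  intro u hu v hv
  rw [compl_compl] at hv
  rw [(hc u (region_mono (Set.subset_univ _) hu) v (region_mono (Set.subset_univ _) hv)).eq,
    h v hv u hu, mul_comm]

/-- Conditioning on a further projection that is measurable with respect to one side. -/
theorem Factors.mul_of_mem_compl (hφ : PosOn ⊤ φ)
    (hc : ∀ a ∈ region D Set.univ, ∀ b ∈ region D Set.univ, Commute a b) {s q : M} {Y : Set V}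
    (h : Factors D φ s Y) (hs : star s = s) (hss : s * s = s) (hsD : s ∈ region D Set.univ)
    (hq : q ∈ region D Yᶜ) : Factors D φ (q * s) Y := by
  have hqD := region_mono (Set.subset_univ _) hq
  have hqs : q * s = s * q := hc q hqD s hsD
  intro u hu v hv
  have huq : q * u = u * q := hc q hqD u (region_mono (Set.subset_univ _) hu)
  have e1 : q * s * (u * v) = s * (u * (q * v)) := by
    rw [hqs, mul_assoc, ← mul_assoc q u, huq, mul_assoc]
  have e2 : q * s * u = s * (u * q) := by rw [hqs, mul_assoc, huq]
  have e3 : q * s * v = s * (q * v) := by rw [hqs, mul_assoc]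
  have f1 := h u hu (q * v) (mul_mem hq hv)
  have f2 := h u hu q hq
  by_cases h0 : φ s = 0
  · have hz := hφ.map_proj_mul_eq_zero hs hss h0
    rw [hqs, hz, zero_mul, mul_assoc s q u, hz, zero_mul]
  · rw [e1, e2, e3, hqs]
    apply mul_left_cancel₀ h0
    linear_combination φ (s * q) * f1 - φ (s * (q * v)) * f2

theorem Factors.mul_of_mem (hφ : PosOn ⊤ φ)
    (hc : ∀ a ∈ region D Set.univ, ∀ b ∈ region D Set.univ, Commute a b) {s q : M} {Y : Set V}
    (h : Factors D φ s Y) (hs : star s = s) (hss : s * s = s) (hsD : s ∈ region D Set.univ)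
    {x : V} (hq : q ∈ D x) : Factors D φ (q * s) Y := by
  by_cases hx : x ∈ Y
  · have h1 := (h.compl hc).mul_of_mem_compl hφ hc hs hss hsD (q := q)
      (by rw [compl_compl]; exact le_region hx hq)
    have h2 := h1.compl hc
    rwa [compl_compl] at h2
  · exact h.mul_of_mem_compl hφ hc hs hss hsD (le_region (Y := Yᶜ) hx hq)

/-- `p` is a minimal projection of `Z`. -/
structure IsMinProj (Z : StarSubalgebra ℂ M) (p : M) : Prop where
  mem : p ∈ Z
  star_eq : star p = p
  idem : p * p = p
  scalar : ∀ z ∈ Z, ∃ c : ℂ, z * p = c • p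

namespace IsSepSystem

variable {o : V} {par : V → V} {lev : V → ℕ} {L R : V → StarSubalgebra ℂ M}
  (h : IsSepSystem o par lev L R φ) (hD : ∀ x, IsMasa (D x) (cAlg o par L R x) ∧
    ∀ d ∈ D x, ∀ a ∈ cAlg o par L R x, φ (d * a) = φ (a * d))
include h hD

/-- Passing to the factorization over a cut edge with one colour below it. -/
theorem factors_of_desc_subset {x : V} {p s : M} (hp : IsMinProj (relComm (R x) (R x)) p)
    (hs : s ∈ region D (desc par x)ᶜ) {Y : Set V} (hY : desc par x ⊆ Y)
    (hf : Factors D φ (p * s) (Y \ desc par x)) : Factors D φ (p * s) Y := by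
  have hc := h.commAlg_diag hD Set.univ Set.univ
  have hu' : ∀ {Z : Set V} {a : M}, a ∈ region D Z → a ∈ region D Set.univ :=
    fun ha => region_mono (Set.subset_univ _) ha
  have hle := fun Z => region_diag_le hD Z
  intro u hu v hv
  have hvd : v ∈ region D (desc par x)ᶜ := region_mono (Set.compl_subset_compl.2 hY) hv
  rw [← Set.sdiff_union_of_subset hY, region_union] at hu
  rw [mul_comm (φ (p * s * u))]
  refine mem_of_mem_sup (h.commAlg_diag hD _ _)
    (LinearMap.eqLocus (φ (p * s) • (φ ∘ₗ LinearMap.mulLeft ℂ (p * s) ∘ₗ LinearMap.mulRight ℂ v))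
    (φ (p * s * v) • (φ ∘ₗ LinearMap.mulLeft ℂ (p * s)))) ?_ hu
  intro a ha b hb
  change φ (p * s) * φ (p * s * (a * b * v)) = φ (p * s * v) * φ (p * s * (a * b))
  have had : a ∈ region D (desc par x)ᶜ := region_mono (fun _ hw => hw.2) ha
  -- Independence across the edge above `x` is used twice, with and without `v`. Together with the
  -- factorization above the edge this gives the claim after cancelling φ(p).
  have e1 := h.map_mul_atom x hp.mem hp.scalar (X := s * (a * v)) (b := b)
    (hle _ (mul_mem hs (mul_mem had hvd))) (hle _ hb)
  have e2 := h.map_mul_atom x hp.mem hp.scalar (X := s * a) (b := b)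
    (hle _ (mul_mem hs had)) (hle _ hb)
  have e3 := hf a ha v (region_mono (Set.compl_subset_compl.2 Set.sdiff_subset) hv)
  have hbv : b * v = v * b := hc b (hu' hb) v (hu' hv)
  have r1 : p * s * (a * b * v) = p * (s * (a * v)) * b := by
    rw [mul_assoc a b v, hbv]; simp only [mul_assoc]
  have r2 : p * s * (a * b) = p * (s * a) * b := by simp only [mul_assoc]
  rw [r1, r2]
  rw [mul_assoc p s (a * v), mul_assoc p s a] at e3
  by_cases h0 : φ p = 0
  · have hz := h.pos.map_proj_mul_eq_zero hp.star_eq hp.idem h0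
    simp only [mul_assoc, hz, mul_zero]
  · apply mul_left_cancel₀ h0
    linear_combination φ (p * s) * e1 + φ (p * b) * e3 - φ (p * s * v) * e2

/-- Cut the edge above each `x ∈ X`. If `Y` is a union of components, then conditionally on all
atoms at the cut edges, `Y` and its complement are independent; `s` is the product of these atoms.
Cut vertices are added in order of level. -/
theorem exists_factors (p : V → M) (X : Finset V) (hXo : o ∉ X)
    (hp : ∀ x ∈ X, IsMinProj (relComm (R x) (R x)) (p x)) :
    ∃ s ∈ region D (X : Set V), star s = s ∧ s * s = s ∧
      (∀ q, (∀ x ∈ X, q * p x = q) → q * s = q) ∧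
      ∀ Y : Set V, (∀ w, w ≠ o → w ∉ X → (w ∈ Y ↔ par w ∈ Y)) → Factors D φ s Y := by
  classical
  have hc := h.commAlg_diag hD Set.univ Set.univ
  induction X using Finset.induction_on_max_value lev with
  | empty =>
    refine ⟨1, one_mem _, star_one _, mul_one _, fun q _ => mul_one q, fun Y hY => ?_⟩
    -- Without cuts, membership in `Y` is constant along the tree, so `Y` is everything or empty.
    have key : ∀ Y : Set V, o ∈ Y → (∀ w, w ≠ o → (w ∈ Y ↔ par w ∈ Y)) → Factors D φ 1 Y := by
      intro Y ho hY
      have hYu : Yᶜ = ∅ := Set.compl_empty_iff.2 (Set.eq_univ_of_forall fun w =>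
        h.rooted.desc_induction (P := fun w => w ∈ Y) (fun w hw => by
          by_cases hwo : w = o
          · rw [hwo]; exact ho
          · exact (hY w hwo).2 (hw hwo)) w)
      intro u _ v hv
      rw [hYu, region_empty] at hv
      obtain ⟨c, rfl⟩ := StarSubalgebra.mem_bot.1 hv
      rw [Algebra.algebraMap_eq_smul_one]
      simp [h.one, mul_comm]
    by_cases ho : o ∈ Y
    · exact key Y ho fun w hw => hY w hw (Finset.notMem_empty w)
    · have h1 := (key Yᶜ ho fun w hw => not_congr (hY w hw (Finset.notMem_empty w))).compl hc
      rwa [compl_compl] at h1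
  | insert x X hxX hmax ih =>
    obtain ⟨s, hsX, hss, hsi, hsq, hsf⟩ := ih (fun ho => hXo (Finset.mem_insert_of_mem ho))
      fun w hw => hp w (Finset.mem_insert_of_mem hw)
    have hpx := hp x (Finset.mem_insert_self x X)
    have hxo : x ≠ o := fun e => hXo (e ▸ Finset.mem_insert_self x X)
    have hpD : p x ∈ D x := h.center_le_diag hD x hpx.mem
    have hpD' : p x ∈ D (par x) := h.center_le_diag_of_mem_kids hD ⟨hxo, rfl⟩ hpx.mem
    have hsD : s ∈ region D Set.univ := region_mono (Set.subset_univ _) hsX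
    have hpu : p x ∈ region D Set.univ := le_region (Set.mem_univ x) hpD
    have hps : p x * s = s * p x := hc _ hpu _ hsD
    -- The new cut vertex has maximal level, so its whole subtree is one component.
    have hXd : (X : Set V) ⊆ (desc par x)ᶜ := by
      intro w hw hwx
      have h1 := h.rooted.lev_lt_of_mem_desc hwx fun e => hxX (e ▸ hw)
      exact absurd (hmax w hw) (not_le.2 h1)
    refine ⟨p x * s, mul_mem (le_region (by simp) hpD) (region_mono (by simp) hsX), ?_, ?_, ?_, ?_⟩
    · rw [star_mul, hss, hpx.star_eq, hps]
    · calc p x * s * (p x * s) = p x * (s * p x) * s := by simp only [mul_assoc]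
        _ = p x * p x * (s * s) := by rw [← hps]; simp only [mul_assoc]
        _ = p x * s := by rw [hpx.idem, hsi]
    · intro q hq
      rw [← mul_assoc, hq x (Finset.mem_insert_self x X),
        hsq q fun w hw => hq w (Finset.mem_insert_of_mem hw)]
    · have key : ∀ Y : Set V, (∀ w, w ≠ o → w ∉ insert x X → (w ∈ Y ↔ par w ∈ Y)) → x ∈ Y →
          par x ∉ Y → Factors D φ (p x * s) Y := by
        intro Y hY hxY hxY'
        have hdY : ∀ w, w ∈ desc par x → w ∈ Y := by
          refine fun w => h.rooted.desc_induction (P := fun w => w ∈ desc par x → w ∈ Y)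
            (fun w hw hwx => ?_) w
          by_cases hwx' : w = x
          · rw [hwx']; exact hxY
          · rcases h.rooted.mem_desc_iff.1 hwx with h1 | ⟨hwo, h1⟩
            · exact absurd h1 hwx'
            · refine (hY w hwo ?_).2 (hw hwo h1)
              rw [Finset.mem_insert, not_or]
              exact ⟨hwx', fun hwX => hXd hwX hwx⟩
        refine h.factors_of_desc_subset hD hpx (region_mono hXd hsX) hdY ?_
        -- The subtree of `x` is given the colour of its parent, after which the edge above `x` need
        -- not be cut and the induction hypothesis applies.
        refine (hsf (Y \ desc par x) fun w hwo hwX => ?_).mul_of_mem h.pos hc hss hsi hsD hpD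
        by_cases hwx : w ∈ desc par x
        · rcases h.rooted.mem_desc_iff.1 hwx with h1 | ⟨-, h1⟩
          · subst h1
            exact ⟨fun hh => absurd hwx hh.2, fun hh => absurd hh.1 hxY'⟩
          · exact ⟨fun hh => absurd hwx hh.2, fun hh => absurd h1 hh.2⟩
        · have h1 : par w ∉ desc par x := fun h1 => hwx (h.rooted.mem_desc_iff.2 (Or.inr ⟨hwo, h1⟩))
          have h2 : w ≠ x := fun e => hwx (by rw [e]; exact self_mem_desc x)
          have h3 := hY w hwo (by rw [Finset.mem_insert, not_or]; exact ⟨h2, hwX⟩)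
          exact ⟨fun hh => ⟨h3.1 hh.1, h1⟩, fun hh => ⟨h3.2 hh.1, hwx⟩⟩
      intro Y hY
      by_cases hx : x ∈ Y
      · by_cases hx' : par x ∈ Y
        · refine (hsf Y fun w hwo hwX => ?_).mul_of_mem h.pos hc hss hsi hsD hpD
          by_cases hwx : w = x
          · rw [hwx]; exact iff_of_true hx hx'
          · exact hY w hwo (by rw [Finset.mem_insert, not_or]; exact ⟨hwx, hwX⟩)
        · exact key Y hY hx hx'
      · by_cases hx' : par x ∈ Y
        · have h1 := (key Yᶜ (fun w hwo hw => not_congr (hY w hwo hw)) hx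
            (fun hh => hh hx')).compl hc
          rwa [compl_compl] at h1
        · refine (hsf Y fun w hwo hwX => ?_).mul_of_mem h.pos hc hss hsi hsD hpD
          by_cases hwx : w = x
          · rw [hwx]; exact iff_of_false hx hx'
          · exact hY w hwo (by rw [Finset.mem_insert, not_or]; exact ⟨hwx, hwX⟩)

omit hD in
-- A minimal projection of a larger commutative algebra lies below an atom of the centre: some atom
-- has a nonzero product with it, and that product is a scalar multiple of it, with scalar 1.
theorem exists_minProj {Q : StarSubalgebra ℂ M} {q : M} (hq : IsMinProj Q q) (hq0 : q ≠ 0) {x : V}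
    (hx : relComm (R x) (R x) ≤ Q) (hQ : ∀ a ∈ Q, ∀ b ∈ Q, Commute a b) :
    ∃ p, IsMinProj (relComm (R x) (R x)) p ∧ q * p = q := by
  have := h.fd x
  have : FiniteDimensional ℂ (relComm (R x) (R x)) :=
    finiteDimensional_of_le (relComm_le.trans (h.sep x).le)
  obtain ⟨n, p, hp⟩ := exists_isAtoms (relComm (R x) (R x)) fun a ha b hb =>
    (mem_relComm.1 ha).2 b (mem_relComm.1 hb).1
  have h1 : ∃ i, p i * q ≠ 0 := by
    by_contra! hall
    apply hq0
    rw [← one_mul q, ← hp.sum_eq, Finset.sum_mul]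
    exact Finset.sum_eq_zero fun i _ => hall i
  obtain ⟨i, hi⟩ := h1
  refine ⟨p i, ⟨hp.mem i, hp.star_eq i, hp.idem i, fun z hz => hp.scalar z hz i⟩, ?_⟩
  obtain ⟨c, hc⟩ := hq.scalar (p i) (hx (hp.mem i))
  have h2 : c • (c • q) = c • q := by
    rw [← hc, ← mul_smul_comm, ← hc, ← mul_assoc, hp.idem]
  have hc0 : c ≠ 0 := by
    rintro rfl
    rw [zero_smul] at hc
    exact hi hc
  have h3 := smul_right_injective M hc0 h2
  have h4 : p i * q = q := hc.trans h3
  rw [(hQ q hq.mem (p i) (hx (hp.mem i))).eq, h4]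

/-- The Markov property: conditionally on a minimal projection of the boundary algebra, the
algebras inside and outside of `Λ` are independent. -/
theorem factors_of_boundary {Λ B : Set V} (hΛ : Λ.Finite) (hBΛ : B ⊆ Λᶜ)
    (hB : ∀ w, w ≠ o → w ∈ Λ → par w ∉ Λ → par w ∈ B)
    (hB' : ∀ w, w ≠ o → w ∉ Λ → par w ∈ Λ → w ∈ B) {q : M}
    (hq : IsMinProj (region D B) q) (hq0 : q ≠ 0) : Factors D φ q Λ := by
  classical
  have hc := h.commAlg_diag hD Set.univ Set.univ
  -- The edges between Λ and its complement, each given by its lower end. Its central algebra lies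
  -- in the diagonal algebra at both ends, hence in the boundary algebra.
  have hfin : {w | w ≠ o ∧ ¬(w ∈ Λ ↔ par w ∈ Λ)}.Finite := by
    refine (hΛ.union (hΛ.biUnion fun x _ => h.finite x)).subset fun w hw => ?_
    by_cases hwΛ : w ∈ Λ
    · exact Or.inl hwΛ
    · have : par w ∈ Λ := by
        by_contra hpw
        exact hw.2 (iff_of_false hwΛ hpw)
      exact Or.inr (Set.mem_iUnion₂.2 ⟨par w, this, hw.1, rfl⟩)
  have hex : ∀ w, w ∈ hfin.toFinset → ∃ p, IsMinProj (relComm (R w) (R w)) p ∧ q * p = q := by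
    intro w hw
    obtain ⟨hwo, hw⟩ := hfin.mem_toFinset.1 hw
    refine h.exists_minProj hq hq0 ?_ (h.commAlg_diag hD _ _)
    by_cases hwΛ : w ∈ Λ
    · have h1 : par w ∉ Λ := fun hpw => hw (iff_of_true hwΛ hpw)
      exact (h.center_le_diag_of_mem_kids hD ⟨hwo, rfl⟩).trans (le_region (hB w hwo hwΛ h1))
    · have h1 : par w ∈ Λ := by
        by_contra hpw
        exact hw (iff_of_false hwΛ hpw)
      exact (h.center_le_diag hD w).trans (le_region (hB' w hwo hwΛ h1))
  choose! p hp hqp using hex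
  obtain ⟨s, hsX, hss, hsi, hsq, hsf⟩ := h.exists_factors hD p hfin.toFinset
    (fun ho => (hfin.mem_toFinset.1 ho).1 rfl) hp
  have hsf' := hsf Λ fun w hwo hw => by
    by_contra hcon
    exact hw (hfin.mem_toFinset.2 ⟨hwo, hcon⟩)
  -- The projection `q` refines the product `s` of the edge atoms and lives outside of Λ, so
  -- conditioning further on it keeps the independence.
  have := hsf'.mul_of_mem_compl h.pos hc hss hsi (region_mono (Set.subset_univ _) hsX)
    (region_mono hBΛ hq.mem)
  rwa [hsq q hqp] at this

end IsSepSystem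

end Markov

/-! ### States on commutative C*-algebras -/

section Riesz

open WeakDual CompactlySupported

variable {N : Type*} [CommCStarAlgebra N]

/-- A real function on the spectrum as an element of the algebra. -/
def ofRealFun (f : C_c(characterSpace ℂ N, ℝ)) : N :=
  (gelfandStarTransform N).symm
    (ContinuousMap.comp ⟨Complex.ofReal, Complex.continuous_ofReal⟩ f.toContinuousMap)

theorem apply_ofRealFun (f : C_c(characterSpace ℂ N, ℝ)) (χ : characterSpace ℂ N) :
    χ (ofRealFun f) = f χ := by
  have h1 : gelfandStarTransform N (ofRealFun f) = _ :=
    (gelfandStarTransform N).apply_symm_apply _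
  exact DFunLike.congr_fun h1 χ

theorem ext_characterSpace {a b : N} (h : ∀ χ : characterSpace ℂ N, χ a = χ b) : a = b :=
  EquivLike.injective (gelfandStarTransform N) (ContinuousMap.ext fun χ => h χ)

theorem star_ofRealFun (f : C_c(characterSpace ℂ N, ℝ)) : star (ofRealFun f) = ofRealFun f := by
  refine ext_characterSpace fun χ => ?_
  rw [map_star, apply_ofRealFun]
  exact Complex.conj_ofReal _

theorem ofRealFun_add (f g : C_c(characterSpace ℂ N, ℝ)) :
    ofRealFun (f + g) = ofRealFun f + ofRealFun g := by
  refine ext_characterSpace fun χ => ?_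
  rw [map_add, apply_ofRealFun, apply_ofRealFun, apply_ofRealFun]
  simp

theorem ofRealFun_smul (c : ℝ) (f : C_c(characterSpace ℂ N, ℝ)) :
    ofRealFun (c • f) = (c : ℂ) • ofRealFun f := by
  refine ext_characterSpace fun χ => ?_
  rw [map_smul, apply_ofRealFun, apply_ofRealFun]
  simp

/-- The compactly supported function with a given continuous function on the spectrum. -/
def toCc (f : C(characterSpace ℂ N, ℝ)) : C_c(characterSpace ℂ N, ℝ) :=
  ⟨f, HasCompactSupport.of_compactSpace f⟩

theorem exists_star_mul_self (f g : C_c(characterSpace ℂ N, ℝ)) (hfg : f ≤ g) :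
    ∃ b : N, ofRealFun g = ofRealFun f + star b * b := by
  have hf := f.continuous
  have hg := g.continuous
  refine ⟨ofRealFun (toCc ⟨fun χ => Real.sqrt (g χ - f χ), by fun_prop⟩), ?_⟩
  refine ext_characterSpace fun χ => ?_
  rw [star_ofRealFun, map_add, map_mul, apply_ofRealFun, apply_ofRealFun, apply_ofRealFun]
  change ((g χ : ℝ) : ℂ) = f χ + (Real.sqrt (g χ - f χ) : ℂ) * (Real.sqrt (g χ - f χ) : ℂ)
  rw [← Complex.ofReal_mul, Real.mul_self_sqrt (sub_nonneg.2 (hfg χ)), ← Complex.ofReal_add]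
  congr 1
  ring

variable [MeasurableSpace (characterSpace ℂ N)] [BorelSpace (characterSpace ℂ N)]

/-- A state on a commutative C*-algebra is the integral with respect to a probability measure on
the spectrum. -/
theorem exists_measure_of_state {φ : N →ₗ[ℂ] ℂ} (hφ : PosOn ⊤ φ) (h1 : φ 1 = 1) :
    ∃ μ : Measure (characterSpace ℂ N), IsProbabilityMeasure μ ∧
      ∀ b : N, φ b = ∫ χ : characterSpace ℂ N, χ b ∂μ := by
  let Λ : C_c(characterSpace ℂ N, ℝ) →ₚ[ℝ] ℝ :=
    { toFun := fun f => (φ (ofRealFun f)).re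
      map_add' := fun f g => by rw [ofRealFun_add, map_add, Complex.add_re]
      map_smul' := fun c f => by
        rw [ofRealFun_smul, map_smul, smul_eq_mul, Complex.re_ofReal_mul]; rfl
      monotone' := fun f g hfg => by
        obtain ⟨b, hb⟩ := exists_star_mul_self f g hfg
        change (φ (ofRealFun f)).re ≤ (φ (ofRealFun g)).re
        rw [hb, map_add, Complex.add_re]
        have := (Complex.le_def.1 (hφ b trivial)).1
        rw [Complex.zero_re] at this
        linarith }
  have hΛ : ∀ f, φ (ofRealFun f) = ((Λ f : ℝ) : ℂ) := by
    intro f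
    have h2 := hφ.map_star (StarSubalgebra.mem_top : ofRealFun f ∈ (⊤ : StarSubalgebra ℂ N))
    rw [star_ofRealFun] at h2
    exact (Complex.conj_eq_iff_re.1 h2.symm).symm
  let μ := RealRMK.rieszMeasure Λ
  have hint : ∀ f : C_c(characterSpace ℂ N, ℝ), ∫ χ, f χ ∂μ = Λ f := fun f =>
    RealRMK.integral_rieszMeasure Λ f
  have hfin : IsFiniteMeasure μ := inferInstanceAs (IsFiniteMeasure (RealRMK.rieszMeasure Λ))
  have hformula : ∀ b : N, φ b = ∫ χ : characterSpace ℂ N, χ b ∂μ := by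
    intro b
    have hcont : Continuous fun χ : characterSpace ℂ N => χ b :=
      (gelfandStarTransform N b).continuous
    have hI : Integrable (fun χ : characterSpace ℂ N => χ b) μ :=
      hcont.integrable_of_hasCompactSupport (HasCompactSupport.of_compactSpace _)
    let f : C_c(characterSpace ℂ N, ℝ) := toCc ⟨fun χ => (χ b).re, Complex.continuous_re.comp hcont⟩
    let g : C_c(characterSpace ℂ N, ℝ) := toCc ⟨fun χ => (χ b).im, Complex.continuous_im.comp hcont⟩
    have hb : b = ofRealFun f + Complex.I • ofRealFun g := by
      refine ext_characterSpace fun χ => ?_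
      rw [map_add, map_smul, apply_ofRealFun, apply_ofRealFun, smul_eq_mul, mul_comm]
      exact (Complex.re_add_im (χ b)).symm
    have h3 := integral_re_add_im hI
    have h4 : φ b = φ (ofRealFun f + Complex.I • ofRealFun g) := congrArg φ hb
    rw [h4, map_add, map_smul, hΛ, hΛ, ← hint, ← hint, ← h3, smul_eq_mul, mul_comm Complex.I]
    rfl
  refine ⟨μ, ⟨?_⟩, hformula⟩
  have h2 := hformula 1
  simp only [map_one, h1] at h2
  rw [integral_const, Complex.real_smul, mul_one] at h2
  have h3 : μ.real Set.univ = 1 := by exact_mod_cast h2.symm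
  exact (ENNReal.toReal_eq_one_iff _).1 h3

end Riesz

/-! ### Markov random fields on the spectrum -/

section Field

open WeakDual

variable {M : Type*} [CStarAlgebra M] {V : Type*} {𝒟 : StarSubalgebra ℂ M}

/-- The event that the projection `p` has the value `1`. -/
def projEvent (p : 𝒟) : Set (characterSpace ℂ 𝒟) := {χ | χ p = 1}

theorem continuous_eval (a : 𝒟) : Continuous fun χ : characterSpace ℂ 𝒟 => χ a :=
  (WeakDual.eval_continuous a).comp continuous_subtype_val

theorem character_map_star (hcl : IsClosed (𝒟 : Set M)) (χ : characterSpace ℂ 𝒟) (a : 𝒟) :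
    χ (star a) = (starRingEnd ℂ) (χ a) :=
  have := hcl
  map_star χ a

theorem eval_eq_zero_or_one {p : 𝒟} (hp : p * p = p) (χ : characterSpace ℂ 𝒟) :
    χ p = 0 ∨ χ p = 1 := by
  have h1 := congrArg χ hp
  rw [map_mul] at h1
  by_cases h0 : χ p = 0
  · exact Or.inl h0
  · exact Or.inr (mul_left_cancel₀ h0 (by rw [h1, mul_one]))

theorem projEvent_mul {p q : 𝒟} (hp : p * p = p) (hq : q * q = q) :
    projEvent (p * q) = projEvent p ∩ projEvent q := by
  ext χ
  change χ (p * q) = 1 ↔ χ p = 1 ∧ χ q = 1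
  rw [map_mul]
  rcases eval_eq_zero_or_one hp χ with h1 | h1 <;> rcases eval_eq_zero_or_one hq χ with h2 | h2 <;>
    simp [h1, h2]

theorem eval_eq_indicator {p : 𝒟} (hp : p * p = p) :
    (fun χ : characterSpace ℂ 𝒟 => χ p) = (projEvent p).indicator fun _ => (1 : ℂ) := by
  classical
  funext χ
  rw [Set.indicator_apply]
  split_ifs with h1
  · exact h1
  · exact (eval_eq_zero_or_one hp χ).resolve_right h1

/-- The σ-algebra generated by the characters on the algebras `D x`, `x ∈ Y`. -/
@[reducible] def fieldAlg (D : V → StarSubalgebra ℂ M) (𝒟 : StarSubalgebra ℂ M) (Y : Set V) :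
    MeasurableSpace (characterSpace ℂ 𝒟) :=
  ⨆ (a : 𝒟) (_ : ∃ x ∈ Y, (a : M) ∈ D x),
    MeasurableSpace.comap (fun χ : characterSpace ℂ 𝒟 => χ a) (borel ℂ)

/-- The projections of the algebra over `Y` as events. -/
def projEvents (D : V → StarSubalgebra ℂ M) (𝒟 : StarSubalgebra ℂ M) (Y : Set V) :
    Set (Set (characterSpace ℂ 𝒟)) :=
  {S | ∃ p : 𝒟, (p : M) ∈ region D Y ∧ p * p = p ∧ S = projEvent p}

variable {D : V → StarSubalgebra ℂ M} {Y : Set V}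

theorem isPiSystem_projEvents (hc : ∀ a ∈ 𝒟, ∀ b ∈ 𝒟, Commute a b) :
    IsPiSystem (projEvents D 𝒟 Y) := by
  rintro _ ⟨p, hpY, hp, rfl⟩ _ ⟨q, hqY, hq, rfl⟩ -
  refine ⟨p * q, mul_mem hpY hqY, ?_, (projEvent_mul hp hq).symm⟩
  have hpq : q * p = p * q := Subtype.ext (hc q q.2 p p.2)
  calc p * q * (p * q) = p * (q * p) * q := by simp only [mul_assoc]
    _ = p * p * (q * q) := by rw [hpq]; simp only [mul_assoc]
    _ = p * q := by rw [hp, hq]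

theorem measurable_eval (hcl : IsClosed (𝒟 : Set M)) (hD : ∀ x, D x ≤ 𝒟) {p : 𝒟}
    (hp : (p : M) ∈ region D Y) :
    Measurable[fieldAlg D 𝒟 Y] fun χ : characterSpace ℂ 𝒟 => χ p := by
  let S : StarSubalgebra ℂ M :=
    { carrier := {a | ∃ ha : a ∈ 𝒟, Measurable[fieldAlg D 𝒟 Y]
        fun χ : characterSpace ℂ 𝒟 => χ ⟨a, ha⟩}
      mul_mem' := by
        rintro a b ⟨ha, hma⟩ ⟨hb, hmb⟩
        refine ⟨mul_mem ha hb, ?_⟩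
        have e : (fun χ : characterSpace ℂ 𝒟 => χ ⟨a * b, mul_mem ha hb⟩)
            = fun χ => χ ⟨a, ha⟩ * χ ⟨b, hb⟩ := funext fun χ => map_mul χ ⟨a, ha⟩ ⟨b, hb⟩
        rw [e]
        exact hma.mul hmb
      add_mem' := by
        rintro a b ⟨ha, hma⟩ ⟨hb, hmb⟩
        refine ⟨add_mem ha hb, ?_⟩
        have e : (fun χ : characterSpace ℂ 𝒟 => χ ⟨a + b, add_mem ha hb⟩)
            = fun χ => χ ⟨a, ha⟩ + χ ⟨b, hb⟩ := funext fun χ => map_add χ ⟨a, ha⟩ ⟨b, hb⟩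
        rw [e]
        exact hma.add hmb
      algebraMap_mem' := by
        intro z
        refine ⟨𝒟.algebraMap_mem z, ?_⟩
        have e : (fun χ : characterSpace ℂ 𝒟 => χ ⟨algebraMap ℂ M z, 𝒟.algebraMap_mem z⟩)
            = fun _ => z := funext fun χ => AlgHomClass.commutes χ z
        rw [e]
        exact measurable_const
      star_mem' := by
        rintro a ⟨ha, hma⟩
        refine ⟨star_mem ha, ?_⟩
        have e : (fun χ : characterSpace ℂ 𝒟 => χ ⟨star a, star_mem ha⟩)
            = fun χ => (starRingEnd ℂ) (χ ⟨a, ha⟩) :=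
          funext fun χ => character_map_star hcl χ ⟨a, ha⟩
        rw [e]
        exact Complex.continuous_conj.measurable.comp hma }
  have hS : region D Y ≤ S := region_le fun x hx a ha => ⟨hD x ha, by
    rw [measurable_iff_comap_le]
    exact le_iSup₂_of_le (⟨a, hD x ha⟩ : 𝒟) ⟨x, hx, ha⟩ le_rfl⟩
  exact (hS hp).2

/-- The elements of the finite-dimensional `D x` are simple functions over their atoms. The events
of projections form a π-system, so independence can be tested on them. -/
theorem fieldAlg_eq_generateFrom (hcl : IsClosed (𝒟 : Set M)) (hD : ∀ x, D x ≤ 𝒟)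
    (hfd : ∀ x, FiniteDimensional ℂ (D x)) (hc : ∀ a ∈ 𝒟, ∀ b ∈ 𝒟, Commute a b) :
    fieldAlg D 𝒟 Y = MeasurableSpace.generateFrom (projEvents D 𝒟 Y) := by
  apply le_antisymm
  · refine iSup₂_le fun a ha => ?_
    obtain ⟨x, hx, hax⟩ := ha
    have := hfd x
    obtain ⟨n, p, hp⟩ := exists_isAtoms (D x) fun a ha b hb => hc a (hD x ha) b (hD x hb)
    obtain ⟨c, hca⟩ := hp.eq_sum hax
    have e : (fun χ : characterSpace ℂ 𝒟 => χ a)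
        = fun χ => ∑ i, c i * (projEvent (⟨p i, hD x (hp.mem i)⟩ : 𝒟)).indicator (fun _ => (1 : ℂ)) χ := by
      funext χ
      have h1 : a = ∑ i, c i • (⟨p i, hD x (hp.mem i)⟩ : 𝒟) := Subtype.ext (by rw [hca]; simp)
      rw [h1, map_sum]
      refine Finset.sum_congr rfl fun i _ => ?_
      rw [map_smul, smul_eq_mul]
      congr 1
      exact congrFun (eval_eq_indicator (p := (⟨p i, hD x (hp.mem i)⟩ : 𝒟))
        (Subtype.ext (hp.idem i))) χ
    refine Measurable.comap_le (m₂ := borel ℂ) ?_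
    rw [e]
    refine Finset.measurable_sum _ fun i _ => measurable_const.mul
      (measurable_const.indicator (MeasurableSpace.measurableSet_generateFrom
        ⟨_, le_region hx (hp.mem i), Subtype.ext (hp.idem i), rfl⟩))
  · refine MeasurableSpace.generateFrom_le ?_
    rintro _ ⟨p, hpY, hp, rfl⟩
    exact measurable_eval hcl hD hpY (measurableSet_singleton (1 : ℂ))

/-- The cylinder sets over finite-dimensional boundary algebras are the events of minimal
projections. -/
theorem exists_minProj_cylinder (hcl : IsClosed (𝒟 : Set M)) (hD : ∀ x, D x ≤ 𝒟)
    (hc : ∀ a ∈ 𝒟, ∀ b ∈ 𝒟, Commute a b) {B : Set V} [FiniteDimensional ℂ (region D B)]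
    (ω : characterSpace ℂ 𝒟) :
    ∃ q : 𝒟, IsMinProj (region D B) (q : M) ∧ (q : M) ≠ 0 ∧
      {χ : characterSpace ℂ 𝒟 | ∀ x ∈ B, ∀ a : 𝒟, (a : M) ∈ D x → χ a = ω a} = projEvent q := by
  have hB : region D B ≤ 𝒟 := region_le fun x _ => hD x
  obtain ⟨n, p, hp⟩ := exists_isAtoms (region D B) fun a ha b hb => hc a (hB ha) b (hB hb)
  let P : Fin n → 𝒟 := fun i => ⟨p i, hB (hp.mem i)⟩
  have hP : ∀ i, P i * P i = P i := fun i => Subtype.ext (hp.idem i)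
  have hex : ∃ i, ω (P i) = 1 := by
    by_contra! hall
    have h1 : ∑ i, P i = 1 := Subtype.ext (by simpa [P] using hp.sum_eq)
    have h2 := congrArg ω h1
    rw [map_sum, map_one, Finset.sum_eq_zero fun i _ =>
      (eval_eq_zero_or_one (hP i) ω).resolve_right (hall i)] at h2
    exact zero_ne_one h2
  obtain ⟨i, hi⟩ := hex
  refine ⟨P i, ⟨hp.mem i, hp.star_eq i, hp.idem i, fun z hz => hp.scalar z hz i⟩, hp.ne_zero i, ?_⟩
  ext χ
  constructor
  · intro hχ
    let S : StarSubalgebra ℂ M :=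
      { carrier := {a | ∃ ha : a ∈ 𝒟, χ ⟨a, ha⟩ = ω ⟨a, ha⟩}
        mul_mem' := by
          rintro a b ⟨ha, hma⟩ ⟨hb, hmb⟩
          have e : ∀ χ : characterSpace ℂ 𝒟, χ ⟨a * b, mul_mem ha hb⟩ = χ ⟨a, ha⟩ * χ ⟨b, hb⟩ :=
            fun χ => map_mul χ ⟨a, ha⟩ ⟨b, hb⟩
          exact ⟨mul_mem ha hb, by rw [e, e, hma, hmb]⟩
        add_mem' := by
          rintro a b ⟨ha, hma⟩ ⟨hb, hmb⟩
          have e : ∀ χ : characterSpace ℂ 𝒟, χ ⟨a + b, add_mem ha hb⟩ = χ ⟨a, ha⟩ + χ ⟨b, hb⟩ :=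
            fun χ => map_add χ ⟨a, ha⟩ ⟨b, hb⟩
          exact ⟨add_mem ha hb, by rw [e, e, hma, hmb]⟩
        algebraMap_mem' := fun z => ⟨𝒟.algebraMap_mem z,
          (AlgHomClass.commutes χ z).trans (AlgHomClass.commutes ω z).symm⟩
        star_mem' := by
          rintro a ⟨ha, hma⟩
          exact ⟨star_mem ha, (character_map_star hcl χ ⟨a, ha⟩).trans
            ((congrArg _ hma).trans (character_map_star hcl ω ⟨a, ha⟩).symm)⟩ }
    have hS : region D B ≤ S := region_le fun x hx a ha => ⟨hD x ha, hχ x hx ⟨a, hD x ha⟩ ha⟩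
    exact (hS (hp.mem i)).2.trans hi
  · intro hχ x hx a ha
    obtain ⟨c, hca⟩ := hp.scalar a (le_region hx ha) i
    have h1 : a * P i = c • P i := Subtype.ext hca
    have key : ∀ χ : characterSpace ℂ 𝒟, χ (P i) = 1 → χ a = c := by
      intro χ h2
      have h3 := congrArg χ h1
      rwa [map_mul, map_smul, h2, mul_one, smul_eq_mul, mul_one] at h3
    rw [key χ hχ, key ω hi]

variable [MeasurableSpace (characterSpace ℂ 𝒟)] [BorelSpace (characterSpace ℂ 𝒟)]

/-- On projections φ is the measure of the corresponding event, so `Factors` is the product formula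
for conditional probabilities on the generating π-systems. A null condition gives the zero measure.
-/
theorem indep_of_factors (hcl : IsClosed (𝒟 : Set M)) (hD : ∀ x, D x ≤ 𝒟)
    (hfd : ∀ x, FiniteDimensional ℂ (D x)) (hc : ∀ a ∈ 𝒟, ∀ b ∈ 𝒟, Commute a b)
    {μ : Measure (characterSpace ℂ 𝒟)} [IsProbabilityMeasure μ] {φ : M →ₗ[ℂ] ℂ}
    (hμ : ∀ b : 𝒟, φ b = ∫ χ : characterSpace ℂ 𝒟, χ b ∂μ) {q : 𝒟} (hq : q * q = q)
    (hf : Factors D φ q Y) :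
    Indep (fieldAlg D 𝒟 Y) (fieldAlg D 𝒟 Yᶜ) (ProbabilityTheory.cond μ (projEvent q)) := by
  have hmeas : ∀ p : 𝒟, MeasurableSet (projEvent p) := fun p =>
    (continuous_eval p).measurable (measurableSet_singleton (1 : ℂ))
  have hφ : ∀ p : 𝒟, p * p = p → φ p = (μ.real (projEvent p) : ℂ) := by
    intro p hp
    rw [hμ, eval_eq_indicator hp, integral_indicator_const _ (hmeas p)]
    simp
  have hle : ∀ Z, fieldAlg D 𝒟 Z ≤ ‹MeasurableSpace (characterSpace ℂ 𝒟)› := fun Z =>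
    iSup₂_le fun a _ => (continuous_eval a).measurable.comap_le
  refine IndepSets.indep (hle _) (hle _) (isPiSystem_projEvents hc) (isPiSystem_projEvents hc)
    (fieldAlg_eq_generateFrom hcl hD hfd hc) (fieldAlg_eq_generateFrom hcl hD hfd hc) ?_
  rw [IndepSets_iff]
  rintro _ _ ⟨u, huY, hu, rfl⟩ ⟨v, hvY, hv, rfl⟩
  have hcc : ∀ a b : 𝒟, a * b = b * a := fun a b => Subtype.ext (hc a a.2 b b.2)
  have hmul : ∀ a b : 𝒟, a * a = a → b * b = b → a * b * (a * b) = a * b := by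
    intro a b ha hb
    calc a * b * (a * b) = a * (b * a) * b := by simp only [mul_assoc]
      _ = a * a * (b * b) := by rw [hcc b a]; simp only [mul_assoc]
      _ = a * b := by rw [ha, hb]
  have h1 := hf u huY v hvY
  have e1 := hφ q hq
  have e2 := hφ (q * u) (hmul _ _ hq hu)
  have e3 := hφ (q * v) (hmul _ _ hq hv)
  have e4 := hφ (q * (u * v)) (hmul _ _ hq (hmul _ _ hu hv))
  rw [projEvent_mul hq hu] at e2
  rw [projEvent_mul hq hv] at e3
  rw [projEvent_mul hq (hmul _ _ hu hv), projEvent_mul hu hv] at e4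
  simp only [MulMemClass.coe_mul] at e2 e3 e4
  rw [e1, e2, e3, e4] at h1
  have h2 : μ.real (projEvent q) * μ.real (projEvent q ∩ (projEvent u ∩ projEvent v))
      = μ.real (projEvent q ∩ projEvent u) * μ.real (projEvent q ∩ projEvent v) := by
    exact_mod_cast h1
  have h3 : μ (projEvent q) * μ (projEvent q ∩ (projEvent u ∩ projEvent v))
      = μ (projEvent q ∩ projEvent u) * μ (projEvent q ∩ projEvent v) := by
    rw [← ENNReal.toReal_eq_toReal_iff' (ENNReal.mul_ne_top (measure_ne_top _ _) (measure_ne_top _ _))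
      (ENNReal.mul_ne_top (measure_ne_top _ _) (measure_ne_top _ _)), ENNReal.toReal_mul,
      ENNReal.toReal_mul]
    exact h2
  rw [cond_apply (hmeas q), cond_apply (hmeas q), cond_apply (hmeas q)]
  by_cases h0 : μ (projEvent q) = 0
  · have hz : ∀ S, μ (projEvent q ∩ S) = 0 := fun S => measure_mono_null Set.inter_subset_left h0
    rw [hz, hz, hz, mul_zero, zero_mul]
  · have h4 : (μ (projEvent q))⁻¹ * μ (projEvent q) = 1 :=
      ENNReal.inv_mul_cancel h0 (measure_ne_top _ _)
    calc (μ (projEvent q))⁻¹ * μ (projEvent q ∩ (projEvent u ∩ projEvent v))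
        = (μ (projEvent q))⁻¹ * ((μ (projEvent q))⁻¹ * (μ (projEvent q)
          * μ (projEvent q ∩ (projEvent u ∩ projEvent v)))) := by
          rw [← mul_assoc (μ (projEvent q))⁻¹ (μ (projEvent q)), h4, one_mul]
      _ = _ := by rw [h3]; ring

end Field

/-! ### Localized quantum Markov states as Markov systems -/

theorem coe_inclusion {N : Type*} [Semiring N] [StarRing N] [Algebra ℂ N] [StarModule ℂ N]
    {S T : StarSubalgebra ℂ N} (h : S ≤ T) (a : S) : (StarSubalgebra.inclusion h a : N) = a := rfl

section Extension

variable {V : Type*} {G : SimpleGraph V} {o : V} {d : V → ℕ} [∀ x, NeZero (d x)]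
  {𝒜 : ∀ x, StarSubalgebra ℂ (Matrix (Fin (d x)) (Fin (d x)) ℂ)}
  {E : ∀ n, ballAlg G o 𝒜 (n + 1) →ₗ[ℂ] ballAlg G o 𝒜 n}

/-- The state and the maps Eₙ live on different subalgebras. Arbitrary linear extensions to all
operators allow composing and iterating them without coercions; only the original values are ever
used. -/
theorem exists_extend_linear {W U : Type*} [AddCommGroup W] [Module ℂ W] [AddCommGroup U]
    [Module ℂ U] {A : Type*} [AddCommGroup A] [Module ℂ A] (i : A →ₗ[ℂ] W)
    (hi : Function.Injective i) (f : A →ₗ[ℂ] U) : ∃ g : W →ₗ[ℂ] U, ∀ a, g (i a) = f a := by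
  obtain ⟨s, hs⟩ := i.exists_leftInverse_of_injective (LinearMap.ker_eq_bot.2 hi)
  exact ⟨f ∘ₗ s, fun a => congrArg f (LinearMap.congr_fun hs a)⟩

theorem IsQuantumMarkovChain.map_of_mem {φ : quasiLocal 𝒜 →ₗ[ℂ] ℂ}
    (h : IsQuantumMarkovChain G o 𝒜 φ E) {n : ℕ} (a : ballAlg G o 𝒜 (n + 1))
    (ha : (a : Op d) ∈ locAlg 𝒜 {x | G.dist o x < n}) : (E n a : Op d) = a := by
  have := (h.quasiCondExp n).map_mul a 1 ha
  rw [(h.quasiCondExp n).map_one, mul_one] at this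
  simpa using this

theorem IsQuantumMarkovChain.chain_succ {φ : quasiLocal 𝒜 →ₗ[ℂ] ℂ}
    (h : IsQuantumMarkovChain G o 𝒜 φ E) {n : ℕ} (b : ballAlg G o 𝒜 (n + 1)) (c : ballAlg G o 𝒜 n)
    (hbc : (b : Op d) = c) (hb : (b : Op d) ∈ locAlg 𝒜 {x | G.dist o x < n}) :
    chain E (n + 1) b = chain E n c :=
  congrArg (chain E n) (Subtype.ext ((h.map_of_mem b hb).trans hbc))

theorem IsQuantumMarkovChain.chain_add {φ : quasiLocal 𝒜 →ₗ[ℂ] ℂ}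
    (h : IsQuantumMarkovChain G o 𝒜 φ E) {m : ℕ} (a : ballAlg G o 𝒜 m) (c : ballAlg G o 𝒜 (m + 1))
    (hc : (c : Op d) = a) : ∀ (k : ℕ) (b : ballAlg G o 𝒜 (m + 1 + k)), (b : Op d) = a →
      chain E (m + 1 + k) b = chain E (m + 1) c := by
  intro k
  induction k with
  | zero => exact fun b hb => congrArg (chain E (m + 1)) (Subtype.ext (hb.trans hc.symm))
  | succ k ih =>
    intro b hb
    have hlt : (a : Op d) ∈ locAlg 𝒜 {x | G.dist o x < m + 1 + k} :=
      locAlg_mono 𝒜 (fun x (hx : G.dist o x ≤ m) => show G.dist o x < m + 1 + k by omega) a.2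
    have hle : (a : Op d) ∈ ballAlg G o 𝒜 (m + 1 + k) :=
      locAlg_mono 𝒜 (ball_mono G o (by omega)) a.2
    rw [← ih ⟨a, hle⟩ rfl]
    exact h.chain_succ b ⟨a, hle⟩ hb (hb ▸ hlt)

/-- Maps of index above the radius of the observable fix it, so the defining sequence is constant
from the first step that includes `E m` on, and the limit becomes an identity. -/
theorem IsQuantumMarkovChain.eq_chain {φ : quasiLocal 𝒜 →ₗ[ℂ] ℂ}
    (h : IsQuantumMarkovChain G o 𝒜 φ E) {m : ℕ} (a : ballAlg G o 𝒜 m) (c : ballAlg G o 𝒜 (m + 1))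
    (hc : (c : Op d) = a) : φ (incl 𝒜 _ a) = φ (incl 𝒜 _ (chain E (m + 1) c)) := by
  have key : ∀ {i k : ℕ} (_ : i = m + 1 + k) (b : ballAlg G o 𝒜 i), (b : Op d) = a →
      chain E i b = chain E (m + 1) c := by
    rintro i k rfl b hb
    exact h.chain_add a c hc k b hb
  have hlim : ∀ k ≥ 1, φ (incl 𝒜 _ (chain E (m + 1) c)) = φ (incl 𝒜 _ (chain E (m + k)
      (StarSubalgebra.inclusion (locAlg_mono 𝒜 (ball_mono G o (Nat.le_add_right m k))) a))) := by
    intro k hk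
    rw [key (show m + k = m + 1 + (k - 1) by omega) _ (coe_inclusion _ a)]
  exact tendsto_nhds_unique (h.tendsto m a)
    (tendsto_const_nhds.congr' ((eventually_ge_atTop 1).mono hlim))

theorem IsLocalizedQMS.exists_isMarkovSystem [G.LocallyFinite] (hG : G.IsTree)
    {φ : quasiLocal 𝒜 →ₗ[ℂ] ℂ} (hφ : IsState 𝒜 φ) (hM : IsLocalizedQMS G o 𝒜 φ) {par : V → V}
    (hr : IsRooted o par (G.dist o)) (hk : ∀ x, succs G o x = kids o par x) :
    ∃ (ψ : Op d →ₗ[ℂ] ℂ) (F : ℕ → Op d →ₗ[ℂ] Op d),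
      IsMarkovSystem o par (G.dist o) (fun x => locAlg 𝒜 {x}) ψ F ∧
        ∀ a : quasiLocal 𝒜, ψ a = φ a := by
  obtain ⟨E, hE, hloc⟩ := hM
  obtain ⟨ψ, hψ⟩ := exists_extend_linear (quasiLocal 𝒜).subtype.toAlgHom.toLinearMap
    Subtype.val_injective φ
  have hF : ∀ n, ∃ g : Op d →ₗ[ℂ] Op d, ∀ a : ballAlg G o 𝒜 (n + 1), g a = E n a := fun n =>
    exists_extend_linear (ballAlg G o 𝒜 (n + 1)).subtype.toAlgHom.toLinearMap
      Subtype.val_injective ((ballAlg G o 𝒜 n).subtype.toAlgHom.toLinearMap ∘ₗ E n)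
  choose F hF using hF
  change ∀ a : quasiLocal 𝒜, ψ a = φ a at hψ
  have hreg : ∀ Y : Set V, region (fun x => locAlg 𝒜 {x}) Y = locAlg 𝒜 Y := fun Y =>
    (locAlg_eq_region 𝒜 Y).symm
  have hψ' : ∀ (Y : Set V) (a : locAlg 𝒜 Y), ψ a = φ (incl 𝒜 Y a) := fun Y a =>
    hψ (incl 𝒜 Y a)
  have hball : ∀ n, lball (G.dist o) n = ball G o n := fun n => rfl
  have hfam : ∀ x, fam o par x = {x} ∪ succs G o x := fun x => by rw [hk]; rfl
  have hfamball : ∀ x, {x} ∪ succs G o x ⊆ ball G o (G.dist o x + 1) := fun x => by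
    rw [← hfam]
    exact hr.fam_subset_lball x
  have hfampreds : ∀ x, {x} ∪ succs G o x ⊆ preds G o x ∪ {x} ∪ succs G o x := fun x =>
    Set.union_subset_union_left _ Set.subset_union_right
  refine ⟨ψ, F, ?_, hψ⟩
  refine
    { rooted := hr
      comm := pairwise_commAlg_locAlg 𝒜
      fd := finiteDimensional_locAlg_singleton 𝒜
      finite := finite_ball G hG o
      ks := ?_, left := ?_, loc := ?_, mul := ?_, inv := ?_, pos := ?_, one := ?_, chain := ?_ }
  · intro n
    rw [hreg, hreg]
    exact isKS_of_form (hE.quasiCondExp n).completelyPositive (hE.quasiCondExp n).map_one (hF n)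
  · intro n c hc a ha
    rw [hreg] at hc ha
    have hc' : c ∈ ballAlg G o 𝒜 (n + 1) :=
      locAlg_mono 𝒜 (fun x (hx : G.dist o x < n) => show G.dist o x ≤ n + 1 by omega) hc
    have h1 := (hE.quasiCondExp n).map_mul ⟨c, hc'⟩ ⟨a, ha⟩ hc
    rw [← hF, ← hF] at h1
    exact h1
  · intro x a ha
    rw [hreg, hfam] at ha
    have := (hloc _ x rfl).2.1 ⟨a, locAlg_mono 𝒜 (hfamball x) ha⟩ ha
    rw [← hF] at this
    exact this
  · intro x a ha b hb
    rw [hreg, hfam] at ha hb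
    rw [hball] at hb
    have := congrArg Subtype.val ((hloc _ x rfl).2.2.1 ⟨a, locAlg_mono 𝒜 (hfamball x) ha⟩
      ⟨b, locAlg_mono 𝒜 Set.sdiff_subset hb⟩ ha hb)
    rw [← hF] at this
    refine this.trans ?_
    change (E _ _ : Op d) * (E _ _ : Op d) = _
    rw [← hF, ← hF]
  · intro x a ha
    rw [hreg, hfam] at ha
    have := (hloc _ x rfl).2.2.2 ⟨a, locAlg_mono 𝒜 (hfamball x) ha⟩
      (locAlg_mono 𝒜 (hfampreds x) ha)
    rw [← hψ', ← hψ', ← hF] at this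
    exact this
  · intro a ha
    rw [hreg] at ha
    have := hφ.nonneg (incl 𝒜 _ ⟨a, ha⟩)
    rw [← hψ] at this
    exact this
  · exact (hψ 1).trans hφ.map_one
  · have key : ∀ n (a : ballAlg G o 𝒜 n), φ (incl 𝒜 _ (chain E n a)) = pullback ψ F n a := by
      intro n
      induction n with
      | zero => exact fun a => (hψ' _ a).symm
      | succ n ih =>
        intro a
        change φ (incl 𝒜 _ (chain E n (E n a))) = pullback ψ F n (F n a)
        rw [ih, hF]
    intro n a ha
    rw [hreg] at ha
    have := hE.eq_chain ⟨a, ha⟩ ⟨a, locAlg_mono 𝒜 (ball_mono G o (Nat.le_succ n)) ha⟩ rfl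
    rw [key, ← hψ'] at this
    exact this

end Extension

/-! ### Restriction to a subalgebra -/

section Comap

variable {N : Type*} [Ring N] [StarRing N] [Algebra ℂ N] [StarModule ℂ N] {V : Type*}
  {Q : StarSubalgebra ℂ N} {A : V → StarSubalgebra ℂ N}

theorem map_comap_subtype {B : StarSubalgebra ℂ N} (hB : B ≤ Q) :
    (B.comap Q.subtype).map Q.subtype = B := by
  ext a
  constructor
  · rintro ⟨b, hb, rfl⟩
    exact hb
  · exact fun ha => ⟨⟨a, hB ha⟩, ha, rfl⟩

theorem map_region_comap (hA : ∀ x, A x ≤ Q) (Y : Set V) :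
    (region (fun x => (A x).comap Q.subtype) Y).map Q.subtype = region A Y := by
  unfold region
  simp only [(StarSubalgebra.gc_map_comap Q.subtype).l_iSup, map_comap_subtype (hA _)]

theorem mem_region_comap (hA : ∀ x, A x ≤ Q) {Y : Set V} {a : Q} :
    a ∈ region (fun x => (A x).comap Q.subtype) Y ↔ (a : N) ∈ region A Y := by
  rw [← map_region_comap hA]
  constructor
  · exact fun ha => ⟨a, ha, rfl⟩
  · rintro ⟨b, hb, h⟩
    rwa [← Subtype.ext h]

theorem mem_relComm_comap {R B : StarSubalgebra ℂ N} (hR : R ≤ Q) {a : Q} :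
    a ∈ relComm (R.comap Q.subtype) (B.comap Q.subtype) ↔ (a : N) ∈ relComm R B := by
  rw [mem_relComm, mem_relComm]
  refine and_congr Iff.rfl ⟨fun h r hr => ?_, fun h r hr => ?_⟩
  · exact congrArg Subtype.val (h ⟨r, hR hr⟩ hr).eq
  · exact Subtype.ext (h r hr).eq

theorem IsSeparating.comap {par : V → V} {ψ : N →ₗ[ℂ] ℂ} {φ : Q →ₗ[ℂ] ℂ}
    (hψ : ∀ a : Q, ψ a = φ a) (hA : ∀ x, A x ≤ Q) {x : V} {R : StarSubalgebra ℂ N}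
    (h : IsSeparating par A ψ x R) :
    IsSeparating par (fun x => (A x).comap Q.subtype) φ x (R.comap Q.subtype) := by
  have hR : R ≤ Q := h.le.trans (hA x)
  refine ⟨fun a ha => h.le ha, fun z hz a ha b hb => ?_, fun b hb => ?_⟩
  · rw [← hψ, ← hψ]
    exact h.central z ((mem_relComm_comap hR).1 hz) a ((mem_region_comap hA).1 ha) b
      ((mem_region_comap hA).1 hb)
  · have hb' : (b : N) ∈ relComm R (region A (desc par x)) := by
      rw [mem_relComm] at hb ⊢
      exact ⟨(mem_region_comap hA).1 hb.1, fun r hr => congrArg Subtype.val (hb.2 ⟨r, hR hr⟩ hr).eq⟩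
    obtain ⟨e, he, h1⟩ := h.reduce b hb'
    refine ⟨⟨e, hR (relComm_le he)⟩, (mem_relComm_comap hR).2 he, fun a ha r hr => ?_⟩
    rw [← hψ, ← hψ]
    exact h1 a ((mem_region_comap hA).1 ha) r hr

theorem finiteDimensional_comap (B : StarSubalgebra ℂ N) [FiniteDimensional ℂ B] :
    FiniteDimensional ℂ (B.comap Q.subtype) := by
  let f : (B.comap Q.subtype) →ₗ[ℂ] B :=
    { toFun := fun a => ⟨a.1.1, a.2⟩
      map_add' := fun _ _ => rfl
      map_smul' := fun _ _ => rfl }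
  exact FiniteDimensional.of_injective f fun a b hab =>
    Subtype.ext (Subtype.ext (congrArg (fun c : B => (c : N)) hab))

end Comap

/-! ### The separating system of a localized quantum Markov state. -/

section SepSystem

variable {V : Type*} {G : SimpleGraph V} {o : V} {d : V → ℕ} [∀ x, NeZero (d x)]
  {𝒜 : ∀ x, StarSubalgebra ℂ (Matrix (Fin (d x)) (Fin (d x)) ℂ)}

theorem isClosed_quasiLocal : IsClosed (quasiLocal 𝒜 : Set (Op d)) :=
  StarSubalgebra.isClosed_topologicalClosure _

attribute [local instance] isClosed_quasiLocal

theorem locAlg_le_quasiLocal (Y : Set V) : locAlg 𝒜 Y ≤ quasiLocal 𝒜 :=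
  (locAlg_mono 𝒜 (Set.subset_univ Y)).trans (StarSubalgebra.le_topologicalClosure _)

variable (𝒜) in
/-- The site algebra at `x` in the quasi-local algebra. -/
def siteAlg (x : V) : StarSubalgebra ℂ (quasiLocal 𝒜) :=
  (locAlg 𝒜 {x}).comap (quasiLocal 𝒜).subtype

theorem mem_region_siteAlg {Y : Set V} {a : quasiLocal 𝒜} :
    a ∈ region (siteAlg 𝒜) Y ↔ (a : Op d) ∈ locAlg 𝒜 Y := by
  rw [locAlg_eq_region]
  exact mem_region_comap fun x => locAlg_le_quasiLocal {x}

theorem IsLocalizedQMS.exists_isSepSystem [G.LocallyFinite] (hG : G.IsTree)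
    {φ : quasiLocal 𝒜 →ₗ[ℂ] ℂ} (hφ : IsState 𝒜 φ) (hM : IsLocalizedQMS G o 𝒜 φ) {par : V → V}
    (hr : IsRooted o par (G.dist o)) (hk : ∀ x, succs G o x = kids o par x) :
    ∃ R : V → StarSubalgebra ℂ (quasiLocal 𝒜),
      IsSepSystem o par (G.dist o) (siteAlg 𝒜) R φ := by
  classical
  obtain ⟨ψ, F, hS, hψ⟩ := hM.exists_isMarkovSystem hG hφ hr hk
  choose R hR using hS.exists_isSeparating
  -- At the root the algebra found for the Markov system is replaced by the scalars.
  have hsep : ∀ x, ∃ R : StarSubalgebra ℂ (quasiLocal 𝒜),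
      IsSeparating par (siteAlg 𝒜) φ x R ∧ (x = o → R = ⊥) := by
    intro x
    by_cases hx : x = o
    · subst hx
      exact ⟨⊥, isSeparating_bot hr hφ.map_one, fun _ => rfl⟩
    · exact ⟨_, (hR x).comap hψ fun x => locAlg_le_quasiLocal {x}, fun h => absurd h hx⟩
  choose R' hR' using hsep
  refine ⟨R',
    { rooted := hr
      finite := fun x => ?_
      comm := fun x y hxy a ha b hb => Subtype.ext (pairwise_commAlg_locAlg 𝒜 hxy a ha b hb).eq
      fd := fun x => ?_
      sep := fun x => (hR' x).1
      root := (hR' o).2 rfl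
      pos := fun a _ => hφ.nonneg a
      one := hφ.map_one
      dense := ?_ }⟩
  · exact (hS.finite (G.dist o x + 1)).subset fun y hy => (hr.lev_of_mem_kids hy).le
  · have := finiteDimensional_locAlg_singleton 𝒜 x
    exact finiteDimensional_comap _
  · rw [Topology.IsInducing.subtypeVal.dense_iff]
    intro a
    have h1 : (Subtype.val '' (region (siteAlg 𝒜) Set.univ : Set (quasiLocal 𝒜)))
        = (locAlg 𝒜 Set.univ : Set (Op d)) := by
      ext b
      constructor
      · rintro ⟨c, hc, rfl⟩
        exact mem_region_siteAlg.1 hc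
      · exact fun hb => ⟨⟨b, locAlg_le_quasiLocal _ hb⟩, mem_region_siteAlg.2 hb, rfl⟩
    exact h1.symm ▸ a.2

end SepSystem

/-! ### Measures on the spectrum of a commutative subalgebra -/

theorem exists_measure_of_subalgebra {M : Type*} [CStarAlgebra M] {𝒟 : StarSubalgebra ℂ M} (hcl : IsClosed (𝒟 : Set M))
    (hc : ∀ a ∈ 𝒟, ∀ b ∈ 𝒟, Commute a b) [MeasurableSpace (WeakDual.characterSpace ℂ 𝒟)]
    [BorelSpace (WeakDual.characterSpace ℂ 𝒟)] {φ : M →ₗ[ℂ] ℂ} (hφ : PosOn ⊤ φ) (h1 : φ 1 = 1) :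
    ∃ μ : Measure (WeakDual.characterSpace ℂ 𝒟), IsProbabilityMeasure μ ∧
      ∀ b : 𝒟, φ b = ∫ χ : WeakDual.characterSpace ℂ 𝒟, χ b ∂μ := by
  let : CommCStarAlgebra 𝒟 :=
    { (StarSubalgebra.cstarAlgebra 𝒟 (h_closed := hcl)) with
      mul_comm := fun a b => Subtype.ext (hc a a.2 b b.2) }
  exact exists_measure_of_state (N := 𝒟) (φ := φ ∘ₗ 𝒟.subtype.toAlgHom.toLinearMap)
    (fun a _ => hφ a trivial) h1

/-! ### The diagonal algebra of a separating system -/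

section Diagonal

variable {M : Type*} [CStarAlgebra M] {V : Type*} {o : V} {par : V → V} {lev : V → ℕ}
  {L R : V → StarSubalgebra ℂ M} {φ : M →ₗ[ℂ] ℂ}

/-- The diagonal algebra, its Markov random field, and the conditional expectation onto it. -/
theorem IsSepSystem.exists_diagonal (h : IsSepSystem o par lev L R φ) :
    ∃ (D : V → StarSubalgebra ℂ M) (𝒟 : StarSubalgebra ℂ M) (P : M →ₗ[ℂ] 𝒟),
      (∀ a ∈ 𝒟, ∀ b ∈ 𝒟, a * b = b * a) ∧
      (∀ a : M, (∀ b ∈ 𝒟, a * b = b * a) → a ∈ 𝒟) ∧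
      (∀ x, D x ≤ region L (fam o par x)) ∧
      𝒟 = (⨆ x, D x).topologicalClosure ∧
      (∀ a : 𝒟, P a = a) ∧
      (∀ a, ‖P a‖ ≤ ‖a‖) ∧
      (∀ a, ∃ b : 𝒟, P (star a * a) = star b * b) ∧
      (∀ (b : 𝒟) (a : M), P (b * a) = b * P a) ∧
      (∀ (a : M) (b : 𝒟), P (a * b) = P a * b) ∧
      ∀ [MeasurableSpace (WeakDual.characterSpace ℂ 𝒟)] [BorelSpace (WeakDual.characterSpace ℂ 𝒟)],
        ∃ μ : Measure (WeakDual.characterSpace ℂ 𝒟), IsProbabilityMeasure μ ∧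
          (∀ a : M, φ a = ∫ χ : WeakDual.characterSpace ℂ 𝒟, χ (P a) ∂μ) ∧
          ∀ Λ B : Set V, Λ.Finite → B.Finite → B ⊆ Λᶜ →
            (∀ w, w ≠ o → w ∈ Λ → par w ∉ Λ → par w ∈ B) →
            (∀ w, w ≠ o → w ∉ Λ → par w ∈ Λ → w ∈ B) →
            ∀ ω : WeakDual.characterSpace ℂ 𝒟, Indep (fieldAlg D 𝒟 Λ) (fieldAlg D 𝒟 Λᶜ)
              (ProbabilityTheory.cond μ {χ | ∀ x ∈ B, ∀ a : 𝒟, (a : M) ∈ D x → χ a = ω a}) := by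
  obtain ⟨D, hD⟩ := h.exists_diag
  obtain ⟨P, hP𝒟, hPmax, hPnorm, hPpos, hPl, hPr, hPφ⟩ := h.exists_condExp hD
  obtain ⟨𝒟, h𝒟⟩ : ∃ 𝒟 : StarSubalgebra ℂ M, 𝒟 = (region D Set.univ).topologicalClosure := ⟨_, rfl⟩
  rw [← h𝒟] at hP𝒟 hPmax hPpos hPl hPr
  have hcl : IsClosed (𝒟 : Set M) := h𝒟 ▸ StarSubalgebra.isClosed_topologicalClosure _
  have hc : ∀ a ∈ 𝒟, ∀ b ∈ 𝒟, Commute a b :=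
    h𝒟 ▸ commute_topologicalClosure (h.commAlg_diag hD _ _)
  have hD𝒟 : ∀ x, D x ≤ 𝒟 := fun x => h𝒟 ▸ (le_region (Set.mem_univ x)).trans
    (StarSubalgebra.le_topologicalClosure _)
  refine ⟨D, 𝒟, P.codRestrict (Subalgebra.toSubmodule 𝒟.toSubalgebra) hP𝒟, hc,
    fun a ha => hPmax a ha ▸ hP𝒟 a, fun x => (hD x).1.le.trans (h.cAlg_le x), ?_,
    fun a => Subtype.ext (hPmax a fun b hb => hc a a.2 b hb), hPnorm, fun a => ?_,
    fun b a => Subtype.ext (hPl b b.2 a), fun a b => Subtype.ext (hPr b b.2 a), ?_⟩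
  · rw [h𝒟, region]
    simp
  · obtain ⟨b, hb, hab⟩ := hPpos a
    exact ⟨⟨b, hb⟩, Subtype.ext hab⟩
  · intro _ _
    obtain ⟨μ, hμ, hφμ⟩ := exists_measure_of_subalgebra hcl hc h.pos h.one
    refine ⟨μ, hμ, fun a => ?_, fun Λ B hΛ hB hBΛ hB₁ hB₂ ω => ?_⟩
    · rw [← hPφ a]
      exact hφμ ⟨P a, hP𝒟 a⟩
    · have hfd := h.finiteDimensional_diag hD
      have : FiniteDimensional ℂ (region D B) :=
        finiteDimensional_region hfd (fun x y _ _ ha _ hb => h.commute_diag hD ha hb) hB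
      obtain ⟨q, hq, hq0, hqω⟩ := exists_minProj_cylinder hcl hD𝒟 hc (B := B) ω
      rw [hqω]
      exact indep_of_factors hcl hD𝒟 hfd hc hφμ (Subtype.ext hq.idem)
        (h.factors_of_boundary hD hΛ hBΛ hB₁ hB₂ hq hq0)

end Diagonal

end TreeQMS

end

theorem theorem4p3 {V : Type*} (G : SimpleGraph V) [G.LocallyFinite] (hG : G.IsTree) (o : V)
    (d : V → ℕ) [∀ x, NeZero (d x)]
    (𝒜 : ∀ x, StarSubalgebra ℂ (Matrix (Fin (d x)) (Fin (d x)) ℂ))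
    (φ : TreeQMS.quasiLocal 𝒜 →ₗ[ℂ] ℂ) (hφ : TreeQMS.IsState 𝒜 φ)
    (hM : TreeQMS.IsLocalizedQMS G o 𝒜 φ) :
    ∃ (D : V → StarSubalgebra ℂ (TreeQMS.quasiLocal 𝒜))
      (𝒟 : StarSubalgebra ℂ (TreeQMS.quasiLocal 𝒜))
      (μ : MeasureTheory.Measure (TreeQMS.Spec 𝒟))
      (P : TreeQMS.quasiLocal 𝒜 →ₗ[ℂ] 𝒟),
      TreeQMS.IsDiagonalAlgebra G o D 𝒟 ∧
      MeasureTheory.IsProbabilityMeasure μ ∧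
      TreeQMS.IsMarkovRandomField G D 𝒟 μ ∧
      TreeQMS.IsUmegakiCondExp 𝒟 P ∧
      ∀ a, φ a = TreeQMS.stateOfMeasure μ (P a) := by
  obtain ⟨par, hr, hk, hadj⟩ := TreeQMS.exists_isRooted G hG o
  obtain ⟨R, h⟩ := hM.exists_isSepSystem hG hφ hr hk
  have := TreeQMS.isClosed_quasiLocal (𝒜 := 𝒜)
  have hdiag := h.exists_diagonal
  obtain ⟨D, 𝒟, P, hcomm, hmax, hloc, hgen, hproj, hnorm, hpos, hleft, hright, hμ⟩ := hdiag
  obtain ⟨μ, hprob, hφμ, hind⟩ := hμ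
  refine ⟨D, 𝒟, μ, P, ⟨hcomm, hmax, fun x a ha => ?_, hgen⟩, hprob, fun Λ hΛ ω => ?_,
    ⟨hproj, hnorm, hpos, hleft, hright⟩, hφμ⟩
  · rw [hk]
    exact TreeQMS.mem_region_siteAlg.1 (hloc x ha)
  · refine hind Λ (TreeQMS.outerBoundary G Λ) hΛ ?_ (fun y hy => hy.1)
      (fun w hw hwΛ hpw => ⟨hpw, w, hwΛ, (hadj _ _).2 (Or.inl ⟨hw, rfl⟩)⟩)
      (fun w hw hwΛ hpw => ⟨hwΛ, _, hpw, (hadj _ _).2 (Or.inr ⟨hw, rfl⟩)⟩) ω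
    refine (hΛ.biUnion fun x _ => (G.neighborSet x).toFinite).subset ?_
    rintro y ⟨-, x, hx, hxy⟩
    exact Set.mem_biUnion hx hxy
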